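/- Notation. Let $\Lambda$ be the ring of symmetric functions over $\mathbb{Q}(z,w)$ in variables $\mathbf{x}=(x_1,x_2,\dots)$, with power sums $p_k$, complete symmetric functions $h_\mu$, Schur functions $s_\lambda$ and Hall pairing $\langle\cdot,\cdot\rangle$. For a partition $\lambda$ and a cell $s$ of its Young diagram let $a(s),l(s)$ be the arm and leg lengths, and put $n(\lambda)=\sum_i(i-1)\lambda_i$. Let $$\tilde H_\lambda(\mathbf{x};q,t)=t^{n(\lambda)}J_\lambda\!\left[\frac{X}{1-t^{-1}};q,t^{-1}\right]$$ be the modified Macdonald symmetric function; here $J_\lambda=\prod_{s\in\lambda}(1-q^{a(s)}t^{l(s)+1})\,P_\lambda(\mathbf{x};q,t)$, where $P_\lambda=s_\lambda+(\text{lower terms})$ are the Macdonald symmetric functions, orthogonal for $\langle p_\lambda,p_\mu\rangle_{q,t}=\delta_{\lambda\mu}z_\lambda\prod_i\frac{1-q^{\lambda_i}}{1-t^{\lambda_i}}$, and $f[X]\mapsto f[X/(1-t)]$ is the substitution $p_k\mapsto p_k/(1-t^k)$. Let $$\mathcal{H}_\lambda(z,w)=\prod_{s\in\lambda}\frac{(z^{2a(s)+1}-w^{2l(s)+1})^{2}}{(z^{2a(s)+2}-w^{2l(s)})(z^{2a(s)}-w^{2l(s)+2})},\qquad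 \Omega=\sum_\lambda\mathcal{H}_\lambda(z,w)\,\tilde H_\lambda(\mathbf{x};z^2,w^2)\,T^{|\lambda|}$$ (genus $1$, one puncture). Let $\operatorname{Log}\Omega=\sum_{d\ge1}\frac{\mu(d)}{d}\psi_d(\log\Omega)$, where $\psi_d$ replaces $x_i,z,w,T$ by their $d$-th powers. For a partition $\mu$ of $n$ put $$\mathbb{H}_\mu(z,w)=(z^2-1)(1-w^2)\,\big\langle [T^n]\operatorname{Log}\Omega,\;h_\mu\big\rangle\in\mathbb{Q}(z,w).$$ For even $k\ge 2$ let $$G_k(T)=-\frac{B_k}{2k}+\sum_{n\ge1}\sum_{d\mid n}d^{k-1}T^n\in\mathbb{Q}[[T]]$$ be the Eisenstein series, where $B_k$ is the $k$-th Bernoulli number. Theorem. For every $n\ge1$ the rational function $\mathbb{H}_{(n-1,1)}$ (for $n=1$ read $(n-1,1)$ as $(1)$) is defined at $(z,w)=(e^{u/2},e^{-u/2})$, that is, it is a quotient of polynomials in $z,w$ whose denominator does not vanish identically in $u$ at this point; and, as formal power series in $T$ over $\mathbb{Q}((u))$, $$1+\sum_{n\ge1}\mathbb{H}_{(n-1,1)}\left(e^{u/2},e^{-u/2}\right)T^n=\frac1u\left(e^{u/2}-e^{-u/2}\right)\exp\Bigg(2\sum_{\substack{k\ge2\\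 k\text{ even}}}G_k(T)\frac{u^k}{k!}\Bigg).$$ In particular, the coefficient of every power of $u$ on the left-hand side, a power series in $T$, lies in the ring of quasi-modular forms $\mathbb{Q}[G_2,G_4,G_6]$. -/

import Mathlib

noncomputable section

namespace CharVar

/-! ### Partitions -/

/-- The parts of a partition in weakly decreasing order. -/
def rows {n : ℕ} (l : n.Partition) : List ℕ := l.parts.sort (· ≥ ·)

/-- `row l i` is the part `λ_{i+1}` (zero beyond the length). -/
def row {n : ℕ} (l : n.Partition) (i : ℕ) : ℕ := (rows l).getD i 0

/-- The number of parts. -/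
def len {n : ℕ} (l : n.Partition) : ℕ := l.parts.card

/-- `col l j` is the part `λ'_{j+1}` of the dual partition. -/
def col {n : ℕ} (l : n.Partition) (j : ℕ) : ℕ := l.parts.countP (fun i => j < i)

/-- The cells `(i, j)` of the Young diagram, rows and columns numbered from `0`. -/
def cells {n : ℕ} (l : n.Partition) : Finset (ℕ × ℕ) :=
  (Finset.range (len l) ×ˢ Finset.range n).filter fun s => s.2 < row l s.1

/-- Arm length: the number of cells strictly to the right of `s` in its row. -/
def arm {n : ℕ} (l : n.Partition) (s : ℕ × ℕ) : ℕ := row l s.1 - (s.2 + 1)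

/-- Leg length: the number of cells strictly below `s` in its column. -/
def leg {n : ℕ} (l : n.Partition) (s : ℕ × ℕ) : ℕ := col l s.2 - (s.1 + 1)

/-- `n(λ) = ∑ (i - 1) λ_i`. -/
def nStat {n : ℕ} (l : n.Partition) : ℕ := ∑ i ∈ Finset.range (len l), i * row l i

/-- `z_λ = ∏ i ^ {m_i} m_i !`. -/
def zNum {n : ℕ} (l : n.Partition) : ℕ :=
  ∏ i ∈ l.parts.toFinset, i ^ l.parts.count i * (l.parts.count i).factorial

/-- The (strict) lexicographic order on the partitions of `n`, a total order which refines the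
dominance order. -/
def LexLT {n : ℕ} (m l : n.Partition) : Prop := rows m < rows l

theorem lexLT_wf (n : ℕ) : WellFounded (LexLT (n := n)) := by
  have : IsTrans n.Partition LexLT := ⟨fun _ _ _ h h' => lt_trans (α := List ℕ) h h'⟩
  have : Std.Irrefl (LexLT (n := n)) := ⟨fun a h => lt_irrefl (rows a) h⟩
  exact Finite.wellFounded_of_trans_of_irrefl _

instance lexWF (n : ℕ) : WellFoundedRelation n.Partition := ⟨LexLT, lexLT_wf n⟩

/-! ### Symmetric functions

Over a field `K` of characteristic zero the ring of symmetric functions in infinitely many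
variables is the polynomial ring in the power sums `p_1, p_2, …`; the variable `X k` of
`MvPolynomial ℕ+ K` stands for `p_k`. -/

/-- The ring of symmetric functions over `K`, presented as `K[p_1, p_2, …]`. -/
abbrev Sym (K : Type*) [Field K] : Type _ := MvPolynomial ℕ+ K

section SymmetricFunctions

variable {K : Type*} [Field K]

/-- The power sum `p_λ = p_{λ_1} p_{λ_2} ⋯`. -/
def psumPart {n : ℕ} (l : n.Partition) : Sym K :=
  (l.parts.map fun i => (MvPolynomial.X i.toPNat' : Sym K)).prod

/-- The complete symmetric function `h_n = ∑_{λ ⊢ n} z_λ⁻¹ p_λ`. -/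
def hsym (n : ℕ) : Sym K :=
  ∑ l : n.Partition, MvPolynomial.C ((zNum l : K)⁻¹) * psumPart l

/-- `h_m` for an integer `m`, with `h_m = 0` for `m < 0`. -/
def hsymInt (m : ℤ) : Sym K := if 0 ≤ m then hsym m.toNat else 0

/-- `h_μ = h_{μ_1} h_{μ_2} ⋯`. -/
def hsymPart {n : ℕ} (l : n.Partition) : Sym K := (l.parts.map fun i => (hsym i : Sym K)).prod

/-- The Schur function `s_λ = det (h_{λ_i - i + j})`. -/
def schur {n : ℕ} (l : n.Partition) : Sym K :=
  Matrix.det (Matrix.of fun i j : Fin (len l) =>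
    (hsymInt ((row l i : ℤ) - (i : ℤ) + (j : ℤ)) : Sym K))

/-- The bilinear form on symmetric functions with
`⟨p_λ, p_μ⟩ = δ_{λ μ} z_λ ∏ c_{λ_i}`. -/
def pairing (c : ℕ+ → K) (f g : Sym K) : K :=
  ∑ a ∈ f.support, f.coeff a * g.coeff a *
    a.prod fun k m => (((k : ℕ) : K) * c k) ^ m * (m.factorial : K)

/-- The Hall pairing, `⟨p_λ, p_μ⟩ = δ_{λ μ} z_λ`. -/
def hall (f g : Sym K) : K := pairing (fun _ => 1) f g

/-- Macdonald's pairing,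
`⟨p_λ, p_μ⟩_{q,t} = δ_{λ μ} z_λ ∏ (1 - q ^ λ_i) / (1 - t ^ λ_i)`. -/
def hallQT (q t : K) (f g : Sym K) : K :=
  pairing (fun k => (1 - q ^ (k : ℕ)) / (1 - t ^ (k : ℕ))) f g

/-- The Macdonald symmetric functions `P_λ(x; q, t)` (for independent parameters `q`, `t`): the
basis which is orthogonal for `⟨ , ⟩_{q,t}` and of the form `P_λ = s_λ + lower terms`, obtained
by the Gram–Schmidt process. -/
def macP (q t : K) {n : ℕ} (l : n.Partition) : Sym K :=
  open Classical in
  schur l - ∑ m : {m : n.Partition // LexLT m l},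
    MvPolynomial.C (hallQT q t (schur l) (macP q t m.1) /
      hallQT q t (macP q t m.1) (macP q t m.1)) * macP q t m.1
termination_by l
decreasing_by all_goals exact m.2

/-- The integral form `J_λ = ∏_s (1 - q ^ a(s) t ^ (l(s) + 1)) P_λ`. -/
def macJ (q t : K) {n : ℕ} (l : n.Partition) : Sym K :=
  MvPolynomial.C (∏ s ∈ cells l, (1 - q ^ arm l s * t ^ (leg l s + 1))) * macP q t l

/-- The plethystic substitution `f[X] ↦ f[X / (1 - t)]`, that is `p_k ↦ p_k / (1 - t ^ k)`. -/
def plethDiv (t : K) : Sym K →ₐ[K] Sym K :=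
  MvPolynomial.aeval fun k : ℕ+ => MvPolynomial.C ((1 - t ^ (k : ℕ))⁻¹) * MvPolynomial.X k

/-- The modified Macdonald symmetric function
`H̃_λ(x; q, t) = t ^ n(λ) J_λ[X / (1 - t⁻¹); q, t⁻¹]`. -/
def macH (q t : K) {n : ℕ} (l : n.Partition) : Sym K :=
  MvPolynomial.C (t ^ nStat l) * plethDiv t⁻¹ (macJ q t⁻¹ l)

end SymmetricFunctions

/-! ### Rational functions in two variables -/

/-- The field `ℚ(z, w)`. -/
abbrev QZW : Type := FractionRing (MvPolynomial (Fin 2) ℚ)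

/-- The variable `z`. -/
def zv : QZW := algebraMap (MvPolynomial (Fin 2) ℚ) QZW (MvPolynomial.X 0)

/-- The variable `w`. -/
def wv : QZW := algebraMap (MvPolynomial (Fin 2) ℚ) QZW (MvPolynomial.X 1)

section Evaluation

variable {L : Type*} [Field L] [Algebra ℚ L]

/-- `f = p / d` with a denominator which does not vanish at the point `a`. -/
def IsFracAt (f : QZW) (a : Fin 2 → L) (x : MvPolynomial (Fin 2) ℚ × MvPolynomial (Fin 2) ℚ) :
    Prop :=
  MvPolynomial.aeval a x.2 ≠ 0 ∧
    f = algebraMap (MvPolynomial (Fin 2) ℚ) QZW x.1 / algebraMap (MvPolynomial (Fin 2) ℚ) QZW x.2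

/-- The rational function `f` is defined at the point `a`. -/
def RegularAt (f : QZW) (a : Fin 2 → L) : Prop := ∃ x, IsFracAt f a x

open Classical in
/-- The value of the rational function `f` at the point `a` (`0` if `f` is not defined there). -/
def evalAt (f : QZW) (a : Fin 2 → L) : L :=
  if h : RegularAt f a then
    MvPolynomial.aeval a h.choose.1 / MvPolynomial.aeval a h.choose.2
  else 0

/-- The value does not depend on the chosen fraction. -/
theorem evalAt_eq (f : QZW) (a : Fin 2 → L)
    (x : MvPolynomial (Fin 2) ℚ × MvPolynomial (Fin 2) ℚ) (hx : IsFracAt f a x) :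
    evalAt f a = MvPolynomial.aeval a x.1 / MvPolynomial.aeval a x.2 := by
  have h : RegularAt f a := ⟨x, hx⟩
  rw [evalAt, dif_pos h]
  obtain ⟨h1, h2⟩ := h.choose_spec
  obtain ⟨h3, h4⟩ := hx
  have inj := IsFractionRing.injective (MvPolynomial (Fin 2) ℚ) QZW
  have ne : ∀ y : MvPolynomial (Fin 2) ℚ, MvPolynomial.aeval a y ≠ 0 →
      algebraMap (MvPolynomial (Fin 2) ℚ) QZW y ≠ 0 := by
    intro y hy h0
    apply hy
    rw [inj (h0.trans (map_zero _).symm), map_zero]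
  rw [h2, div_eq_div_iff (ne _ h1) (ne _ h3), ← map_mul, ← map_mul] at h4
  rw [div_eq_div_iff h1 h3, ← map_mul, ← map_mul, inj h4]

end Evaluation

/-! ### Adams operations and the plethystic logarithm -/

theorem adams_injective (d : ℕ+) : Function.Injective
    ((algebraMap (MvPolynomial (Fin 2) ℚ) QZW).comp
      (MvPolynomial.expand (R := ℚ) (σ := Fin 2) (d : ℕ)).toRingHom) :=
  (IsFractionRing.injective (MvPolynomial (Fin 2) ℚ) QZW).comp
    (MvPolynomial.expand_injective d.pos)

/-- The Adams operation `f(z, w) ↦ f(z ^ d, w ^ d)` of `ℚ(z, w)`. -/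
def adamsK (d : ℕ+) : QZW →+* QZW := IsFractionRing.lift (adams_injective d)

/-- The Adams operation on symmetric functions over `ℚ(z, w)`: `p_k ↦ p_{dk}`, `z ↦ z ^ d`,
`w ↦ w ^ d`. -/
def adams (d : ℕ+) : Sym QZW →+* Sym QZW :=
  MvPolynomial.eval₂Hom (MvPolynomial.C.comp (adamsK d)) fun k => MvPolynomial.X (d * k)

/-- The plethystic logarithm `Log f = ∑_{d ≥ 1} (μ(d) / d) ψ_d (log f)`, where `ψ_d` also sends
`T` to `T ^ d`. -/
def plethLog (f : PowerSeries (Sym QZW)) : PowerSeries (Sym QZW) :=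
  PowerSeries.mk fun n => ∑ d ∈ n.divisors,
    MvPolynomial.C (((ArithmeticFunction.moebius d : ℤ) : QZW) / (d : QZW)) *
      adams d.toPNat' (PowerSeries.coeff (n / d) (PowerSeries.logOf f))

/-! ### The functions `ℍ_μ` (one puncture) -/

/-- The genus `g` hook function `ℋ_λ(z, w)`. -/
def hookFun (g : ℕ) {n : ℕ} (l : n.Partition) : QZW :=
  ∏ s ∈ cells l, (zv ^ (2 * arm l s + 1) - wv ^ (2 * leg l s + 1)) ^ (2 * g) /
    ((zv ^ (2 * arm l s + 2) - wv ^ (2 * leg l s)) *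
      (zv ^ (2 * arm l s) - wv ^ (2 * leg l s + 2)))

/-- `Ω(z, w) = ∑_λ ℋ_λ(z, w) H̃_λ(x; z², w²) T ^ |λ|`. -/
def Omega (g : ℕ) : PowerSeries (Sym QZW) :=
  PowerSeries.mk fun n => ∑ l : n.Partition,
    MvPolynomial.C (hookFun g l) * macH (zv ^ 2) (wv ^ 2) l

/-- `ℍ_μ(z, w) = (z² - 1)(1 - w²) ⟨Log Ω(z, w), h_μ⟩` for genus `g` and one partition `μ`. -/
def bbH (g : ℕ) {n : ℕ} (m : n.Partition) : QZW :=
  (zv ^ 2 - 1) * (1 - wv ^ 2) * hall (PowerSeries.coeff n (plethLog (Omega g))) (hsymPart m)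

/-- The partition `(n, 1)` of `n + 1` (for `n = 0`, the partition `(1)` of `1`). -/
def hookPartition (n : ℕ) : (n + 1).Partition :=
  Nat.Partition.ofSums (n + 1) {n, 1} (by simp)

/-! ### The two sides of the formula -/

/-- The Laurent series `e ^ (c u)`. -/
def expU (c : ℚ) : LaurentSeries ℚ :=
  HahnSeries.ofPowerSeries ℤ ℚ (PowerSeries.rescale c (PowerSeries.exp ℚ))

/-- The point `(e ^ (u / 2), e ^ (- u / 2))` with coordinates in `ℚ((u))`. -/
def eulerPoint : Fin 2 → LaurentSeries ℚ := ![expU (1 / 2), expU (-1 / 2)]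

/-- `1 + ∑_{n ≥ 1} ℍ_{(n-1,1)}(e ^ (u/2), e ^ (-u/2)) T ^ n`, a power series in `T` over
`ℚ((u))`, with genus one. -/
def hookSeries : PowerSeries (LaurentSeries ℚ) :=
  1 + PowerSeries.X * PowerSeries.mk fun n => evalAt (bbH 1 (hookPartition n)) eulerPoint

/-- The Eisenstein series `G_k(T) = - B_k / (2k) + ∑_{n ≥ 1} ∑_{d ∣ n} d ^ (k-1) T ^ n`. -/
def eisG (k : ℕ) : PowerSeries ℚ :=
  PowerSeries.mk fun n =>
    if n = 0 then -bernoulli k / (2 * (k : ℚ)) else ∑ d ∈ n.divisors, (d : ℚ) ^ (k - 1)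

/-- `2 ∑ G_k(T) u ^ k / k!` over the even `k ≥ 2`, as a power series in `u` over `ℚ[[T]]`. -/
def eisExponent : PowerSeries (PowerSeries ℚ) :=
  2 * PowerSeries.mk fun k =>
    if 2 ≤ k ∧ Even k then ((k.factorial : ℚ)⁻¹) • eisG k else 0

/-- `exp f` for a power series without constant term. -/
def expOf (f : PowerSeries (PowerSeries ℚ)) : PowerSeries (PowerSeries ℚ) :=
  (PowerSeries.exp (PowerSeries ℚ)).subst f

/-- Rewrites a power series in `u` over `ℚ[[T]]` as a power series in `T` over `ℚ((u))`. -/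
def swapSeries (f : PowerSeries (PowerSeries ℚ)) : PowerSeries (LaurentSeries ℚ) :=
  PowerSeries.mk fun n => HahnSeries.ofPowerSeries ℤ ℚ
    (PowerSeries.mk fun m => PowerSeries.coeff n (PowerSeries.coeff m f))

/-- The ring `ℚ[G_2, G_4, G_6]` of quasi-modular forms (through their expansions in `T`). -/
def quasiModular : Subalgebra ℚ (PowerSeries ℚ) := Algebra.adjoin ℚ {eisG 2, eisG 4, eisG 6}

/-- The coefficient of `u ^ m` of a power series in `T` over `ℚ((u))`, a power series in `T`. -/
def coeffU (m : ℤ) (f : PowerSeries (LaurentSeries ℚ)) : PowerSeries ℚ :=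
  PowerSeries.mk fun n => (PowerSeries.coeff n f).coeff m

end CharVar

end

/-!
At a point with `z w = 1` the two parameters of Macdonald's pairing agree, so by the orthonormality
of the Schur functions `P_λ` specialises to `s_λ`. With `q = z²`, the principal specialization of
`s_λ` is `q ^ n(λ)` divided by the product of the `1 - q ^ h` over the hook lengths `h`. Hence the
hook function and the factor relating `H̃_λ` to `P_λ` become explicit: setting all `p_k` to `1`
turns `Ω` into `∑_λ T ^ |λ|`, and pairing with `h_{n-1} h_1`, which is `f ↦ (∂f / ∂p_1)(1, 1, …)`,
gives `∑_λ T ^ |λ| ∑_{(i, j) ∈ λ} q ^ (j - i)`. As the pairing with `h_{n-1} h_1` is a derivation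
at the point `p_k = 1` and annihilates the terms `d > 1` of `Log`, the series of the theorem is
governed by the quotient of the two, the Bloch–Okounkov one-point function, which equals
`∏ (1 - T ^ k) ^ 2 / ((1 - q T ^ k) (1 - q⁻¹ T ^ k))`. For `q = e ^ u` the logarithmic derivative of
this product in `u` is a difference of Lambert series, which agrees with that of the exponential of
Eisenstein series. All `G_k` are quasi-modular because every modular form of level one is a
polynomial in `E₄` and `E₆`.
-/

noncomputable section

namespace CharVar

/-! ### Power sums and complete symmetric functions -/

section SymmetricFunctions

open MvPolynomial

variable {K : Type*} [Field K]

/-- The grading of `Λ`: `p_k` has degree `k`. It takes values in `ℤ` because the entries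
`h_{λ_i - i + j}` of a Jacobi–Trudi matrix are homogeneous of possibly negative degree. -/
def psumWeight (k : ℕ+) : ℤ := ((k : ℕ) : ℤ)

/-- `z_a = ∏ k ^ {a_k} a_k !` for an exponent vector `a` of the power sums. -/
def zFac (a : ℕ+ →₀ ℕ) : ℕ := a.prod fun k m => (k : ℕ) ^ m * m.factorial

/-- The exponent vector of `p_λ`. -/
def expo {n : ℕ} (l : n.Partition) : ℕ+ →₀ ℕ :=
  Multiset.toFinsupp (l.parts.map Nat.toPNat')

theorem weight_psumWeight_toFinsupp (s : Multiset ℕ+) :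
    Finsupp.weight psumWeight (Multiset.toFinsupp s) =
      ((s.map fun k : ℕ+ => (k : ℕ)).sum : ℕ) := by
  induction s using Multiset.induction_on with
  | empty => simp
  | cons k s ih =>
    rw [← Multiset.singleton_add, map_add, map_add, ih, Multiset.toFinsupp_singleton,
      Finsupp.weight_single]
    simp [psumWeight]

theorem zFac_ne_zero (a : ℕ+ →₀ ℕ) : zFac a ≠ 0 :=
  Finset.prod_ne_zero_iff.2 fun k _ =>
    mul_ne_zero (pow_ne_zero _ k.ne_zero) (Nat.factorial_ne_zero _)

theorem cast_zFac_ne_zero [CharZero K] (a : ℕ+ →₀ ℕ) : (zFac a : K) ≠ 0 :=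
  Nat.cast_ne_zero.2 (zFac_ne_zero a)

theorem zFac_add_single (a : ℕ+ →₀ ℕ) (k : ℕ+) :
    zFac (a + Finsupp.single k 1) = (k : ℕ) * (a k + 1) * zFac a := by
  have split_off (b : ℕ+ →₀ ℕ) :
      zFac b = (k : ℕ) ^ b k * (b k).factorial * zFac (b.erase k) :=
    (Finsupp.mul_prod_erase' b k _ fun _ => by simp).symm
  have erase_eq : (a + Finsupp.single k 1).erase k = a.erase k := by
    rw [Finsupp.erase_add, Finsupp.erase_single, add_zero]
  rw [split_off a, split_off (a + Finsupp.single k 1), erase_eq]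
  simp only [Finsupp.add_apply, Finsupp.single_eq_same, Nat.factorial_succ, pow_succ]
  ring

theorem psumPart_eq_monomial {n : ℕ} (l : n.Partition) :
    (psumPart l : Sym K) = monomial (expo l) 1 := by
  have prod_X (s : Multiset ℕ+) :
      (s.map fun k => (X k : Sym K)).prod = monomial (Multiset.toFinsupp s) 1 := by
    induction s using Multiset.induction_on with
    | empty => simp
    | cons k s ih =>
      rw [Multiset.map_cons, Multiset.prod_cons, ih, ← Multiset.singleton_add, map_add,
        Multiset.toFinsupp_singleton, X, monomial_mul, one_mul]
  rw [psumPart, expo, ← prod_X, Multiset.map_map]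
  rfl

theorem map_coe_map_toPNat'_parts {n : ℕ} (l : n.Partition) :
    (l.parts.map Nat.toPNat').map (fun k : ℕ+ => (k : ℕ)) = l.parts := by
  rw [Multiset.map_map]
  conv_rhs => rw [← Multiset.map_id l.parts]
  refine Multiset.map_congr rfl fun i hi => ?_
  simp [Nat.toPNat'_coe, l.parts_pos hi]

theorem expo_injective {n : ℕ} : Function.Injective (expo (n := n)) := by
  intro l m h
  rw [Nat.Partition.ext_iff, ← map_coe_map_toPNat'_parts l, ← map_coe_map_toPNat'_parts m,
    Multiset.toFinsupp.injective h]

theorem weight_expo {n : ℕ} (l : n.Partition) : Finsupp.weight psumWeight (expo l) = n := by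
  rw [expo, weight_psumWeight_toFinsupp, map_coe_map_toPNat'_parts, l.parts_sum]

theorem exists_expo_eq {n : ℕ} {a : ℕ+ →₀ ℕ} (h : Finsupp.weight psumWeight a = n) :
    ∃ l : n.Partition, expo l = a := by
  refine ⟨⟨(Finsupp.toMultiset a).map (fun k : ℕ+ => (k : ℕ)), fun {i} hi => ?_, ?_⟩, ?_⟩
  · obtain ⟨k, -, rfl⟩ := Multiset.mem_map.1 hi
    exact k.pos
  · rw [← Nat.cast_inj (R := ℤ), ← weight_psumWeight_toFinsupp, Finsupp.toMultiset_toFinsupp, h]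
  · simp [expo, Multiset.map_map]

theorem zNum_eq_zFac_expo {n : ℕ} (l : n.Partition) : zNum l = zFac (expo l) := by
  have coe_injective : Function.Injective (fun k : ℕ+ => (k : ℕ)) := PNat.coe_injective
  unfold zNum zFac expo Finsupp.prod
  conv_lhs => rw [← map_coe_map_toPNat'_parts l]
  rw [Multiset.toFinsupp_support, Multiset.toFinset_map, Finset.prod_image coe_injective.injOn]
  refine Finset.prod_congr rfl fun k _ => ?_
  rw [Multiset.count_map_eq_count' _ _ coe_injective, Multiset.toFinsupp_apply]

theorem coeff_hsym (n : ℕ) (a : ℕ+ →₀ ℕ) :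
    coeff a (hsym n : Sym K) =
      if Finsupp.weight psumWeight a = n then (zFac a : K)⁻¹ else 0 := by
  classical
  simp only [hsym, psumPart_eq_monomial, coeff_sum, coeff_C_mul, coeff_monomial, mul_ite, mul_one,
    mul_zero]
  split_ifs with h
  · obtain ⟨l, rfl⟩ := exists_expo_eq h
    rw [Finset.sum_eq_single_of_mem l (Finset.mem_univ l) fun m _ hm =>
      if_neg fun h' => hm (expo_injective h'), if_pos rfl, zNum_eq_zFac_expo]
  · refine Finset.sum_eq_zero fun l _ => if_neg ?_
    rintro rfl
    exact h (weight_expo l)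

theorem isWeightedHomogeneous_hsym (n : ℕ) :
    IsWeightedHomogeneous psumWeight (hsym n : Sym K) (n : ℤ) := by
  intro a ha
  rw [coeff_hsym] at ha
  by_contra h
  exact ha (if_neg h)

theorem hsym_zero : (hsym 0 : Sym K) = 1 := by
  have parts_eq : (default : Nat.Partition 0).parts = 0 :=
    congrArg Nat.Partition.parts (Subsingleton.elim default (Nat.Partition.indiscrete 0))
  rw [hsym, Fintype.sum_unique, psumPart, zNum, parts_eq]
  simp

theorem pderiv_hsym [CharZero K] (k : ℕ+) (n : ℕ) :
    (k : ℕ) • pderiv k (hsym n : Sym K) = if (k : ℕ) ≤ n then hsym (n - k) else 0 := by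
  ext a
  have weight_add_single : Finsupp.weight psumWeight (a + Finsupp.single k 1) =
      Finsupp.weight psumWeight a + (k : ℕ) := by
    rw [map_add, Finsupp.weight_single, one_smul, psumWeight]
  have weight_nonneg : 0 ≤ Finsupp.weight psumWeight a :=
    Finset.sum_nonneg fun k _ => nsmul_nonneg (Nat.cast_nonneg (k : ℕ)) _
  have zFac_inv : (k : K) * ((zFac (a + Finsupp.single k 1) : K)⁻¹ * (a k + 1)) =
      (zFac a : K)⁻¹ := by
    have := cast_zFac_ne_zero (K := K) a
    have : ((k : ℕ) : K) ≠ 0 := Nat.cast_ne_zero.2 k.ne_zero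
    have : ((a k : ℕ) : K) + 1 ≠ 0 := Nat.cast_add_one_ne_zero (a k)
    rw [zFac_add_single]
    push_cast
    field_simp
  rw [coeff_smul, coeff_pderiv, coeff_hsym, weight_add_single, nsmul_eq_mul]
  by_cases h : Finsupp.weight psumWeight a + (k : ℕ) = n
  · rw [if_pos h, if_pos (by omega), coeff_hsym, if_pos (by omega), zFac_inv]
  · rw [if_neg h, zero_mul, mul_zero]
    split_ifs with hk
    · rw [coeff_hsym, if_neg (by omega)]
    · rw [coeff_zero]

theorem coeff_X_mul_pderiv (k : ℕ+) (f : Sym K) (a : ℕ+ →₀ ℕ) :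
    coeff a (X k * pderiv k f) = a k * coeff a f := by
  rw [coeff_X_mul']
  split_ifs with hk
  · have hle : Finsupp.single k 1 ≤ a :=
      Finsupp.single_le_iff.2 (Nat.one_le_iff_ne_zero.2 (Finsupp.mem_support_iff.1 hk))
    have hk1 : (a - Finsupp.single k 1 : ℕ+ →₀ ℕ) k + 1 = a k := by
      conv_rhs => rw [← tsub_add_cancel_of_le hle]
      simp
    rw [coeff_pderiv, tsub_add_cancel_of_le hle, mul_comm, ← hk1]
    push_cast
    rfl
  · rw [Finsupp.notMem_support_iff.1 hk, Nat.cast_zero, zero_mul]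

theorem sum_range_succ_mul_eq_of_weight_eq {a : ℕ+ →₀ ℕ} {n : ℕ}
    (h : Finsupp.weight psumWeight a = n) :
    ∑ i ∈ Finset.range n, (i + 1) * a i.succPNat = n := by
  have support_subset : a.support ⊆ (Finset.range n).image Nat.succPNat := by
    intro k hk
    have hle := Finsupp.le_weight_of_ne_zero (w := psumWeight) (fun k => Nat.cast_nonneg (k : ℕ))
      (Finsupp.mem_support_iff.1 hk)
    rw [h, psumWeight, Nat.cast_le] at hle
    exact Finset.mem_image.2 ⟨k.natPred, Finset.mem_range.2
      (by have := k.natPred_add_one; omega), k.succPNat_natPred⟩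
  rw [Finsupp.weight_apply, Finsupp.sum_of_support_subset _ support_subset _ (by simp),
    Finset.sum_image Nat.succPNat_injective.injOn] at h
  rw [← Nat.cast_inj (R := ℤ), ← h, Nat.cast_sum]
  refine Finset.sum_congr rfl fun i _ => ?_
  rw [psumWeight, Nat.succPNat_coe, nsmul_eq_mul, Nat.cast_mul, Nat.succ_eq_add_one, mul_comm]

/-- Euler's identity for the homogeneous polynomial `h_{n+1}` in the `p_k`. -/
theorem sum_X_mul_hsym [CharZero K] (n : ℕ) :
    ∑ p ∈ Finset.HasAntidiagonal.antidiagonal n, (X p.1.succPNat : Sym K) * hsym p.2 =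
      (n + 1) • hsym (n + 1) := by
  ext a
  have coeff_X_mul_hsym : ∀ p ∈ Finset.HasAntidiagonal.antidiagonal n,
      coeff a ((X p.1.succPNat : Sym K) * hsym p.2) =
        ((p.1 + 1) * a p.1.succPNat : ℕ) * coeff a (hsym (n + 1) : Sym K) := by
    rintro ⟨i, j⟩ hij
    have hij : i + j = n := Finset.HasAntidiagonal.mem_antidiagonal.1 hij
    have pderiv_eq := pderiv_hsym (K := K) i.succPNat (n + 1)
    rw [Nat.succPNat_coe, if_pos (by omega), show n + 1 - i.succ = j by omega] at pderiv_eq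
    rw [← pderiv_eq, mul_smul_comm, coeff_smul, coeff_X_mul_pderiv, nsmul_eq_mul]
    push_cast
    ring
  rw [coeff_sum, Finset.sum_congr rfl coeff_X_mul_hsym, ← Finset.sum_mul, ← Nat.cast_sum,
    Finset.Nat.sum_antidiagonal_eq_sum_range_succ_mk, coeff_smul, nsmul_eq_mul]
  by_cases h : Finsupp.weight psumWeight a = (n + 1 : ℕ)
  · rw [sum_range_succ_mul_eq_of_weight_eq h]
  · rw [coeff_hsym, if_neg h, mul_zero, mul_zero]

/-! ### The Hall pairing -/

theorem pairing_eq_sum (c : ℕ+ → K) {f : Sym K} (g : Sym K) {s : Finset (ℕ+ →₀ ℕ)}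
    (hs : f.support ⊆ s) :
    pairing c f g = ∑ a ∈ s, f.coeff a * g.coeff a *
      a.prod fun k m => (((k : ℕ) : K) * c k) ^ m * (m.factorial : K) :=
  Finset.sum_subset hs fun a _ ha => by rw [notMem_support_iff.1 ha, zero_mul, zero_mul]

/-- The form `pairing c`, bundled as a bilinear form. -/
def pairingForm (c : ℕ+ → K) : LinearMap.BilinForm K (Sym K) :=
  LinearMap.mk₂ K (pairing c)
    (fun f f' g => by
      classical
      rw [pairing_eq_sum c g (f := f + f') support_add,
        pairing_eq_sum c g (f := f) (Finset.subset_union_left (s₂ := f'.support)),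
        pairing_eq_sum c g (f := f') (Finset.subset_union_right (s₁ := f.support)),
        ← Finset.sum_add_distrib]
      exact Finset.sum_congr rfl fun a _ => by rw [coeff_add]; ring)
    (fun x f g => by
      rw [pairing_eq_sum c g support_smul, pairing_eq_sum c g subset_rfl, smul_eq_mul,
        Finset.mul_sum]
      exact Finset.sum_congr rfl fun a _ => by rw [coeff_smul, smul_eq_mul]; ring)
    (fun f g g' => by
      rw [pairing, pairing, pairing, ← Finset.sum_add_distrib]
      exact Finset.sum_congr rfl fun a _ => by rw [coeff_add]; ring)
    (fun x f g => by
      rw [pairing, pairing, smul_eq_mul, Finset.mul_sum]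
      exact Finset.sum_congr rfl fun a _ => by rw [coeff_smul, smul_eq_mul]; ring)

theorem hall_eq_pairingForm (f g : Sym K) : hall f g = pairingForm (fun _ => 1) f g := rfl

theorem hall_eq_sum {f : Sym K} (g : Sym K) {s : Finset (ℕ+ →₀ ℕ)} (hs : f.support ⊆ s) :
    hall f g = ∑ a ∈ s, f.coeff a * g.coeff a * (zFac a : K) := by
  rw [hall, pairing_eq_sum _ g hs]
  simp [zFac, Finsupp.prod]

theorem hall_comm (f g : Sym K) : hall f g = hall g f := by
  classical
  rw [hall_eq_sum g (s := f.support ∪ g.support) Finset.subset_union_left,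
    hall_eq_sum f (s := f.support ∪ g.support) Finset.subset_union_right]
  exact Finset.sum_congr rfl fun a _ => by ring

theorem hall_C (c : K) (g : Sym K) : hall (C c) g = c * constantCoeff g := by
  rw [hall_eq_sum g (s := {0}) (by rw [← monomial_zero']; exact support_monomial_subset)]
  simp [zFac, constantCoeff_eq]

theorem hall_mul_X (f g : Sym K) (k : ℕ+) :
    hall (f * X k) g = hall f ((k : ℕ) • pderiv k g) := by
  rw [hall_eq_sum g subset_rfl, hall_eq_sum _ subset_rfl, support_mul_X, Finset.sum_map]
  refine Finset.sum_congr rfl fun a _ => ?_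
  rw [addRightEmbedding_apply, coeff_mul_X, coeff_smul, coeff_pderiv, zFac_add_single,
    nsmul_eq_mul]
  push_cast
  ring

theorem hall_hsym [CharZero K] {n : ℕ} {f : Sym K}
    (hf : IsWeightedHomogeneous psumWeight f (n : ℤ)) :
    hall f (hsym n) = eval (fun _ => 1) f := by
  rw [hall_eq_sum _ subset_rfl, eval_eq]
  refine Finset.sum_congr rfl fun a ha => ?_
  rw [coeff_hsym, if_pos (hf (mem_support_iff.1 ha)), mul_assoc,
    inv_mul_cancel₀ (cast_zFac_ne_zero a)]
  simp

end SymmetricFunctions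

/-! ### Generating series -/

section GeneratingSeries

open PowerSeries

variable {K : Type*} [Field K] {R : Type*} [CommRing R]

theorem eq_zero_of_derivative_eq_mul [IsAddTorsionFree R] {a f : PowerSeries R}
    (hf : d⁄dX R f = a * f) (h0 : constantCoeff f = 0) : f = 0 := by
  ext m
  induction m using Nat.strong_induction_on with
  | _ m ih =>
    obtain _ | m := m
    · simpa using h0
    · have hm := congrArg (coeff m) hf
      rw [coeff_derivative, coeff_mul, Finset.sum_eq_zero fun p hp => by
        have := Finset.HasAntidiagonal.mem_antidiagonal.1 hp
        rw [ih p.2 (by omega), map_zero, mul_zero]] at hm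
      refine nsmul_right_injective (Nat.succ_ne_zero m) ?_
      simpa only [nsmul_eq_mul, mul_comm, Nat.cast_succ, map_zero, zero_mul] using hm

theorem eq_of_derivative_eq_mul [IsAddTorsionFree R] {a f g : PowerSeries R}
    (hf : d⁄dX R f = a * f) (hg : d⁄dX R g = a * g)
    (h0 : constantCoeff f = constantCoeff g) : f = g :=
  sub_eq_zero.1 <| eq_zero_of_derivative_eq_mul (by rw [map_sub, hf, hg, mul_sub])
    (by rw [map_sub, h0, sub_self])

/-- The generating series `∑_{k ≥ 0} φ(p_{k+1}) t ^ k` of the power sums under a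
specialization `φ` of `Λ`. -/
def psumSeries (φ : Sym K →+* R) : PowerSeries R :=
  PowerSeries.mk fun k => φ (MvPolynomial.X k.succPNat)

/-- The generating series `∑_{m ≥ 0} φ(h_m) t ^ m` of the complete symmetric functions under a
specialization `φ` of `Λ`. -/
def hsymSeries (φ : Sym K →+* R) : PowerSeries R := PowerSeries.mk fun m => φ (hsym m)

theorem derivative_hsymSeries [CharZero K] (φ : Sym K →+* R) :
    d⁄dX R (hsymSeries φ) = psumSeries φ * hsymSeries φ := by
  ext n
  have euler := congrArg φ (sum_X_mul_hsym (K := K) n)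
  simp only [map_sum, map_mul, map_natCast, nsmul_eq_mul] at euler
  simp only [coeff_derivative, coeff_mul, psumSeries, hsymSeries, coeff_mk, euler]
  push_cast
  ring

theorem constantCoeff_hsymSeries (φ : Sym K →+* R) : constantCoeff (hsymSeries φ) = 1 := by
  simp [hsymSeries, hsym_zero]

end GeneratingSeries

/-! ### Orthonormality of the Schur functions -/

section Orthonormality

open PowerSeries

theorem derivation_prod {R A ι : Type*} [CommSemiring R] [CommRing A] [Algebra R A]
    [DecidableEq ι] (D : Derivation R A A) (s : Finset ι) (f : ι → A) :
    D (∏ i ∈ s, f i) = ∑ j ∈ s, (∏ i ∈ s.erase j, f i) * D (f j) := by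
  induction s using Finset.induction_on with
  | empty => simp
  | insert a s ha ih =>
    rw [Finset.prod_insert ha, Derivation.leibniz, ih, Finset.sum_insert ha,
      Finset.erase_insert ha, add_comm, Finset.smul_sum, smul_eq_mul]
    refine congrArg₂ _ rfl (Finset.sum_congr rfl fun j hj => ?_)
    have hne : a ≠ j := fun h => ha (h ▸ hj)
    rw [Finset.erase_insert_of_ne hne, Finset.prod_insert (fun h => ha (Finset.mem_of_mem_erase h)),
      smul_eq_mul, mul_assoc]

variable {K : Type*} [Field K] {N : ℕ}

theorem hsymInt_natCast (m : ℕ) : (hsymInt (m : ℤ) : Sym K) = hsym m := by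
  simp [hsymInt]

theorem hsymInt_of_neg {m : ℤ} (hm : m < 0) : (hsymInt m : Sym K) = 0 := by
  simp [hsymInt, hm]

theorem pderiv_hsymInt [CharZero K] (k : ℕ+) (m : ℤ) :
    (k : ℕ) • MvPolynomial.pderiv k (hsymInt m : Sym K) = hsymInt (m - k) := by
  rcases lt_or_ge m 0 with hm | hm
  · have := k.pos
    rw [hsymInt_of_neg hm, hsymInt_of_neg (by omega), map_zero, smul_zero]
  · lift m to ℕ using hm
    rw [hsymInt_natCast, pderiv_hsym]
    split_ifs with h
    · rw [← Nat.cast_sub h, hsymInt_natCast]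
    · rw [hsymInt_of_neg (by omega)]

theorem constantCoeff_hsymInt (m : ℤ) :
    MvPolynomial.constantCoeff (hsymInt m : Sym K) = if m = 0 then 1 else 0 := by
  rcases lt_or_ge m 0 with hm | hm
  · rw [hsymInt_of_neg hm, map_zero, if_neg hm.ne]
  · lift m to ℕ using hm
    rw [hsymInt_natCast, MvPolynomial.constantCoeff_eq, coeff_hsym, map_zero]
    simp [zFac, eq_comm]

theorem pderiv_prod_hsymInt [CharZero K] {ι : Type*} [Fintype ι] [DecidableEq ι] (k : ℕ+)
    (a : ι → ℤ) :
    (k : ℕ) • MvPolynomial.pderiv k (∏ i, (hsymInt (a i) : Sym K)) =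
      ∑ j, ∏ i, hsymInt (a i - Pi.single (M := fun _ => ℤ) j (k : ℤ) i) := by
  rw [derivation_prod, Finset.smul_sum]
  refine Finset.sum_congr rfl fun j _ => ?_
  rw [← mul_smul_comm, pderiv_hsymInt, ← Finset.prod_erase_mul Finset.univ _ (Finset.mem_univ j),
    Pi.single_eq_same]
  refine congrArg₂ _ (Finset.prod_congr rfl fun i hi => ?_) rfl
  rw [Pi.single_eq_of_ne (Finset.ne_of_mem_erase hi), sub_zero]

variable (K N) in
/-- Specialization of a symmetric function to `N` variables. -/
def toVars : Sym K →ₐ[K] MvPolynomial (Fin N) K :=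
  MvPolynomial.aeval fun k : ℕ+ => MvPolynomial.psum (Fin N) K k

/-- The case `β = 0` is the duality of the complete and the monomial functions; the shift by `β`
makes the induction on `f` go through. -/
theorem hall_prod_hsymInt [CharZero K] (f : Sym K) (α β : Fin N →₀ ℕ) :
    hall f (∏ i, hsymInt ((α i : ℤ) - β i)) =
      MvPolynomial.coeff α (toVars K N f * MvPolynomial.monomial β 1) := by
  classical
  induction f using MvPolynomial.induction_on generalizing β with
  | C c =>
    rw [hall_C, map_prod, toVars, MvPolynomial.algHom_C, MvPolynomial.algebraMap_eq,
      MvPolynomial.coeff_C_mul, MvPolynomial.coeff_monomial]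
    simp only [constantCoeff_hsymInt, Finset.prod_ite_zero, Finset.prod_const_one,
      Finset.mem_univ, true_imp_iff, sub_eq_zero, Nat.cast_inj, Finsupp.ext_iff, eq_comm (a := β _)]
  | add p q hp hq =>
    rw [hall_eq_pairingForm, map_add, LinearMap.add_apply, ← hall_eq_pairingForm,
      ← hall_eq_pairingForm, hp, hq, map_add, add_mul, MvPolynomial.coeff_add]
  | mul_X p k ih =>
    have shift (j i : Fin N) : (α i : ℤ) - β i - Pi.single (M := fun _ => ℤ) j (k : ℤ) i =
        α i - (β + Finsupp.single j (k : ℕ)) i := by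
      rw [Finsupp.add_apply, Finsupp.single_apply, Pi.single_apply]
      simp only [eq_comm (a := j)]
      split_ifs <;> push_cast <;> ring
    rw [hall_mul_X, pderiv_prod_hsymInt, hall_eq_pairingForm, map_sum]
    simp only [shift, ← hall_eq_pairingForm, ih]
    rw [← MvPolynomial.coeff_sum, ← Finset.mul_sum, map_mul, mul_assoc]
    congr 2
    rw [toVars, MvPolynomial.aeval_X, MvPolynomial.psum, Finset.sum_mul]
    refine Finset.sum_congr rfl fun j _ => ?_
    rw [MvPolynomial.X_pow_eq_monomial, MvPolynomial.monomial_mul, one_mul, add_comm]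

theorem mk_pow_mul_one_sub {R : Type*} [CommRing R] (x : R) :
    (PowerSeries.mk fun m => x ^ m) * (1 - C x * X) = 1 := by
  ext m
  rw [mul_sub, mul_one, map_sub, ← mul_assoc, mul_comm _ (C x), mul_assoc]
  cases m with
  | zero => simp
  | succ m => simp [coeff_one, pow_succ']

theorem derivative_mk_pow {R : Type*} [CommRing R] (x : R) :
    d⁄dX R (PowerSeries.mk fun m => x ^ m) =
      (PowerSeries.mk fun k => x ^ (k + 1)) * PowerSeries.mk fun m => x ^ m := by
  ext n
  have summand : ∀ p ∈ Finset.HasAntidiagonal.antidiagonal n,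
      x ^ (p.1 + 1) * x ^ p.2 = x ^ (n + 1) := by
    intro p hp
    rw [← pow_add, ← Finset.HasAntidiagonal.mem_antidiagonal.1 hp]
    congr 1
    omega
  simp only [coeff_derivative, coeff_mul, coeff_mk]
  rw [Finset.sum_congr rfl summand, Finset.sum_const, Finset.Nat.card_antidiagonal, nsmul_eq_mul]
  push_cast
  ring

theorem hsymSeries_toVars [CharZero K] :
    hsymSeries (toVars K N : Sym K →+* MvPolynomial (Fin N) K) =
      ∏ i : Fin N, PowerSeries.mk fun m => (MvPolynomial.X i : MvPolynomial (Fin N) K) ^ m := by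
  classical
  refine eq_of_derivative_eq_mul (derivative_hsymSeries _) ?_
    (by simp [constantCoeff_hsymSeries])
  have psumSeries_eq : psumSeries (toVars K N : Sym K →+* MvPolynomial (Fin N) K) =
      ∑ i : Fin N,
        PowerSeries.mk fun k => (MvPolynomial.X i : MvPolynomial (Fin N) K) ^ (k + 1) := by
    ext1 k
    simp [psumSeries, toVars, MvPolynomial.psum]
  rw [psumSeries_eq, derivation_prod, Finset.sum_mul]
  refine Finset.sum_congr rfl fun j _ => ?_
  rw [derivative_mk_pow, ← Finset.prod_erase_mul Finset.univ _ (Finset.mem_univ j)]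
  ring

/-- The polynomial `∏_{i ≠ k} (1 - x_i t)` in `t`, whose coefficients are the elementary symmetric
polynomials of the variables other than `x_k`, up to sign. -/
def elemPoly (K : Type*) [Field K] {N : ℕ} (k : Fin N) : Polynomial (MvPolynomial (Fin N) K) :=
  ∏ i ∈ Finset.univ.erase k, (1 - Polynomial.C (MvPolynomial.X i) * Polynomial.X)

theorem natDegree_elemPoly_lt (k : Fin N) : (elemPoly K k).natDegree < N := by
  have natDegree_factor_le (x : MvPolynomial (Fin N) K) :
      (1 - Polynomial.C x * Polynomial.X).natDegree ≤ 1 := by compute_degree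
  calc (elemPoly K k).natDegree
      ≤ ∑ _i ∈ Finset.univ.erase k, 1 :=
        (Polynomial.natDegree_prod_le _ _).trans
          (Finset.sum_le_sum fun i _ => natDegree_factor_le _)
    _ < N := by
        rw [Finset.sum_const, Finset.card_erase_of_mem (Finset.mem_univ k), Finset.card_univ,
          Fintype.card_fin, smul_eq_mul, mul_one]
        exact Nat.sub_one_lt_of_lt k.pos

theorem hsymSeries_mul_elemPoly [CharZero K] (k : Fin N) :
    hsymSeries (toVars K N : Sym K →+* MvPolynomial (Fin N) K) * (elemPoly K k : PowerSeries _) =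
      PowerSeries.mk fun m => (MvPolynomial.X k : MvPolynomial (Fin N) K) ^ m := by
  have coe_elemPoly : (elemPoly K k : PowerSeries (MvPolynomial (Fin N) K)) =
      ∏ i ∈ Finset.univ.erase k, (1 - C (MvPolynomial.X i) * X) := by
    rw [elemPoly, ← Polynomial.coeToPowerSeries.ringHom_apply, map_prod]
    simp
  rw [hsymSeries_toVars, coe_elemPoly, ← Finset.mul_prod_erase Finset.univ _ (Finset.mem_univ k),
    mul_assoc, ← Finset.prod_mul_distrib, Finset.prod_congr rfl fun i _ => mk_pow_mul_one_sub _,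
    Finset.prod_const_one, mul_one]

theorem coeff_hsymSeries_mul_polynomial {R : Type*} [CommRing R] (φ : Sym K →+* R)
    {p : Polynomial R} (hp : p.natDegree < N) (a : ℕ) :
    coeff a (hsymSeries φ * (p : PowerSeries R)) =
      ∑ j : Fin N, φ (hsymInt ((a : ℤ) - (j : ℕ))) * p.coeff j := by
  have coe_p : (p : PowerSeries R) = ∑ j : Fin N, C (p.coeff j) * X ^ (j : ℕ) := by
    conv_lhs => rw [p.as_sum_range_C_mul_X_pow' hp]
    rw [← Polynomial.coeToPowerSeries.ringHom_apply, map_sum, Finset.sum_range]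
    simp
  rw [coe_p, Finset.mul_sum, map_sum]
  refine Finset.sum_congr rfl fun j _ => ?_
  rw [mul_left_comm, coeff_C_mul, coeff_mul_X_pow', mul_comm]
  split_ifs with h
  · rw [← Nat.cast_sub h, hsymInt_natCast, hsymSeries, coeff_mk]
  · rw [hsymInt_of_neg (by omega), map_zero]

/-- The alternant `det (x_k ^ {α_i})`. -/
def alternant (K : Type*) [Field K] {N : ℕ} (α : Fin N → ℕ) : MvPolynomial (Fin N) K :=
  Matrix.det (Matrix.of fun i k : Fin N => (MvPolynomial.X k : MvPolynomial (Fin N) K) ^ α i)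

/-- The Jacobi–Trudi determinant `det (h_{α_i - j})` of an integer vector `α`. With rows and
columns in reverse order, `α` is an increasing sequence `λ_i + N - i`. -/
def jacobiTrudi (K : Type*) [Field K] {N : ℕ} (α : Fin N → ℕ) : Sym K :=
  Matrix.det (Matrix.of fun i j : Fin N => (hsymInt ((α i : ℤ) - (j : ℕ)) : Sym K))

theorem toVars_jacobiTrudi_mul_det [CharZero K] (α : Fin N → ℕ) :
    toVars K N (jacobiTrudi K α) *
      Matrix.det (Matrix.of fun j k : Fin N => (elemPoly K k).coeff j) = alternant K α := by
  rw [jacobiTrudi, AlgHom.map_det, ← Matrix.det_mul, alternant]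
  congr 1
  ext1 i k
  have coeff_eq := coeff_hsymSeries_mul_polynomial (toVars K N : Sym K →+* _)
    (natDegree_elemPoly_lt (K := K) k) (α i)
  rw [hsymSeries_mul_elemPoly, coeff_mk] at coeff_eq
  exact coeff_eq.symm

theorem jacobiTrudi_val : jacobiTrudi K (Fin.val : Fin N → ℕ) = 1 := by
  rw [jacobiTrudi, Matrix.det_of_isLowerTriangular]
  · refine Finset.prod_eq_one fun i _ => ?_
    rw [Matrix.of_apply, sub_self]
    exact (hsymInt_natCast 0).trans hsym_zero
  · intro i j hij
    have : (i : ℕ) < j := hij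
    rw [Matrix.of_apply, hsymInt_of_neg (by omega)]

theorem toVars_jacobiTrudi_mul_alternant [CharZero K] (α : Fin N → ℕ) :
    toVars K N (jacobiTrudi K α) * alternant K (Fin.val : Fin N → ℕ) = alternant K α := by
  have vandermonde := toVars_jacobiTrudi_mul_det (K := K) (Fin.val : Fin N → ℕ)
  rw [jacobiTrudi_val, map_one, one_mul] at vandermonde
  rw [← vandermonde, toVars_jacobiTrudi_mul_det]

theorem alternant_eq_sum (α : Fin N → ℕ) :
    alternant K α = ∑ σ : Equiv.Perm (Fin N), (Equiv.Perm.sign σ : ℤ) •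
      MvPolynomial.monomial (Finsupp.equivFunOnFinite.symm (α ∘ σ)) 1 := by
  rw [alternant, Matrix.det_apply]
  refine Finset.sum_congr rfl fun σ _ => ?_
  rw [MvPolynomial.monomial_eq, map_one, one_mul, Finsupp.prod_fintype _ _ (by simp)]
  rfl

theorem coeff_alternant {α β : Fin N → ℕ} (hα : StrictMono α) (hβ : StrictMono β) :
    MvPolynomial.coeff (Finsupp.equivFunOnFinite.symm β) (alternant K α) =
      if α = β then 1 else 0 := by
  have eq_of_comp_eq (σ : Equiv.Perm (Fin N)) (h : α ∘ σ = β) : σ = 1 := by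
    have range_eq : Set.range α = Set.range β := by rw [← h, σ.surjective.range_comp]
    obtain rfl := (hα.range_inj hβ).1 range_eq
    exact Equiv.ext fun i => hα.injective (congrFun h i)
  simp only [alternant_eq_sum, MvPolynomial.coeff_sum, MvPolynomial.coeff_smul,
    MvPolynomial.coeff_monomial, Finsupp.equivFunOnFinite.symm.injective.eq_iff]
  rw [Finset.sum_eq_single 1]
  · simp
  · intro σ _ hσ
    rw [if_neg fun h => hσ (eq_of_comp_eq σ h), smul_zero]
  · simp

theorem hall_jacobiTrudi [CharZero K] (f : Sym K) (α : Fin N → ℕ) :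
    hall f (jacobiTrudi K α) = MvPolynomial.coeff (Finsupp.equivFunOnFinite.symm α)
      (toVars K N f * alternant K (Fin.val : Fin N → ℕ)) := by
  rw [jacobiTrudi, ← Matrix.det_transpose, Matrix.det_apply, hall_eq_pairingForm, map_sum,
    alternant_eq_sum, Finset.mul_sum, MvPolynomial.coeff_sum]
  refine Finset.sum_congr rfl fun σ _ => ?_
  rw [Units.smul_def, map_zsmul, mul_smul_comm, MvPolynomial.coeff_smul, ← hall_prod_hsymInt]
  rfl

theorem hall_jacobiTrudi_jacobiTrudi [CharZero K] {α β : Fin N → ℕ} (hα : StrictMono α)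
    (hβ : StrictMono β) :
    hall (jacobiTrudi K α) (jacobiTrudi K β) = if α = β then 1 else 0 := by
  rw [hall_jacobiTrudi, toVars_jacobiTrudi_mul_alternant, coeff_alternant hα hβ]

end Orthonormality

/-! ### Partitions and their beta-numbers -/

section Partitions

variable {n : ℕ}

theorem lt_getD_iff_lt_countP {L : List ℕ} (hL : L.Pairwise (· ≥ ·)) (j k : ℕ) :
    j < L.getD k 0 ↔ k < L.countP (fun i => j < i) := by
  induction L generalizing k with
  | nil => simp
  | cons a t ih =>
    rw [List.pairwise_cons] at hL
    by_cases h : j < a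
    · rw [List.countP_cons_of_pos (by simpa using h)]
      cases k with
      | zero => simpa using h
      | succ k => simpa using ih hL.2 k
    · have all_le : ∀ b ∈ a :: t, ¬ j < b := by
        intro b hb
        rcases List.mem_cons.1 hb with rfl | hb
        · exact h
        · exact fun hjb => h (hjb.trans_le (hL.1 b hb))
      rw [List.countP_eq_zero.2 (by simpa using all_le), List.getD_eq_getElem?_getD]
      simp only [Nat.not_lt_zero, iff_false]
      rcases hb : (a :: t)[k]? with _ | b
      · simp
      · exact all_le b (List.mem_of_getElem? hb)

theorem coe_rows (l : n.Partition) : ((rows l : List ℕ) : Multiset ℕ) = l.parts :=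
  Multiset.sort_eq _ _

theorem length_rows (l : n.Partition) : (rows l).length = len l := by
  rw [len, ← coe_rows, Multiset.coe_card]

theorem lt_row_iff (l : n.Partition) (j k : ℕ) : j < row l k ↔ k < col l j := by
  rw [row, lt_getD_iff_lt_countP (L := rows l) (Multiset.pairwise_sort _ _), col, ← coe_rows,
    Multiset.coe_countP]

theorem col_zero (l : n.Partition) : col l 0 = len l := by
  rw [col, len, Multiset.countP_eq_card]
  exact fun i hi => l.parts_pos hi

theorem col_antitone (l : n.Partition) : Antitone (col l) := fun i j hij =>
  le_of_forall_lt fun k hk => (lt_row_iff l i k).1 (hij.trans_lt ((lt_row_iff l j k).2 hk))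

theorem row_antitone (l : n.Partition) : Antitone (row l) := fun i j hij =>
  le_of_forall_lt fun k hk => (lt_row_iff l k i).2 (hij.trans_lt ((lt_row_iff l k j).1 hk))

theorem col_le_len (l : n.Partition) (j : ℕ) : col l j ≤ len l :=
  (col_antitone l (Nat.zero_le j)).trans_eq (col_zero l)

theorem row_pos_iff (l : n.Partition) (i : ℕ) : 0 < row l i ↔ i < len l := by
  rw [lt_row_iff, col_zero]

theorem row_eq_zero (l : n.Partition) {i : ℕ} (h : len l ≤ i) : row l i = 0 :=
  Nat.eq_zero_of_not_pos fun hi => h.not_gt ((row_pos_iff l i).1 hi)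

theorem sum_row (l : n.Partition) : ∑ i ∈ Finset.range (len l), row l i = n := by
  refine Eq.trans ?_ l.parts_sum
  rw [← coe_rows, Multiset.sum_coe, ← length_rows, ← Fin.sum_univ_eq_sum_range,
    ← Fin.sum_univ_getElem]
  exact Finset.sum_congr rfl fun i _ => by simp [row]

theorem row_le (l : n.Partition) (i : ℕ) : row l i ≤ n := by
  rcases lt_or_ge i (len l) with h | h
  · exact (Finset.single_le_sum (fun _ _ => Nat.zero_le _) (Finset.mem_range.2 h)).trans_eq
      (sum_row l)
  · exact (row_eq_zero l h).trans_le (Nat.zero_le n)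

theorem row_injective : Function.Injective (row (n := n)) := by
  intro l m h
  have len_eq : len l = len m :=
    eq_of_forall_lt_iff fun i => by rw [← row_pos_iff, ← row_pos_iff, h]
  have rows_eq : rows l = rows m := by
    refine List.ext_getElem (by rw [length_rows, length_rows, len_eq]) fun i hl hm => ?_
    simpa only [row, List.getD_eq_getElem, hl, hm] using congrFun h i
  rw [Nat.Partition.ext_iff, ← coe_rows l, ← coe_rows m, rows_eq]

@[to_additive]
theorem prod_cells {M : Type*} [CommMonoid M] (l : n.Partition) (f : ℕ × ℕ → M) :
    ∏ s ∈ cells l, f s = ∏ i ∈ Finset.range (len l), ∏ j ∈ Finset.range (row l i), f (i, j) := by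
  rw [cells, Finset.prod_filter, Finset.prod_product]
  refine Finset.prod_congr rfl fun i _ => ?_
  rw [← Finset.prod_filter]
  refine Finset.prod_congr ?_ fun _ _ => rfl
  ext j
  have := row_le l i
  simp only [Finset.mem_filter, Finset.mem_range]
  omega

/-- The `i`-th smallest of the `N` beta-numbers `λ_k + N - k` of a partition. -/
def betaSeq (l : n.Partition) (N : ℕ) (i : Fin N) : ℕ := row l i.rev + i

/-- The natural numbers which are not among the `N` beta-numbers of `l`, in increasing order (for
`N ≥ len l`). -/
def gapSeq (l : n.Partition) (N : ℕ) (j : ℕ) : ℕ := N + j - col l j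

theorem betaSeq_strictMono (l : n.Partition) (N : ℕ) : StrictMono (betaSeq l N) := fun _ _ hij =>
  add_lt_add_of_le_of_lt (row_antitone l (Fin.rev_le_rev.2 hij.le)) hij

theorem gapSeq_strictMono (l : n.Partition) {N : ℕ} (hN : len l ≤ N) :
    StrictMono (gapSeq l N) := by
  intro i j hij
  have := col_antitone l hij.le
  have := col_le_len l i
  simp only [gapSeq]
  omega

theorem gapSeq_lt_betaSeq (l : n.Partition) {N j : ℕ} {i : Fin N} (hj : j < row l i.rev) :
    gapSeq l N j < betaSeq l N i := by
  have := (lt_row_iff l j i.rev).1 hj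
  simp only [gapSeq, betaSeq, Fin.val_rev] at *
  omega

theorem betaSeq_ne_gapSeq (l : n.Partition) {N : ℕ} (i : Fin N) (j : ℕ) :
    betaSeq l N i ≠ gapSeq l N j := by
  rcases lt_or_ge j (row l i.rev) with hj | hj
  · exact (gapSeq_lt_betaSeq l hj).ne'
  · have := (lt_row_iff l j i.rev).not.1 hj.not_gt
    simp only [gapSeq, betaSeq, Fin.val_rev] at *
    omega

theorem betaSeq_sub_gapSeq (l : n.Partition) {N j : ℕ} {i : Fin N} (hN : len l ≤ N)
    (hj : j < row l i.rev) :
    betaSeq l N i - gapSeq l N j = arm l (i.rev, j) + leg l (i.rev, j) + 1 := by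
  have := (lt_row_iff l j i.rev).1 hj
  have := col_le_len l j
  simp only [arm, leg, gapSeq, betaSeq, Fin.val_rev] at *
  omega

theorem prod_range_betaSeq {M : Type*} [CommMonoid M] (l : n.Partition) {N : ℕ} (hN : len l ≤ N)
    (i : Fin N) (f : ℕ → M) :
    (∏ j ∈ Finset.range (row l i.rev), f (gapSeq l N j)) *
      ∏ k ∈ Finset.Iio i, f (betaSeq l N k) = ∏ x ∈ Finset.range (betaSeq l N i), f x := by
  have gap_inj := (gapSeq_strictMono l hN).injective
  have beta_inj := (betaSeq_strictMono l N).injective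
  have disjoint : Disjoint ((Finset.range (row l i.rev)).image (gapSeq l N))
      ((Finset.Iio i).image (betaSeq l N)) := by
    simp only [Finset.disjoint_left, Finset.mem_image]
    rintro _ ⟨j, -, rfl⟩ ⟨k, -, hk⟩
    exact betaSeq_ne_gapSeq l k j hk
  have union_eq : (Finset.range (row l i.rev)).image (gapSeq l N) ∪
      (Finset.Iio i).image (betaSeq l N) = Finset.range (betaSeq l N i) := by
    refine Finset.eq_of_subset_of_card_le (Finset.union_subset ?_ ?_) ?_
    · exact Finset.image_subset_iff.2 fun j hj =>
        Finset.mem_range.2 (gapSeq_lt_betaSeq l (Finset.mem_range.1 hj))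
    · exact Finset.image_subset_iff.2 fun k hk =>
        Finset.mem_range.2 (betaSeq_strictMono l N (Finset.mem_Iio.1 hk))
    · rw [Finset.card_union_of_disjoint disjoint, Finset.card_image_of_injective _ gap_inj,
        Finset.card_image_of_injective _ beta_inj, Finset.card_range, Finset.card_range,
        Fin.card_Iio, betaSeq]
  rw [← union_eq, Finset.prod_union disjoint, Finset.prod_image gap_inj.injOn,
    Finset.prod_image beta_inj.injOn]

variable {K : Type*} [Field K]

theorem schur_eq_jacobiTrudi_len (l : n.Partition) :
    (schur l : Sym K) = jacobiTrudi K (betaSeq l (len l)) := by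
  rw [schur, jacobiTrudi, ← Matrix.det_submatrix_equiv_self Fin.revPerm]
  congr 1
  ext1 i j
  simp only [Matrix.submatrix_apply, Matrix.of_apply, betaSeq, Fin.revPerm_apply, Fin.val_rev]
  congr 1
  omega

theorem jacobiTrudi_betaSeq_succ (l : n.Partition) {N : ℕ} (hN : len l ≤ N) :
    jacobiTrudi K (betaSeq l (N + 1)) = jacobiTrudi K (betaSeq l N) := by
  have beta_zero : betaSeq l (N + 1) 0 = 0 := by simp [betaSeq, row_eq_zero l hN]
  have beta_succ (i : Fin N) : betaSeq l (N + 1) i.succ = betaSeq l N i + 1 := by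
    simp [betaSeq, Fin.rev_succ, add_assoc]
  rw [jacobiTrudi, Matrix.det_succ_row_zero, Fin.sum_univ_succ, Finset.sum_eq_zero, add_zero]
  · simp only [Matrix.of_apply, beta_zero, Fin.val_zero, pow_zero, sub_self, one_mul]
    rw [← Nat.cast_zero, hsymInt_natCast, hsym_zero, one_mul, jacobiTrudi]
    congr 1
    ext1 i j
    simp [beta_succ]
  · intro j _
    rw [Matrix.of_apply, beta_zero, hsymInt_of_neg (by simp; omega), mul_zero, zero_mul]

theorem schur_eq_jacobiTrudi (l : n.Partition) {N : ℕ} (hN : len l ≤ N) :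
    (schur l : Sym K) = jacobiTrudi K (betaSeq l N) := by
  induction N, hN using Nat.le_induction with
  | base => exact schur_eq_jacobiTrudi_len l
  | succ N hN ih => rw [jacobiTrudi_betaSeq_succ l hN, ih]

theorem betaSeq_injective {l m : n.Partition} {N : ℕ} (hl : len l ≤ N) (hm : len m ≤ N)
    (h : betaSeq l N = betaSeq m N) : l = m := by
  refine row_injective (funext fun i => ?_)
  rcases lt_or_ge i N with hi | hi
  · simpa [betaSeq] using congrFun h (Fin.rev ⟨i, hi⟩)
  · rw [row_eq_zero l (hl.trans hi), row_eq_zero m (hm.trans hi)]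

theorem hall_schur [CharZero K] [DecidableEq n.Partition] (l m : n.Partition) :
    hall (schur l : Sym K) (schur m) = if l = m then 1 else 0 := by
  have hl : len l ≤ len l + len m := Nat.le_add_right _ _
  have hm : len m ≤ len l + len m := Nat.le_add_left _ _
  rw [schur_eq_jacobiTrudi l hl, schur_eq_jacobiTrudi m hm,
    hall_jacobiTrudi_jacobiTrudi (betaSeq_strictMono l _) (betaSeq_strictMono m _)]
  exact if_congr ⟨betaSeq_injective hl hm, fun h => h ▸ rfl⟩ rfl rfl

end Partitions

/-! ### Principal specialization -/

section Determinants

theorem derivation_det {R A ι : Type*} [CommRing R] [CommRing A] [Algebra R A] [DecidableEq ι]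
    [Fintype ι] (D : Derivation R A A) (M : Matrix ι ι A) :
    D M.det = ∑ k, (M.updateCol k fun i => D (M i k)).det := by
  simp only [Matrix.det_apply, map_sum]
  rw [Finset.sum_comm]
  refine Finset.sum_congr rfl fun σ _ => ?_
  rw [Units.smul_def, map_zsmul, derivation_prod, Finset.smul_sum]
  refine Finset.sum_congr rfl fun k _ => ?_
  rw [← Finset.prod_erase_mul Finset.univ _ (Finset.mem_univ k), Matrix.updateCol_self,
    Units.smul_def]
  congr 2
  refine Finset.prod_congr rfl fun i hi => ?_
  rw [Matrix.updateCol_ne (Finset.ne_of_mem_erase hi)]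

variable {R : Type*} [CommRing R] {N : ℕ}

theorem det_eval_polynomials (v : Fin N → R) (p : Fin N → Polynomial R)
    (hp : ∀ j, (p j).natDegree ≤ j) :
    (Matrix.of fun i j => (p j).eval (v i)).det =
      (Matrix.vandermonde v).det * ∏ j : Fin N, (p j).coeff j := by
  rw [Matrix.eval_matrixOfPolynomials_eq_vandermonde_mul_matrixOfPolynomials v p hp, Matrix.det_mul,
    Matrix.det_of_isUpperTriangular (M := Matrix.of fun i j : Fin N => (p j).coeff i)]
  · rfl
  · intro i j hij
    exact Polynomial.coeff_eq_zero_of_natDegree_lt ((hp j).trans_lt hij)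

/-- The last column only depends on `g` modulo `∏ (X - v_i)`. -/
theorem det_eval_snoc (v : Fin (N + 1) → R) (p : Fin N → Polynomial R)
    (hp : ∀ j, (p j).natDegree ≤ j) {g : Polynomial R} (hg : g.natDegree ≤ N + 1) :
    (Matrix.of fun i j => (Fin.snoc (α := fun _ => Polynomial R) p g j).eval (v i)).det =
      (Matrix.vandermonde v).det *
        ((∏ j, (p j).coeff j) * (g.coeff N + g.coeff (N + 1) * ∑ i, v i)) := by
  nontriviality R
  let V := ∏ i, (Polynomial.X - Polynomial.C (v i))
  have natDegree_V : V.natDegree = N + 1 := by simp [V]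
  have coeff_V : V.coeff (N + 1) = 1 := by
    rw [← natDegree_V]
    exact Polynomial.monic_prod_of_monic _ _ fun i _ => Polynomial.monic_X_sub_C _
  have coeff_V_pred : V.coeff N = -∑ i, v i := by
    simpa using Polynomial.prod_X_sub_C_coeff_card_pred Finset.univ v (by simp)
  let r := g - Polynomial.C (g.coeff (N + 1)) * V
  have eval_r (i) : r.eval (v i) = g.eval (v i) := by
    simp [r, V, Polynomial.eval_prod, Finset.prod_eq_zero (Finset.mem_univ i)]
  have natDegree_r : r.natDegree ≤ N := by
    refine Polynomial.natDegree_le_iff_coeff_eq_zero.2 fun m hm => ?_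
    rw [Polynomial.coeff_sub, Polynomial.coeff_C_mul]
    rcases (Nat.succ_le_of_lt hm).eq_or_lt with rfl | hm
    · rw [Nat.succ_eq_add_one, coeff_V, mul_one, sub_self]
    · rw [Polynomial.coeff_eq_zero_of_natDegree_lt (hg.trans_lt hm),
        Polynomial.coeff_eq_zero_of_natDegree_lt (natDegree_V.trans_lt hm), mul_zero, sub_zero]
  have reduce := det_eval_polynomials v (Fin.snoc (α := fun _ => Polynomial R) p r)
    (Fin.lastCases (by simpa using natDegree_r) (by simpa using hp))
  rw [Fin.prod_univ_castSucc] at reduce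
  simp only [Fin.snoc_castSucc, Fin.snoc_last, Fin.val_castSucc, Fin.val_last] at reduce
  rw [show g.coeff N + g.coeff (N + 1) * ∑ i, v i = r.coeff N by
    rw [Polynomial.coeff_sub, Polynomial.coeff_C_mul, coeff_V_pred]; ring, ← reduce]
  congr 1
  ext i j
  refine Fin.lastCases ?_ (fun j => ?_) j
  · simp [eval_r]
  · simp

end Determinants

section PrincipalSpecialization

open PowerSeries

variable {K : Type*} [Field K] {q : K}

/-- The `q`-factorial `(1 - q) ⋯ (1 - q ^ m)`. -/
def qFac (q : K) (m : ℕ) : K := ∏ i ∈ Finset.range m, (1 - q ^ (i + 1))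

theorem qFac_succ (m : ℕ) : qFac q (m + 1) = qFac q m * (1 - q ^ (m + 1)) :=
  Finset.prod_range_succ _ _

theorem one_sub_pow_ne_zero (hq : ∀ k : ℕ, 0 < k → q ^ k ≠ 1) {m : ℕ} (hm : 0 < m) :
    1 - q ^ m ≠ 0 :=
  sub_ne_zero.2 (hq m hm).symm

theorem qFac_ne_zero (hq : ∀ k : ℕ, 0 < k → q ^ k ≠ 1) (m : ℕ) : qFac q m ≠ 0 :=
  Finset.prod_ne_zero_iff.2 fun i _ => one_sub_pow_ne_zero hq i.succ_pos

theorem prod_range_one_sub_pow_sub (b : ℕ) :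
    ∏ x ∈ Finset.range b, (1 - q ^ (b - x)) = qFac q b := by
  rw [qFac, ← Finset.prod_range_reflect]
  refine Finset.prod_congr rfl fun x hx => ?_
  have := Finset.mem_range.1 hx
  congr 2
  omega

/-- The principal specialization `p_k ↦ 1 / (1 - q ^ k)`, which is evaluation at the variables
`1, q, q ^ 2, …` when `|q| < 1`. -/
def principal (q : K) : Sym K →+* K := MvPolynomial.eval fun k : ℕ+ => (1 - q ^ (k : ℕ))⁻¹

/-- Multiplication of the variables by `q` removes the variable `1`. -/
theorem rescale_hsymSeries_principal [CharZero K] (hq : ∀ k : ℕ, 0 < k → q ^ k ≠ 1) :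
    rescale q (hsymSeries (principal q)) = (1 - X) * hsymSeries (principal q) := by
  set P := psumSeries (principal q) with hP
  have derivative_rescale (f : PowerSeries K) :
      d⁄dX K (rescale q f) = C q * rescale q (d⁄dX K f) := by
    ext m
    rw [coeff_derivative, coeff_rescale, coeff_C_mul, coeff_rescale, coeff_derivative, pow_succ]
    ring
  have geometric : (P - C q * rescale q P) * (1 - X) = 1 := by
    refine Eq.trans (congrArg (· * (1 - X)) ?_) (mk_one_mul_one_sub_eq_one K)
    ext k
    have := one_sub_pow_ne_zero hq k.succ_pos
    simp only [hP, psumSeries, principal, map_sub, coeff_C_mul, coeff_rescale, coeff_mk,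
      MvPolynomial.eval_X, Nat.succPNat_coe, Pi.one_apply]
    rw [← mul_assoc, ← pow_succ', ← one_sub_mul, mul_inv_cancel₀ this]
  refine eq_of_derivative_eq_mul (a := C q * rescale q P) ?_ ?_ ?_
  · rw [derivative_rescale, derivative_hsymSeries, map_mul, mul_assoc]
  · rw [Derivation.leibniz, map_sub, Derivation.map_one_eq_zero, derivative_X, smul_eq_mul,
      smul_eq_mul, derivative_hsymSeries]
    linear_combination hsymSeries (principal q) * geometric
  · rw [← coeff_zero_eq_constantCoeff_apply, coeff_rescale]
    simp [constantCoeff_hsymSeries]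

theorem principal_hsym [CharZero K] (hq : ∀ k : ℕ, 0 < k → q ^ k ≠ 1) (m : ℕ) :
    principal q (hsym m) = (qFac q m)⁻¹ := by
  induction m with
  | zero => simp [hsym_zero, qFac]
  | succ m ih =>
    have recursion := congrArg (coeff (m + 1)) (rescale_hsymSeries_principal hq)
    rw [coeff_rescale, sub_mul, one_mul, map_sub, coeff_succ_X_mul, hsymSeries, coeff_mk, coeff_mk,
      ih] at recursion
    have := one_sub_pow_ne_zero hq m.succ_pos
    rw [qFac_succ, mul_inv]
    field_simp
    linear_combination -recursion

/-- The polynomial `∏_{r < d} (1 - q ^ {-r} x)`, whose value at `x = q ^ b` is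
`(1 - q ^ b) ⋯ (1 - q ^ (b - d + 1))`. -/
def fallPoly (q : K) (d : ℕ) : Polynomial K :=
  ∏ r ∈ Finset.range d, (1 - Polynomial.C (q⁻¹ ^ r) * Polynomial.X)

theorem fallPoly_succ (d : ℕ) :
    fallPoly q (d + 1) = fallPoly q d * (1 - Polynomial.C (q⁻¹ ^ d) * Polynomial.X) :=
  Finset.prod_range_succ _ _

theorem natDegree_fallPoly_le (d : ℕ) : (fallPoly q d).natDegree ≤ d := by
  induction d with
  | zero => simp [fallPoly]
  | succ d ih =>
    rw [fallPoly_succ]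
    exact Polynomial.natDegree_mul_le_of_le ih (by compute_degree)

theorem coeff_fallPoly_succ (d k : ℕ) : (fallPoly q (d + 1)).coeff (k + 1) =
    (fallPoly q d).coeff (k + 1) - q⁻¹ ^ d * (fallPoly q d).coeff k := by
  rw [fallPoly_succ, mul_sub, mul_one, mul_left_comm, Polynomial.coeff_sub, Polynomial.coeff_C_mul,
    Polynomial.coeff_mul_X]

theorem coeff_fallPoly_succ_self (d : ℕ) :
    (fallPoly q (d + 1)).coeff (d + 1) = -(q⁻¹ ^ d * (fallPoly q d).coeff d) := by
  rw [coeff_fallPoly_succ, Polynomial.coeff_eq_zero_of_natDegree_lt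
    (Nat.lt_succ_of_le (natDegree_fallPoly_le d)), zero_sub]

theorem coeff_fallPoly_succ_pred (hq0 : q ≠ 0) (d : ℕ) :
    (fallPoly q (d + 1)).coeff d =
      q⁻¹ ^ d * (∑ r ∈ Finset.range (d + 1), q ^ r) * (fallPoly q d).coeff d := by
  induction d with
  | zero => simp [fallPoly]
  | succ d ih =>
    have cancel : q⁻¹ ^ (d + 1) * q ^ (d + 1) = 1 := by
      rw [← mul_pow, inv_mul_cancel₀ hq0, one_pow]
    rw [coeff_fallPoly_succ, ih, Finset.sum_range_succ _ (d + 1), coeff_fallPoly_succ_self]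
    linear_combination q⁻¹ ^ d * (fallPoly q d).coeff d * cancel

theorem principal_hsymInt [CharZero K] (hq0 : q ≠ 0) (hq : ∀ k : ℕ, 0 < k → q ^ k ≠ 1)
    (b d : ℕ) :
    principal q (hsymInt ((b : ℤ) - d)) = (qFac q b)⁻¹ * (fallPoly q d).eval (q ^ b) := by
  have principal_pred (m : ℤ) :
      principal q (hsymInt (m - 1)) = principal q (hsymInt m) * (1 - q ^ m) := by
    rcases lt_trichotomy m 0 with hm | rfl | hm
    · rw [hsymInt_of_neg hm, hsymInt_of_neg (by omega), map_zero, zero_mul]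
    · rw [hsymInt_of_neg (by omega), map_zero, zpow_zero, sub_self, mul_zero]
    · obtain ⟨k, rfl⟩ : ∃ k : ℕ, m = ((k + 1 : ℕ) : ℤ) := ⟨(m - 1).toNat, by omega⟩
      rw [show ((k + 1 : ℕ) : ℤ) - 1 = (k : ℕ) by omega, hsymInt_natCast, hsymInt_natCast,
        principal_hsym hq, principal_hsym hq, qFac_succ, mul_inv, mul_assoc, zpow_natCast,
        inv_mul_cancel₀ (one_sub_pow_ne_zero hq k.succ_pos), mul_one]
  induction d with
  | zero => simp [hsymInt_natCast, principal_hsym hq, fallPoly]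
  | succ d ih =>
    rw [Nat.cast_succ, ← sub_sub, principal_pred, ih, fallPoly_succ, Polynomial.eval_mul, mul_assoc]
    simp only [zpow_sub₀ hq0, zpow_natCast, div_eq_mul_inv, inv_pow, mul_comm (q ^ b),
      Polynomial.eval_sub, Polynomial.eval_one, Polynomial.eval_mul, Polynomial.eval_C,
      Polynomial.eval_X]

variable {N : ℕ}

theorem principal_jacobiTrudi [CharZero K] (hq0 : q ≠ 0) (hq : ∀ k : ℕ, 0 < k → q ^ k ≠ 1)
    (α : Fin N → ℕ) :
    principal q (jacobiTrudi K α) = (∏ i, (qFac q (α i))⁻¹) *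
      ((Matrix.vandermonde fun i => q ^ α i).det * ∏ j : Fin N, (fallPoly q j).coeff j) := by
  rw [jacobiTrudi, RingHom.map_det, ← det_eval_polynomials _ _ (fun j => natDegree_fallPoly_le _),
    ← Matrix.det_mul_column]
  congr 1
  ext1 i j
  exact principal_hsymInt hq0 hq _ _

theorem pderiv_one_jacobiTrudi [CharZero K] (α : Fin (N + 1) → ℕ) :
    MvPolynomial.pderiv 1 (jacobiTrudi K α) = Matrix.det (Matrix.of fun i j : Fin (N + 1) =>
      (hsymInt ((α i : ℤ) - (if j = Fin.last N then N + 1 else (j : ℕ) : ℕ)) : Sym K)) := by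
  have pderiv_one_hsymInt (m : ℤ) :
      MvPolynomial.pderiv 1 (hsymInt m : Sym K) = hsymInt (m - 1) := by
    simpa using pderiv_hsymInt (K := K) 1 m
  rw [jacobiTrudi, derivation_det, Fin.sum_univ_castSucc, Finset.sum_eq_zero, zero_add]
  · congr 1
    ext1 i j
    refine Fin.lastCases ?_ (fun j => ?_) j
    · simp [pderiv_one_hsymInt, sub_sub]
    · rw [Matrix.updateCol_ne (Fin.castSucc_lt_last j).ne, Matrix.of_apply, Matrix.of_apply,
        if_neg (Fin.castSucc_lt_last j).ne]
  · intro k _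
    refine Matrix.det_zero_of_column_eq (i := k.castSucc) (j := k.succ)
      Fin.castSucc_lt_succ.ne fun i => ?_
    rw [Matrix.updateCol_self, Matrix.updateCol_ne Fin.castSucc_lt_succ.ne']
    simp [pderiv_one_hsymInt, sub_sub]

theorem principal_pderiv_jacobiTrudi [CharZero K] (hq0 : q ≠ 0)
    (hq : ∀ k : ℕ, 0 < k → q ^ k ≠ 1) (α : Fin (N + 1) → ℕ) :
    principal q (MvPolynomial.pderiv 1 (jacobiTrudi K α)) =
      q⁻¹ ^ N * (∑ r ∈ Finset.range (N + 1), q ^ r - ∑ i, q ^ α i) *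
        principal q (jacobiTrudi K α) := by
  have det_eq : principal q (MvPolynomial.pderiv 1 (jacobiTrudi K α)) =
      (∏ i, (qFac q (α i))⁻¹) * ((Matrix.vandermonde fun i => q ^ α i).det *
        ((∏ j : Fin N, (fallPoly q j).coeff j) * ((fallPoly q (N + 1)).coeff N +
          (fallPoly q (N + 1)).coeff (N + 1) * ∑ i, q ^ α i))) := by
    rw [pderiv_one_jacobiTrudi, RingHom.map_det, ← det_eval_snoc (fun i => q ^ α i)
      (fun j => fallPoly q j) (fun j => natDegree_fallPoly_le _) (natDegree_fallPoly_le _),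
      ← Matrix.det_mul_column]
    congr 1
    ext1 i j
    simp only [RingHom.mapMatrix_apply, Matrix.map_apply, Matrix.of_apply,
      principal_hsymInt hq0 hq]
    refine Fin.lastCases ?_ (fun j => ?_) j
    · simp
    · simp [(Fin.castSucc_lt_last j).ne]
  rw [det_eq, principal_jacobiTrudi hq0 hq, coeff_fallPoly_succ_self, coeff_fallPoly_succ_pred hq0,
    Fin.prod_univ_castSucc fun j : Fin (N + 1) => (fallPoly q j).coeff j]
  simp only [Fin.val_castSucc, Fin.val_last]
  ring

theorem det_vandermonde_pow {α : Fin N → ℕ} (hα : StrictMono α) :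
    (Matrix.vandermonde fun i => q ^ α i).det = (∏ i : Fin N, (-1) ^ (i.rev : ℕ)) *
      (∏ i : Fin N, (q ^ α i) ^ (i.rev : ℕ)) *
        ∏ k, ∏ i ∈ Finset.Iio k, (1 - q ^ (α k - α i)) := by
  have card_Ioi (i : Fin N) : (Finset.Ioi i).card = (i.rev : ℕ) := by
    rw [Fin.card_Ioi, Fin.val_rev]
    omega
  have swap : ∏ k, ∏ i ∈ Finset.Iio k, (1 - q ^ (α k - α i)) =
      ∏ i, ∏ k ∈ Finset.Ioi i, (1 - q ^ (α k - α i)) :=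
    Finset.prod_comm' fun k i => by simp
  rw [Matrix.det_vandermonde, swap, ← Finset.prod_mul_distrib, ← Finset.prod_mul_distrib]
  refine Finset.prod_congr rfl fun i _ => ?_
  rw [← card_Ioi, ← Finset.prod_const, ← Finset.prod_const, ← Finset.prod_mul_distrib,
    ← Finset.prod_mul_distrib]
  refine Finset.prod_congr rfl fun k hk => ?_
  rw [← Nat.add_sub_of_le (hα (Finset.mem_Ioi.1 hk)).le, pow_add, Nat.add_sub_cancel_left]
  ring

theorem prod_Iio_one_sub_pow_sub (k : Fin N) :
    ∏ i ∈ Finset.Iio k, (1 - q ^ ((k : ℕ) - (i : ℕ))) = qFac q k := by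
  rw [← prod_range_one_sub_pow_sub, ← Nat.Iio_eq_range, ← Fin.map_valEmbedding_Iio,
    Finset.prod_map]
  rfl

theorem principal_jacobiTrudi_mul_prod_qFac [CharZero K] (hq0 : q ≠ 0)
    (hq : ∀ k : ℕ, 0 < k → q ^ k ≠ 1) {α : Fin N → ℕ} (hα : StrictMono α) :
    principal q (jacobiTrudi K α) * (∏ i, qFac q (α i)) * ∏ i : Fin N, (q ^ (i : ℕ)) ^ (i.rev : ℕ) =
      (∏ i : Fin N, (q ^ α i) ^ (i.rev : ℕ)) *
        ∏ k, ∏ i ∈ Finset.Iio k, (1 - q ^ (α k - α i)) := by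
  have prod_qFac_ne_zero (β : Fin N → ℕ) : ∏ i, qFac q (β i) ≠ 0 :=
    Finset.prod_ne_zero_iff.2 fun i _ => qFac_ne_zero hq _
  have normalization := principal_jacobiTrudi hq0 hq (Fin.val : Fin N → ℕ)
  rw [jacobiTrudi_val, map_one, det_vandermonde_pow Fin.val_strictMono, Finset.prod_inv_distrib,
    Finset.prod_congr rfl fun k _ => prod_Iio_one_sub_pow_sub k] at normalization
  have := prod_qFac_ne_zero Fin.val
  have := prod_qFac_ne_zero α
  rw [principal_jacobiTrudi hq0 hq, det_vandermonde_pow hα, Finset.prod_inv_distrib]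
  field_simp at normalization ⊢
  linear_combination -(∏ i : Fin N, (q ^ α i) ^ (i.rev : ℕ)) *
    (∏ k, ∏ i ∈ Finset.Iio k, (1 - q ^ (α k - α i))) * normalization

theorem principal_schur [CharZero K] (hq0 : q ≠ 0) (hq : ∀ k : ℕ, 0 < k → q ^ k ≠ 1)
    {n : ℕ} (l : n.Partition) :
    (∏ s ∈ cells l, (1 - q ^ (arm l s + leg l s + 1))) * principal q (schur l) = q ^ nStat l := by
  set N := len l
  set β := betaSeq l N with hβ
  have hook_eq : (∏ s ∈ cells l, (1 - q ^ (arm l s + leg l s + 1))) *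
      ∏ k, ∏ i ∈ Finset.Iio k, (1 - q ^ (β k - β i)) = ∏ i, qFac q (β i) := by
    rw [prod_cells, Finset.prod_range, ← Equiv.prod_comp Fin.revPerm, ← Finset.prod_mul_distrib]
    refine Finset.prod_congr rfl fun i _ => ?_
    rw [← prod_range_one_sub_pow_sub, ← prod_range_betaSeq l le_rfl i]
    congr 1
    refine Finset.prod_congr rfl fun j hj => ?_
    rw [betaSeq_sub_gapSeq l le_rfl (Finset.mem_range.1 hj), Fin.revPerm_apply]
  have pow_eq : ∏ i : Fin N, (q ^ β i) ^ (i.rev : ℕ) =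
      q ^ nStat l * ∏ i : Fin N, (q ^ (i : ℕ)) ^ (i.rev : ℕ) := by
    rw [nStat, Finset.sum_range, ← Finset.prod_pow_eq_pow_sum, ← Equiv.prod_comp Fin.revPerm,
      ← Finset.prod_mul_distrib]
    refine Finset.prod_congr rfl fun i _ => ?_
    rw [Fin.revPerm_apply, hβ, betaSeq, Fin.rev_rev, pow_add, mul_pow, ← pow_mul,
      mul_comm (row l _), pow_right_comm]
  have specialized := principal_jacobiTrudi_mul_prod_qFac hq0 hq (betaSeq_strictMono l N)
  rw [← schur_eq_jacobiTrudi_len, ← hβ, pow_eq] at specialized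
  have prod_qFac_ne_zero : ∏ i, qFac q (β i) ≠ 0 :=
    Finset.prod_ne_zero_iff.2 fun i _ => qFac_ne_zero hq _
  have prod_pow_ne_zero : ∏ i : Fin N, (q ^ (i : ℕ)) ^ (i.rev : ℕ) ≠ 0 :=
    Finset.prod_ne_zero_iff.2 fun i _ => pow_ne_zero _ (pow_ne_zero _ hq0)
  refine mul_right_cancel₀ (mul_ne_zero prod_qFac_ne_zero prod_pow_ne_zero) ?_
  rw [← hook_eq] at specialized ⊢
  linear_combination (∏ s ∈ cells l, (1 - q ^ (arm l s + leg l s + 1))) * specialized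

theorem principal_pderiv_schur [CharZero K] (hq0 : q ≠ 0) (hq : ∀ k : ℕ, 0 < k → q ^ k ≠ 1)
    {n : ℕ} (l : n.Partition) :
    principal q (MvPolynomial.pderiv 1 (schur l)) =
      (1 - q) * (∑ s ∈ cells l, q ^ s.2 * q⁻¹ ^ s.1) * principal q (schur l) := by
  have sum_geometric : (1 - q) * ∑ s ∈ cells l, q ^ s.2 * q⁻¹ ^ s.1 =
      ∑ i ∈ Finset.range (len l + 1), q⁻¹ ^ i * (1 - q ^ row l i) := by
    rw [Finset.sum_range_succ, row_eq_zero l le_rfl, pow_zero, sub_self, mul_zero, add_zero,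
      sum_cells, Finset.mul_sum]
    refine Finset.sum_congr rfl fun i _ => ?_
    simp only [← Finset.sum_mul]
    rw [← mul_assoc, mul_neg_geom_sum, mul_comm]
  have pow_rev (i : Fin (len l + 1)) : q⁻¹ ^ len l * q ^ (i.rev : ℕ) = q⁻¹ ^ (i : ℕ) := by
    rw [inv_pow, inv_pow, inv_mul_eq_iff_eq_mul₀ (pow_ne_zero _ hq0), eq_mul_inv_iff_mul_eq₀
      (pow_ne_zero _ hq0), ← pow_add, Fin.val_rev]
    congr 1
    omega
  rw [schur_eq_jacobiTrudi l (Nat.le_succ _), principal_pderiv_jacobiTrudi hq0 hq, sum_geometric,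
    Finset.sum_range, Finset.sum_range, ← Finset.sum_sub_distrib, ← Equiv.sum_comp Fin.revPerm,
    Finset.mul_sum]
  congr 1
  refine Finset.sum_congr rfl fun i _ => ?_
  rw [← pow_rev, Fin.revPerm_apply, betaSeq, Fin.rev_rev, pow_add]
  ring

end PrincipalSpecialization

/-! ### Reduction of the Macdonald functions at `z w = 1` -/

section Reduction

variable {L : Type*} [Field L] [Algebra ℚ L]

theorem algebraMap_ne_zero_of_aeval_ne_zero {a : Fin 2 → L} {d : MvPolynomial (Fin 2) ℚ}
    (hd : MvPolynomial.aeval a d ≠ 0) : algebraMap (MvPolynomial (Fin 2) ℚ) QZW d ≠ 0 := by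
  intro h
  apply hd
  rw [IsFractionRing.injective (MvPolynomial (Fin 2) ℚ) QZW (h.trans (map_zero _).symm), map_zero]

/-- The pairs `(f, f(a))` for the rational functions `f` defined at `a`. As a ring it is the local
ring of the point `a`, through which a computation in `ℚ(z, w)` is evaluated at `a`. -/
def valuePairs (a : Fin 2 → L) : Subalgebra ℚ (QZW × L) where
  carrier := {x | ∃ y : MvPolynomial (Fin 2) ℚ × MvPolynomial (Fin 2) ℚ,
    IsFracAt x.1 a y ∧ x.2 = MvPolynomial.aeval a y.1 / MvPolynomial.aeval a y.2}
  mul_mem' := by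
    rintro ⟨_, _⟩ ⟨_, _⟩ ⟨⟨p, d⟩, ⟨hd, rfl⟩, rfl⟩ ⟨⟨p', d'⟩, ⟨hd', rfl⟩, rfl⟩
    refine ⟨(p * p', d * d'), ⟨by simpa only [map_mul] using mul_ne_zero hd hd', ?_⟩, ?_⟩
    · simp only [Prod.mk_mul_mk, map_mul, div_mul_div_comm]
    · simp only [Prod.mk_mul_mk, map_mul, div_mul_div_comm]
  add_mem' := by
    rintro ⟨_, _⟩ ⟨_, _⟩ ⟨⟨p, d⟩, ⟨hd, rfl⟩, rfl⟩ ⟨⟨p', d'⟩, ⟨hd', rfl⟩, rfl⟩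
    refine ⟨(p * d' + d * p', d * d'),
      ⟨by simpa only [map_mul] using mul_ne_zero hd hd', ?_⟩, ?_⟩
    · simp only [Prod.mk_add_mk, map_mul, map_add]
      rw [div_add_div _ _ (algebraMap_ne_zero_of_aeval_ne_zero hd)
        (algebraMap_ne_zero_of_aeval_ne_zero hd')]
    · simp only [Prod.mk_add_mk, map_mul, map_add]
      rw [div_add_div _ _ hd hd']
  algebraMap_mem' r := by
    refine ⟨(MvPolynomial.C r, 1), ⟨by simp, ?_⟩, ?_⟩
    · rw [map_one, div_one, ← MvPolynomial.algebraMap_eq, ← IsScalarTower.algebraMap_apply]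
      rfl
    · rw [map_one, div_one, ← MvPolynomial.algebraMap_eq, AlgHom.commutes]
      rfl

/-- The rational function `x` is defined at `a` and has the value `y` there. -/
def HasValue (a : Fin 2 → L) (x : QZW) (y : L) : Prop := (x, y) ∈ valuePairs a

/-- The projection of `valuePairs a` to the rational function. -/
def pairFun (a : Fin 2 → L) : valuePairs a →+* QZW :=
  (RingHom.fst QZW L).comp (valuePairs a).val.toRingHom

/-- The projection of `valuePairs a` to the value. -/
def pairVal (a : Fin 2 → L) : valuePairs a →+* L :=
  (RingHom.snd QZW L).comp (valuePairs a).val.toRingHom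

variable {a : Fin 2 → L}

theorem hasValue_iff {x : QZW} {y : L} :
    HasValue a x y ↔ ∃ s : valuePairs a, pairFun a s = x ∧ pairVal a s = y :=
  ⟨fun h => ⟨⟨(x, y), h⟩, rfl, rfl⟩, by rintro ⟨s, rfl, rfl⟩; exact s.2⟩

namespace HasValue

variable {x x' : QZW} {y y' : L} {ι : Type*} {f : ι → QZW} {g : ι → L}

theorem regularAt (h : HasValue a x y) : RegularAt x a :=
  h.imp fun _ => And.left

theorem evalAt_eq (h : HasValue a x y) : evalAt x a = y := by
  obtain ⟨z, hz, rfl⟩ := h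
  exact CharVar.evalAt_eq x a z hz

theorem one : HasValue a 1 1 := (valuePairs a).one_mem

theorem sub (h : HasValue a x y) (h' : HasValue a x' y') : HasValue a (x - x') (y - y') :=
  (valuePairs a).sub_mem h h'

theorem mul (h : HasValue a x y) (h' : HasValue a x' y') : HasValue a (x * x') (y * y') :=
  (valuePairs a).mul_mem h h'

theorem pow (h : HasValue a x y) (m : ℕ) : HasValue a (x ^ m) (y ^ m) :=
  (valuePairs a).pow_mem h m

theorem inv (h : HasValue a x y) (hy : y ≠ 0) : HasValue a x⁻¹ y⁻¹ := by
  obtain ⟨⟨p, d⟩, ⟨-, hx⟩, hval⟩ := h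
  simp only at hx hval
  have hp : MvPolynomial.aeval a p ≠ 0 := fun h0 => hy (by rw [hval, h0, zero_div])
  exact ⟨(d, p), ⟨hp, by simp only [hx, inv_div]⟩, by simp only [hval, inv_div]⟩

theorem div (h : HasValue a x y) (h' : HasValue a x' y') (hy : y' ≠ 0) :
    HasValue a (x / x') (y / y') := by
  simpa only [div_eq_mul_inv] using h.mul (h'.inv hy)

theorem sum (s : Finset ι) (h : ∀ i ∈ s, HasValue a (f i) (g i)) :
    HasValue a (∑ i ∈ s, f i) (∑ i ∈ s, g i) := by
  have pair_sum : ∑ i ∈ s, (f i, g i) = (∑ i ∈ s, f i, ∑ i ∈ s, g i) :=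
    Prod.ext Prod.fst_sum Prod.snd_sum
  rw [HasValue, ← pair_sum]
  exact (valuePairs a).sum_mem h

theorem prod (s : Finset ι) (h : ∀ i ∈ s, HasValue a (f i) (g i)) :
    HasValue a (∏ i ∈ s, f i) (∏ i ∈ s, g i) := by
  have pair_prod : ∏ i ∈ s, (f i, g i) = (∏ i ∈ s, f i, ∏ i ∈ s, g i) :=
    Prod.ext Prod.fst_prod Prod.snd_prod
  rw [HasValue, ← pair_prod]
  exact (valuePairs a).prod_mem h

end HasValue

theorem hasValue_zv : HasValue a zv (a 0) :=
  ⟨(MvPolynomial.X 0, 1), ⟨by simp, by simp [zv]⟩, by simp⟩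

theorem hasValue_wv : HasValue a wv (a 1) :=
  ⟨(MvPolynomial.X 1, 1), ⟨by simp, by simp [wv]⟩, by simp⟩

/-- The coefficients of `f` are defined at `a` and have the coefficients of `g` as values there. -/
def SymHasValue (a : Fin 2 → L) (f : Sym QZW) (g : Sym L) : Prop :=
  ∃ F : MvPolynomial ℕ+ (valuePairs a),
    MvPolynomial.map (pairFun a) F = f ∧ MvPolynomial.map (pairVal a) F = g

namespace SymHasValue

variable {f f' : Sym QZW} {g g' : Sym L}

theorem sub (h : SymHasValue a f g) (h' : SymHasValue a f' g') :
    SymHasValue a (f - f') (g - g') := by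
  obtain ⟨F, rfl, rfl⟩ := h
  obtain ⟨F', rfl, rfl⟩ := h'
  exact ⟨F - F', map_sub _ _ _, map_sub _ _ _⟩

theorem sum {ι : Type*} (s : Finset ι) {x : ι → Sym QZW} {y : ι → Sym L}
    (h : ∀ i ∈ s, SymHasValue a (x i) (y i)) :
    SymHasValue a (∑ i ∈ s, x i) (∑ i ∈ s, y i) := by
  choose! F hF using h
  refine ⟨∑ i ∈ s, F i, ?_, ?_⟩
  · rw [map_sum]; exact Finset.sum_congr rfl fun i hi => (hF i hi).1
  · rw [map_sum]; exact Finset.sum_congr rfl fun i hi => (hF i hi).2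

theorem C_mul {x : QZW} {y : L} (hx : HasValue a x y) (h : SymHasValue a f g) :
    SymHasValue a (MvPolynomial.C x * f) (MvPolynomial.C y * g) := by
  obtain ⟨F, rfl, rfl⟩ := h
  obtain ⟨s, rfl, rfl⟩ := hasValue_iff.1 hx
  exact ⟨MvPolynomial.C s * F, by simp, by simp⟩

theorem pderiv (k : ℕ+) (h : SymHasValue a f g) :
    SymHasValue a (MvPolynomial.pderiv k f) (MvPolynomial.pderiv k g) := by
  obtain ⟨F, rfl, rfl⟩ := h
  exact ⟨MvPolynomial.pderiv k F, MvPolynomial.pderiv_map.symm, MvPolynomial.pderiv_map.symm⟩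

theorem eval {x : ℕ+ → QZW} {y : ℕ+ → L} (h : SymHasValue a f g)
    (hxy : ∀ k, HasValue a (x k) (y k)) :
    HasValue a (MvPolynomial.eval x f) (MvPolynomial.eval y g) := by
  obtain ⟨F, rfl, rfl⟩ := h
  choose s hs using fun k => hasValue_iff.1 (hxy k)
  obtain rfl : (fun k => pairFun a (s k)) = x := funext fun k => (hs k).1
  obtain rfl : (fun k => pairVal a (s k)) = y := funext fun k => (hs k).2
  refine hasValue_iff.2 ⟨MvPolynomial.eval s F, ?_, ?_⟩
  · rw [MvPolynomial.eval_map]; exact MvPolynomial.eval₂_comp (pairFun a) s F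
  · rw [MvPolynomial.eval_map]; exact MvPolynomial.eval₂_comp (pairVal a) s F

theorem pairing {c : ℕ+ → QZW} {c' : ℕ+ → L} (h : SymHasValue a f g) (h' : SymHasValue a f' g')
    (hc : ∀ k, HasValue a (c k) (c' k)) :
    HasValue a (pairing c f f') (pairing c' g g') := by
  obtain ⟨F, rfl, rfl⟩ := h
  obtain ⟨F', rfl, rfl⟩ := h'
  choose s hs using fun k => hasValue_iff.1 (hc k)
  obtain rfl : (fun k => pairFun a (s k)) = c := funext fun k => (hs k).1
  obtain rfl : (fun k => pairVal a (s k)) = c' := funext fun k => (hs k).2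
  rw [pairing_eq_sum _ _ (s := F.support) (MvPolynomial.support_map_subset _ _),
    pairing_eq_sum _ _ (s := F.support) (MvPolynomial.support_map_subset _ _)]
  refine hasValue_iff.2 ⟨∑ b ∈ F.support, F.coeff b * F'.coeff b *
      b.prod fun k m => (((k : ℕ) : valuePairs a) * s k) ^ m * (m.factorial : valuePairs a), ?_, ?_⟩
  · simp [map_sum, Finsupp.prod, map_prod, MvPolynomial.coeff_map]
  · simp [map_sum, Finsupp.prod, map_prod, MvPolynomial.coeff_map]

end SymHasValue

section BaseChange

variable {K K' : Type*} [Field K] [Field K'] (φ : K →+* K')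

theorem map_hsym (n : ℕ) : MvPolynomial.map φ (hsym n : Sym K) = hsym n := by
  ext b
  rw [MvPolynomial.coeff_map, coeff_hsym, coeff_hsym]
  split_ifs <;> simp

theorem map_schur {n : ℕ} (l : n.Partition) : MvPolynomial.map φ (schur l : Sym K) = schur l := by
  rw [schur, RingHom.map_det, schur]
  congr 1
  ext1 i j
  simp only [RingHom.mapMatrix_apply, Matrix.map_apply, Matrix.of_apply, hsymInt]
  split_ifs
  · exact map_hsym φ _
  · exact map_zero _

end BaseChange

section PlethDiv

variable {K : Type*} [Field K]

/-- The functional `f ↦ (∂f / ∂p_1)(1, 1, …)` in the power sum coordinates, which is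
`f ↦ ⟨f, h_{n-1} h_1⟩` on the homogeneous functions of degree `n`. -/
def hookCoeff : Sym K →ₗ[K] K :=
  (MvPolynomial.aeval (fun _ : ℕ+ => (1 : K))).toLinearMap ∘ₗ
    (MvPolynomial.pderiv (1 : ℕ+) : Derivation K (Sym K) (Sym K)).toLinearMap

theorem hookCoeff_apply (f : Sym K) :
    hookCoeff f = MvPolynomial.eval (fun _ => 1) (MvPolynomial.pderiv 1 f) := by
  simp [hookCoeff, MvPolynomial.aeval_eq_eval]

theorem eval_one_plethDiv (t : K) (f : Sym K) :
    MvPolynomial.eval (fun _ => 1) (plethDiv t f) = principal t f := by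
  induction f using MvPolynomial.induction_on with
  | C c => simp [plethDiv, principal]
  | add p q hp hq => rw [map_add, map_add, hp, hq, map_add]
  | mul_X p k ih =>
    rw [map_mul, map_mul, ih, map_mul]
    simp [plethDiv, principal]

theorem pderiv_one_plethDiv (t : K) (f : Sym K) :
    MvPolynomial.pderiv 1 (plethDiv t f) =
      MvPolynomial.C (1 - t)⁻¹ * plethDiv t (MvPolynomial.pderiv 1 f) := by
  classical
  induction f using MvPolynomial.induction_on with
  | C c => simp [plethDiv]
  | add p q hp hq => rw [map_add, map_add, hp, hq, map_add, map_add, mul_add]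
  | mul_X p k ih =>
    have pderiv_X : MvPolynomial.pderiv 1 (plethDiv t (MvPolynomial.X k)) =
        MvPolynomial.C (1 - t)⁻¹ * plethDiv t (MvPolynomial.pderiv 1 (MvPolynomial.X k)) := by
      rcases eq_or_ne k 1 with rfl | hk
      · simp [plethDiv]
      · simp [plethDiv, MvPolynomial.pderiv_X, hk]
    rw [map_mul, Derivation.leibniz, ih, Derivation.leibniz, smul_eq_mul, smul_eq_mul, smul_eq_mul,
      smul_eq_mul, map_add, map_mul, map_mul, pderiv_X]
    ring

theorem eval_one_macH (q t : K) {n : ℕ} (l : n.Partition) :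
    MvPolynomial.eval (fun _ => 1) (macH q t l) =
      t ^ nStat l * (∏ s ∈ cells l, (1 - q ^ arm l s * t⁻¹ ^ (leg l s + 1))) *
        principal t⁻¹ (macP q t⁻¹ l) := by
  rw [macH, macJ, map_mul, eval_one_plethDiv, map_mul, principal, MvPolynomial.eval_C,
    MvPolynomial.eval_C, mul_assoc]

theorem hookCoeff_macH (q t : K) {n : ℕ} (l : n.Partition) :
    hookCoeff (macH q t l) =
      t ^ nStat l * (∏ s ∈ cells l, (1 - q ^ arm l s * t⁻¹ ^ (leg l s + 1))) *
        ((1 - t⁻¹)⁻¹ * principal t⁻¹ (MvPolynomial.pderiv 1 (macP q t⁻¹ l))) := by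
  rw [macH, macJ, hookCoeff_apply, MvPolynomial.pderiv_C_mul, map_mul, pderiv_one_plethDiv,
    MvPolynomial.pderiv_C_mul, map_mul, eval_one_plethDiv, map_mul, principal,
    MvPolynomial.eval_C, MvPolynomial.eval_C, MvPolynomial.eval_C]
  ring

end PlethDiv

theorem symHasValue_schur {n : ℕ} (l : n.Partition) : SymHasValue a (schur l) (schur l) :=
  ⟨MvPolynomial.map (algebraMap ℚ (valuePairs a)) (schur l),
    by rw [MvPolynomial.map_map, map_schur], by rw [MvPolynomial.map_map, map_schur]⟩

theorem pow_sub_pow_of_mul_eq_one {R : Type*} [CommRing R] {x y : R} (h : x * y = 1) (u v : ℕ) :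
    x ^ u - y ^ v = y ^ v * (x ^ (u + v) - 1) := by
  have : x ^ v * y ^ v = 1 := by rw [← mul_pow, h, one_pow]
  rw [pow_add]
  linear_combination -x ^ u * this

section ReciprocalPoint

theorem hasValue_wv_sq_inv (ha : a 0 * a 1 = 1) : HasValue a (wv ^ 2)⁻¹ (a 0 ^ 2) := by
  have := (hasValue_wv.pow 2).inv (pow_ne_zero 2 (right_ne_zero_of_mul_eq_one ha))
  rwa [← inv_pow (a 1), ← eq_inv_of_mul_eq_one_left ha] at this

theorem hasValue_wv_sq (ha : a 0 * a 1 = 1) : HasValue a (wv ^ 2) (a 0 ^ 2)⁻¹ := by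
  simpa using (hasValue_wv_sq_inv ha).inv (pow_ne_zero 2 (left_ne_zero_of_mul_eq_one ha))

variable (ha : a 0 * a 1 = 1) (hq : ∀ k : ℕ, 0 < k → (a 0 ^ 2) ^ k ≠ 1)

include ha hq

theorem hasValue_one_sub_wv_inv {k : ℕ} (hk : 0 < k) :
    HasValue a (1 - (wv ^ 2)⁻¹ ^ k)⁻¹ (1 - (a 0 ^ 2) ^ k)⁻¹ :=
  (HasValue.one.sub ((hasValue_wv_sq_inv ha).pow k)).inv (one_sub_pow_ne_zero hq hk)

/-- At `w = z⁻¹` the parameters of Macdonald's pairing agree. -/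
theorem SymHasValue.hallQT {f f' : Sym QZW} {g g' : Sym L} (h : SymHasValue a f g)
    (h' : SymHasValue a f' g') :
    HasValue a (hallQT (zv ^ 2) (wv ^ 2)⁻¹ f f') (hall g g') := by
  refine h.pairing h' fun k => ?_
  have := (HasValue.one.sub ((hasValue_zv.pow 2).pow k)).mul (hasValue_one_sub_wv_inv ha hq k.pos)
  rwa [mul_inv_cancel₀ (one_sub_pow_ne_zero hq k.pos), ← div_eq_mul_inv] at this

theorem symHasValue_macP {n : ℕ} (l : n.Partition) :
    SymHasValue a (macP (zv ^ 2) (wv ^ 2)⁻¹ l) (schur l) := by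
  classical
  have := algebraRat.charZero L
  induction l using (lexLT_wf n).induction with
  | _ l ih =>
    have gramSchmidt_coeff (m : {m : n.Partition // LexLT m l}) : HasValue a
        (hallQT (zv ^ 2) (wv ^ 2)⁻¹ (schur l) (macP (zv ^ 2) (wv ^ 2)⁻¹ m.1) /
          hallQT (zv ^ 2) (wv ^ 2)⁻¹ (macP (zv ^ 2) (wv ^ 2)⁻¹ m.1)
            (macP (zv ^ 2) (wv ^ 2)⁻¹ m.1)) 0 := by
      have ne : l ≠ m.1 := fun h => (show rows m.1 < rows l from m.2).ne (congrArg rows h.symm)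
      have numerator := (symHasValue_schur l).hallQT ha hq (ih m.1 m.2)
      have denominator := (ih m.1 m.2).hallQT ha hq (ih m.1 m.2)
      rw [hall_schur, if_neg ne] at numerator
      rw [hall_schur, if_pos rfl] at denominator
      simpa only [div_one] using numerator.div denominator one_ne_zero
    have difference := (symHasValue_schur (a := a) l).sub (SymHasValue.sum Finset.univ
      fun m (_ : m ∈ Finset.univ) => (ih m.1 m.2).C_mul (gramSchmidt_coeff m))
    rw [macP]
    simpa only [map_zero, zero_mul, Finset.sum_const_zero, sub_zero] using difference

theorem hasValue_hookFun {n : ℕ} (l : n.Partition) : HasValue a (hookFun 1 l) 1 := by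
  rw [hookFun, ← Finset.prod_const_one (M := L) (s := cells l)]
  refine HasValue.prod _ fun s _ => ?_
  generalize arm l s = i
  generalize leg l s = j
  set Q := (a 0 ^ 2) ^ (i + j + 1) - 1 with hQ
  have ha1 : a 1 ≠ 0 := right_ne_zero_of_mul_eq_one ha
  have hQ0 : Q ≠ 0 := sub_ne_zero.2 (hq _ (Nat.succ_pos _))
  have hasValue_factor {u v : ℕ} (huv : u + v = 2 * (i + j + 1)) :
      HasValue a (zv ^ u - wv ^ v) (a 1 ^ v * Q) := by
    rw [hQ, ← pow_mul, ← huv, ← pow_sub_pow_of_mul_eq_one ha]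
    exact (hasValue_zv.pow _).sub (hasValue_wv.pow _)
  have numerator := (hasValue_factor (u := 2 * i + 1) (v := 2 * j + 1) (by ring)).pow (2 * 1)
  have denominator := (hasValue_factor (u := 2 * i + 2) (v := 2 * j) (by ring)).mul
    (hasValue_factor (u := 2 * i) (v := 2 * j + 2) (by ring))
  have quotient := numerator.div denominator
    (mul_ne_zero (mul_ne_zero (pow_ne_zero _ ha1) hQ0) (mul_ne_zero (pow_ne_zero _ ha1) hQ0))
  rwa [show (a 1 ^ (2 * j + 1) * Q) ^ (2 * 1) =
    a 1 ^ (2 * j) * Q * (a 1 ^ (2 * j + 2) * Q) by ring, div_self (mul_ne_zero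
      (mul_ne_zero (pow_ne_zero _ ha1) hQ0) (mul_ne_zero (pow_ne_zero _ ha1) hQ0))] at quotient

theorem hasValue_macH_factor {n : ℕ} (l : n.Partition) :
    HasValue a ((wv ^ 2) ^ nStat l *
        ∏ s ∈ cells l, (1 - (zv ^ 2) ^ arm l s * (wv ^ 2)⁻¹ ^ (leg l s + 1)))
      (principal (a 0 ^ 2) (schur l))⁻¹ := by
  have := algebraRat.charZero L
  set Q := a 0 ^ 2
  have hQ0 : Q ≠ 0 := pow_ne_zero 2 (left_ne_zero_of_mul_eq_one ha)
  have hook_formula := principal_schur hQ0 hq l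
  have value_eq : Q⁻¹ ^ nStat l * ∏ s ∈ cells l, (1 - Q ^ arm l s * Q ^ (leg l s + 1)) =
      (principal Q (schur l))⁻¹ := by
    refine eq_inv_of_mul_eq_one_left ?_
    simp only [← pow_add, ← add_assoc]
    rw [mul_assoc, hook_formula, ← mul_pow, inv_mul_cancel₀ hQ0, one_pow]
  rw [← value_eq]
  exact ((hasValue_wv_sq ha).pow _).mul (HasValue.prod _ fun s _ => HasValue.one.sub
    (((hasValue_zv.pow 2).pow _).mul ((hasValue_wv_sq_inv ha).pow _)))

theorem principal_schur_ne_zero {n : ℕ} (l : n.Partition) :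
    principal (a 0 ^ 2) (schur l) ≠ 0 := by
  have := algebraRat.charZero L
  have hQ0 : a 0 ^ 2 ≠ 0 := pow_ne_zero 2 (left_ne_zero_of_mul_eq_one ha)
  exact right_ne_zero_of_mul (principal_schur hQ0 hq l ▸ pow_ne_zero _ hQ0)

theorem hasValue_eval_one_macH {n : ℕ} (l : n.Partition) :
    HasValue a (MvPolynomial.eval (fun _ => 1) (macH (zv ^ 2) (wv ^ 2) l)) 1 := by
  rw [eval_one_macH, ← inv_mul_cancel₀ (principal_schur_ne_zero ha hq l)]
  exact (hasValue_macH_factor ha hq l).mul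
    ((symHasValue_macP ha hq l).eval fun k => hasValue_one_sub_wv_inv ha hq k.pos)

theorem hasValue_hookCoeff_macH {n : ℕ} (l : n.Partition) :
    HasValue a (hookCoeff (macH (zv ^ 2) (wv ^ 2) l))
      (∑ s ∈ cells l, (a 0 ^ 2) ^ s.2 * (a 0 ^ 2)⁻¹ ^ s.1) := by
  have := algebraRat.charZero L
  set Q := a 0 ^ 2
  have hQ0 : Q ≠ 0 := pow_ne_zero 2 (left_ne_zero_of_mul_eq_one ha)
  have hQ1 : 1 - Q ≠ 0 := by simpa using one_sub_pow_ne_zero hq one_pos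
  have hP : principal Q (schur l) ≠ 0 := principal_schur_ne_zero ha hq l
  have value_eq : ∑ s ∈ cells l, Q ^ s.2 * Q⁻¹ ^ s.1 = (principal Q (schur l))⁻¹ *
      ((1 - Q)⁻¹ * principal Q (MvPolynomial.pderiv 1 (schur l))) := by
    rw [principal_pderiv_schur hQ0 hq]
    field_simp
  rw [hookCoeff_macH, value_eq]
  refine (hasValue_macH_factor ha hq l).mul (HasValue.mul ?_ ?_)
  · simpa using hasValue_one_sub_wv_inv ha hq one_pos
  · exact ((symHasValue_macP ha hq l).pderiv 1).eval fun k => hasValue_one_sub_wv_inv ha hq k.pos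

end ReciprocalPoint

end Reduction

/-! ### Reduction of `Log` to the ordinary logarithm -/

section Homogeneity

open MvPolynomial

variable {K : Type*} [Field K]

theorem isWeightedHomogeneous_hsymInt (m : ℤ) :
    IsWeightedHomogeneous psumWeight (hsymInt m : Sym K) m := by
  rcases lt_or_ge m 0 with hm | hm
  · rw [hsymInt_of_neg hm]
    exact isWeightedHomogeneous_zero _ _ _
  · lift m to ℕ using hm
    rw [hsymInt_natCast]
    exact isWeightedHomogeneous_hsym m

theorem isWeightedHomogeneous_schur {n : ℕ} (l : n.Partition) :
    IsWeightedHomogeneous psumWeight (schur l : Sym K) n := by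
  rw [schur, ← Matrix.det_transpose, Matrix.det_apply']
  refine IsWeightedHomogeneous.sum _ _ _ fun σ _ => ?_
  rw [← map_intCast (C : K →+* Sym K)]
  refine IsWeightedHomogeneous.C_mul ?_ _
  have degree : (n : ℤ) = ∑ i : Fin (len l), ((row l i : ℤ) - (i : ℕ) + (σ i : ℕ)) := by
    rw [Finset.sum_add_distrib, Finset.sum_sub_distrib,
      Equiv.sum_comp σ fun i : Fin (len l) => ((i : ℕ) : ℤ), sub_add_cancel,
      Fin.sum_univ_eq_sum_range fun i => (row l i : ℤ), ← Nat.cast_sum, sum_row]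
  rw [degree]
  exact IsWeightedHomogeneous.prod _ _ _ fun i _ => isWeightedHomogeneous_hsymInt _

theorem isWeightedHomogeneous_macP (q t : K) {n : ℕ} (l : n.Partition) :
    IsWeightedHomogeneous psumWeight (macP q t l) n := by
  induction l using (lexLT_wf n).induction with
  | _ l ih =>
    rw [macP]
    exact (isWeightedHomogeneous_schur l).sub
      (IsWeightedHomogeneous.sum _ _ _ fun m _ => (ih m.1 m.2).C_mul _)

theorem isWeightedHomogeneous_plethDiv (t : K) {f : Sym K} {m : ℤ}
    (hf : IsWeightedHomogeneous psumWeight f m) :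
    IsWeightedHomogeneous psumWeight (plethDiv t f) m := by
  rw [plethDiv, aeval_def, eval₂_eq]
  refine IsWeightedHomogeneous.sum _ _ _ fun b hb => ?_
  rw [← hf (mem_support_iff.1 hb), algebraMap_eq, Finsupp.weight_apply]
  exact (IsWeightedHomogeneous.prod _ _ _ fun k _ =>
    ((isWeightedHomogeneous_X K psumWeight k).C_mul _).pow _).C_mul _

theorem isWeightedHomogeneous_macH (q t : K) {n : ℕ} (l : n.Partition) :
    IsWeightedHomogeneous psumWeight (macH q t l) n :=
  (isWeightedHomogeneous_plethDiv _ ((isWeightedHomogeneous_macP q t⁻¹ l).C_mul _)).C_mul _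

theorem isWeightedHomogeneous_coeff_pow {f : PowerSeries (Sym K)}
    (hf : ∀ n : ℕ, IsWeightedHomogeneous psumWeight (PowerSeries.coeff n f) n) (d n : ℕ) :
    IsWeightedHomogeneous psumWeight (PowerSeries.coeff n (f ^ d)) n := by
  induction d generalizing n with
  | zero =>
    rw [pow_zero, PowerSeries.coeff_one]
    split_ifs with hn
    · rw [hn]
      exact isWeightedHomogeneous_one K psumWeight
    · exact isWeightedHomogeneous_zero K psumWeight _
  | succ d ih =>
    rw [pow_succ, PowerSeries.coeff_mul]
    refine IsWeightedHomogeneous.sum _ _ _ fun p hp => ?_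
    rw [← Finset.HasAntidiagonal.mem_antidiagonal.1 hp, Nat.cast_add]
    exact (ih p.1).mul (hf p.2)

theorem isWeightedHomogeneous_coeff_logOf [CharZero K] {f : PowerSeries (Sym K)}
    (h0 : PowerSeries.constantCoeff f = 1)
    (hf : ∀ n : ℕ, IsWeightedHomogeneous psumWeight (PowerSeries.coeff n f) n) (n : ℕ) :
    IsWeightedHomogeneous psumWeight (PowerSeries.coeff n (PowerSeries.logOf f)) n := by
  have hsub : PowerSeries.HasSubst (f - 1) :=
    PowerSeries.HasSubst.of_constantCoeff_zero' (by rw [map_sub, h0, map_one, sub_self])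
  have hf_sub (m : ℕ) : IsWeightedHomogeneous psumWeight (PowerSeries.coeff m (f - 1)) m := by
    have h1 := isWeightedHomogeneous_coeff_pow hf 0 m
    rw [pow_zero] at h1
    rw [map_sub]
    exact (hf m).sub h1
  rw [PowerSeries.logOf_eq, PowerSeries.coeff_subst' hsub]
  refine finsum_induction (IsWeightedHomogeneous psumWeight · (n : ℤ))
    (isWeightedHomogeneous_zero K psumWeight _) (fun _ _ => IsWeightedHomogeneous.add) fun d => ?_
  rw [PowerSeries.coeff_log, ← map_zero (algebraMap ℚ (Sym K)), ← apply_ite (algebraMap ℚ (Sym K)),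
    IsScalarTower.algebraMap_apply ℚ K (Sym K), algebraMap_eq]
  exact (isWeightedHomogeneous_coeff_pow hf_sub d n).C_mul _

end Homogeneity

section Logarithm

open PowerSeries

theorem mul_derivative_logOf {A : Type*} [CommRing A] [Algebra ℚ A] {f : PowerSeries A}
    (hf : constantCoeff f = 1) : f * d⁄dX A (logOf f) = d⁄dX A f := by
  have hsub : HasSubst (f - 1) :=
    HasSubst.of_constantCoeff_zero' (by rw [map_sub, hf, map_one, sub_self])
  have geometric : (1 + X) * d⁄dX A (log A) = 1 := by
    rw [deriv_log]
    ext n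
    cases n with
    | zero => simp [add_mul]
    | succ n => simp [add_mul, coeff_succ_X_mul, coeff_one, pow_succ]
  have inverse := congrArg (subst (f - 1)) geometric
  rw [subst_mul hsub, subst_add hsub, subst_X hsub, ← coe_substAlgHom hsub, map_one,
    coe_substAlgHom hsub, add_sub_cancel] at inverse
  rw [logOf_eq, derivative_subst hsub, ← mul_assoc, inverse, one_mul, map_sub,
    Derivation.map_one_eq_zero, sub_zero]

variable {K : Type*} [Field K]

theorem hookCoeff_mul (f g : Sym K) : hookCoeff (f * g) =
    MvPolynomial.eval (fun _ => 1) f * hookCoeff g +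
      hookCoeff f * MvPolynomial.eval (fun _ => 1) g := by
  simp only [hookCoeff_apply, Derivation.leibniz, smul_eq_mul, map_add, map_mul]
  ring

theorem hookCoeff_C (c : K) : hookCoeff (MvPolynomial.C c) = 0 := by
  rw [hookCoeff_apply, MvPolynomial.pderiv_C, map_zero]

/-- `hookCoeff` applied to the coefficients of a power series. -/
def hookCoeffSeries (f : PowerSeries (Sym K)) : PowerSeries K :=
  PowerSeries.mk fun n => hookCoeff (coeff n f)

/-- All power sums set to `1` in the coefficients of a power series. -/
def evalOneSeries : PowerSeries (Sym K) →+* PowerSeries K :=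
  PowerSeries.map (MvPolynomial.eval fun _ => 1)

theorem hookCoeffSeries_mul (f g : PowerSeries (Sym K)) : hookCoeffSeries (f * g) =
    evalOneSeries f * hookCoeffSeries g + hookCoeffSeries f * evalOneSeries g := by
  ext n
  simp only [hookCoeffSeries, evalOneSeries, map_add, coeff_mul, coeff_mk, map_sum, coeff_map,
    hookCoeff_mul, Finset.sum_add_distrib]

theorem hookCoeffSeries_derivative (f : PowerSeries (Sym K)) :
    hookCoeffSeries (d⁄dX (Sym K) f) = d⁄dX K (hookCoeffSeries f) := by
  ext n
  have cast_eq : (n : Sym K) + 1 = MvPolynomial.C ((n : K) + 1) := by simp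
  simp only [hookCoeffSeries, coeff_mk, coeff_derivative]
  rw [cast_eq, hookCoeff_mul, hookCoeff_C, mul_zero, zero_add, MvPolynomial.eval_C]

theorem evalOneSeries_derivative (f : PowerSeries (Sym K)) :
    evalOneSeries (d⁄dX (Sym K) f) = d⁄dX K (evalOneSeries f) := by
  ext n
  simp [evalOneSeries, coeff_derivative]

theorem constantCoeff_evalOneSeries (f : PowerSeries (Sym K)) :
    constantCoeff (evalOneSeries f) = MvPolynomial.eval (fun _ => 1) (constantCoeff f) := by
  rw [← coeff_zero_eq_constantCoeff_apply, evalOneSeries, coeff_map,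
    coeff_zero_eq_constantCoeff_apply]

theorem constantCoeff_hookCoeffSeries (f : PowerSeries (Sym K)) :
    constantCoeff (hookCoeffSeries f) = hookCoeff (constantCoeff f) := by
  rw [hookCoeffSeries, constantCoeff_mk, coeff_zero_eq_constantCoeff_apply]

/-- `hookCoeff` is a derivation over the point `p_k = 1`, so it acts on logarithms as a logarithmic
derivative. -/
theorem evalOneSeries_mul_hookCoeffSeries_logOf [CharZero K] {f : PowerSeries (Sym K)}
    (h0 : constantCoeff f = 1) :
    evalOneSeries f * hookCoeffSeries (logOf f) = hookCoeffSeries f := by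
  have hooked := congrArg hookCoeffSeries (mul_derivative_logOf h0)
  have evaluated := congrArg evalOneSeries (mul_derivative_logOf h0)
  rw [hookCoeffSeries_mul, hookCoeffSeries_derivative, hookCoeffSeries_derivative,
    evalOneSeries_derivative] at hooked
  rw [map_mul, evalOneSeries_derivative, evalOneSeries_derivative] at evaluated
  refine sub_eq_zero.1 (eq_zero_of_derivative_eq_mul (a := d⁄dX K (evalOneSeries (logOf f))) ?_ ?_)
  · rw [map_sub, Derivation.leibniz, smul_eq_mul, smul_eq_mul]
    linear_combination hooked - hookCoeffSeries (logOf f) * evaluated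
  · have hook_one : hookCoeff (1 : Sym K) = 0 := by rw [← MvPolynomial.C_1, hookCoeff_C]
    rw [map_sub, map_mul, constantCoeff_hookCoeffSeries, constantCoeff_hookCoeffSeries,
      constantCoeff_logOf h0, h0, hook_one, map_zero, mul_zero, sub_zero]

theorem hsym_one [CharZero K] : (hsym 1 : Sym K) = MvPolynomial.X 1 := by
  have euler := sum_X_mul_hsym (K := K) 0
  simpa [hsym_zero, show Nat.succPNat 0 = 1 from rfl] using euler.symm

theorem hsymPart_hookPartition [CharZero K] (n : ℕ) :
    (hsymPart (hookPartition n) : Sym K) = hsym n * MvPolynomial.X 1 := by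
  rw [← hsym_one]
  rcases Nat.eq_zero_or_pos n with rfl | hn
  · simp [hsymPart, hookPartition, Nat.Partition.ofSums, hsym_zero, Multiset.filter_singleton]
  · simp [hsymPart, hookPartition, Nat.Partition.ofSums, Multiset.filter_singleton, hn.ne']

theorem hall_hsymPart_hookPartition [CharZero K] (f : Sym K) (n : ℕ) :
    hall f (hsymPart (hookPartition n)) = hall (MvPolynomial.pderiv 1 f) (hsym n) := by
  rw [hsymPart_hookPartition, hall_comm, hall_mul_X, hall_comm, PNat.one_coe, one_smul]

theorem hall_hsymPart_hookPartition_eq_hookCoeff [CharZero K] {f : Sym K} {n : ℕ}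
    (hf : MvPolynomial.IsWeightedHomogeneous psumWeight f ((n + 1 : ℕ) : ℤ)) :
    hall f (hsymPart (hookPartition n)) = hookCoeff f := by
  rw [hall_hsymPart_hookPartition, hookCoeff_apply, hall_hsym]
  refine hf.pderiv ?_
  simp [psumWeight]

end Logarithm

section PlethysticLog

open PowerSeries

theorem adamsK_one : adamsK 1 = RingHom.id QZW := by
  refine IsFractionRing.ringHom_ext (A := MvPolynomial (Fin 2) ℚ) fun x => ?_
  rw [adamsK, IsFractionRing.lift_algebraMap]
  simp

theorem adams_one (f : Sym QZW) : adams 1 f = f := by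
  rw [adams, adamsK_one]
  simp

theorem pderiv_one_adams {d : ℕ+} (hd : d ≠ 1) (f : Sym QZW) :
    MvPolynomial.pderiv 1 (adams d f) = 0 := by
  induction f using MvPolynomial.induction_on with
  | C c => simp [adams]
  | add p q hp hq => rw [map_add, map_add, hp, hq, add_zero]
  | mul_X p k ih =>
    have hdk : d * k ≠ 1 := fun h => hd ((PNat.dvd_one_iff d).1 (Dvd.intro k h))
    rw [map_mul, Derivation.leibniz, ih]
    simp [adams, MvPolynomial.pderiv_X, hdk]

/-- For `d > 1` the image of `ψ_d` does not involve `p_1`, so only the term `d = 1` of `Log` pairs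
with `h_n h_1`. -/
theorem hall_plethLog_hookPartition (f : PowerSeries (Sym QZW)) (n : ℕ) :
    hall (coeff (n + 1) (plethLog f)) (hsymPart (hookPartition n)) =
      hall (coeff (n + 1) (logOf f)) (hsymPart (hookPartition n)) := by
  simp only [plethLog, coeff_mk, hall_eq_pairingForm, map_sum, LinearMap.sum_apply]
  simp only [← hall_eq_pairingForm, hall_hsymPart_hookPartition]
  rw [Finset.sum_eq_single 1]
  · rw [show Nat.toPNat' 1 = 1 from rfl, adams_one]
    simp
  · intro d hd hd1
    have hd' : d.toPNat' ≠ 1 := fun h =>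
      hd1 (by simpa [Nat.toPNat'_coe, Nat.pos_of_mem_divisors hd] using congrArg PNat.val h)
    rw [MvPolynomial.pderiv_C_mul, pderiv_one_adams hd', mul_zero, hall_eq_pairingForm, map_zero,
      LinearMap.zero_apply]
  · simp

theorem isWeightedHomogeneous_coeff_Omega (g n : ℕ) :
    MvPolynomial.IsWeightedHomogeneous psumWeight (coeff n (Omega g)) (n : ℤ) := by
  rw [Omega, coeff_mk]
  exact MvPolynomial.IsWeightedHomogeneous.sum _ _ _ fun l _ =>
    (isWeightedHomogeneous_macH _ _ l).C_mul _

section EmptyPartition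

variable {K : Type*} [Field K] (l : Nat.Partition 0)

theorem rows_of_zero : rows l = [] := by
  simp [rows]

theorem len_of_zero : len l = 0 := by
  simp [len]

theorem cells_of_zero : cells l = ∅ := by
  simp [cells]

theorem schur_of_zero : (schur l : Sym K) = 1 := by
  have : IsEmpty (Fin (len l)) := by rw [len_of_zero]; infer_instance
  rw [schur, Matrix.det_isEmpty]

theorem macP_of_zero (q t : K) : macP q t l = 1 := by
  have : IsEmpty {m : Nat.Partition 0 // LexLT m l} :=
    ⟨fun m => (show rows m.1 < rows l from m.2).ne (by rw [rows_of_zero, rows_of_zero])⟩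
  rw [macP, schur_of_zero, Finset.sum_of_isEmpty, sub_zero]

theorem macH_of_zero (q t : K) : macH q t l = 1 := by
  simp [macH, macJ, macP_of_zero, cells_of_zero, nStat, len_of_zero]

end EmptyPartition

theorem constantCoeff_Omega (g : ℕ) : constantCoeff (Omega g) = 1 := by
  rw [← coeff_zero_eq_constantCoeff_apply, Omega, coeff_mk, Fintype.sum_unique, hookFun,
    cells_of_zero, macH_of_zero, Finset.prod_empty, map_one, mul_one]

theorem constantCoeff_evalOneSeries_Omega (g : ℕ) :
    constantCoeff (evalOneSeries (Omega g)) = 1 := by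
  rw [constantCoeff_evalOneSeries, constantCoeff_Omega, map_one]

theorem bbH_hookPartition (g n : ℕ) : bbH g (hookPartition n) = (zv ^ 2 - 1) * (1 - wv ^ 2) *
    coeff (n + 1) (hookCoeffSeries (Omega g) * (evalOneSeries (Omega g))⁻¹) := by
  have h0 := constantCoeff_Omega g
  have evalOne_ne_zero : constantCoeff (evalOneSeries (Omega g)) ≠ 0 := by
    rw [constantCoeff_evalOneSeries_Omega]
    exact one_ne_zero
  have quotient : hookCoeffSeries (Omega g) * (evalOneSeries (Omega g))⁻¹ =
      hookCoeffSeries (logOf (Omega g)) := by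
    rw [← evalOneSeries_mul_hookCoeffSeries_logOf h0, mul_right_comm,
      PowerSeries.mul_inv_cancel _ evalOne_ne_zero, one_mul]
  rw [bbH, hall_plethLog_hookPartition, hall_hsymPart_hookPartition_eq_hookCoeff
    (isWeightedHomogeneous_coeff_logOf h0 (isWeightedHomogeneous_coeff_Omega g) _), quotient,
    hookCoeffSeries, coeff_mk]

end PlethysticLog

/-! ### The one-point function of the contents of partitions -/

section QSeries

open PowerSeries

/-- The partitions of `n` with all parts at most `M`. -/
def partsLE (M n : ℕ) : Finset n.Partition := Finset.univ.filter fun l => ∀ i ∈ l.parts, i ≤ M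

theorem mem_partsLE {M n : ℕ} {l : n.Partition} : l ∈ partsLE M n ↔ ∀ i ∈ l.parts, i ≤ M := by
  simp only [partsLE, Finset.mem_filter, Finset.mem_univ, true_and]

theorem le_of_mem_parts {n : ℕ} {l : n.Partition} {i : ℕ} (hi : i ∈ l.parts) : i ≤ n :=
  (Multiset.single_le_sum (fun _ _ => Nat.zero_le _) _ hi).trans_eq l.parts_sum

theorem partsLE_eq_univ {M n : ℕ} (h : n ≤ M) : partsLE M n = Finset.univ :=
  Finset.filter_true_of_mem fun _ _ _ hi => (le_of_mem_parts hi).trans h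

theorem partsLE_zero_of_ne_zero {n : ℕ} (hn : n ≠ 0) : partsLE 0 n = ∅ := by
  refine Finset.eq_empty_of_forall_notMem fun l hl => hn ?_
  rw [← l.parts_sum]
  exact Multiset.sum_eq_zero fun i hi => Nat.le_zero.1 (mem_partsLE.1 hl i hi)

theorem filter_notMem_partsLE_succ (M n : ℕ) :
    (partsLE (M + 1) n).filter (fun l => M + 1 ∉ l.parts) = partsLE M n := by
  ext l
  rw [Finset.mem_filter, mem_partsLE, mem_partsLE]
  refine ⟨fun ⟨hle, hnot⟩ i hi => Nat.le_of_lt_succ ((hle i hi).lt_of_ne ?_),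
    fun hle => ⟨fun i hi => (hle i hi).trans (Nat.le_succ M), fun hi => ?_⟩⟩
  · rintro rfl
    exact hnot hi
  · exact absurd (hle _ hi) (Nat.not_succ_le_self M)

/-- The partition obtained from `l` by adding a part `M + 1`. -/
def consPart (M : ℕ) {n : ℕ} (l : n.Partition) : (n + (M + 1)).Partition where
  parts := (M + 1) ::ₘ l.parts
  parts_pos hi := (Multiset.mem_cons.1 hi).elim (fun h => h ▸ M.succ_pos) l.parts_pos
  parts_sum := by rw [Multiset.sum_cons, l.parts_sum, add_comm]

theorem consPart_injective (M n : ℕ) : Function.Injective (consPart M (n := n)) := fun _ _ h =>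
  Nat.Partition.ext ((Multiset.cons_inj_right _).1 (congrArg Nat.Partition.parts h))

theorem exists_consPart_eq {M n : ℕ} {l : (n + (M + 1)).Partition} (hl : M + 1 ∈ l.parts) :
    ∃ m : n.Partition, consPart M m = l := by
  have hcons := Multiset.cons_erase hl
  refine ⟨⟨l.parts.erase (M + 1), fun hi => l.parts_pos (Multiset.mem_of_mem_erase hi), ?_⟩,
    Nat.Partition.ext hcons⟩
  have hsum := congrArg Multiset.sum hcons
  rw [Multiset.sum_cons, l.parts_sum] at hsum
  omega

theorem consPart_mem_partsLE_succ {M n : ℕ} {l : n.Partition} :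
    consPart M l ∈ partsLE (M + 1) (n + (M + 1)) ↔ l ∈ partsLE (M + 1) n := by
  simp only [mem_partsLE, consPart, Multiset.mem_cons, forall_eq_or_imp, le_refl, true_and]

theorem filter_mem_partsLE_succ (M n : ℕ) :
    (partsLE (M + 1) (n + (M + 1))).filter (fun l => M + 1 ∈ l.parts) =
      (partsLE (M + 1) n).image (consPart M) := by
  ext l
  rw [Finset.mem_filter, Finset.mem_image]
  constructor
  · rintro ⟨hle, hmem⟩
    obtain ⟨m, rfl⟩ := exists_consPart_eq hmem
    exact ⟨m, consPart_mem_partsLE_succ.1 hle, rfl⟩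
  · rintro ⟨m, hm, rfl⟩
    exact ⟨consPart_mem_partsLE_succ.2 hm, Multiset.mem_cons_self _ _⟩

theorem rows_consPart {M n : ℕ} {l : n.Partition} (hl : l ∈ partsLE (M + 1) n) :
    rows (consPart M l) = (M + 1) :: rows l :=
  Multiset.sort_cons _ _ _ (mem_partsLE.1 hl)

variable {R : Type*} [CommRing R]

/-- The generating series `∑_λ f(λ) T ^ |λ|` of a statistic of partitions, given as a function of
the list of parts. -/
def statSeries (f : List ℕ → R) : PowerSeries R := mk fun n => ∑ l : n.Partition, f (rows l)

/-- The generating series of a statistic over the partitions with parts at most `M`. -/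
def boundedSeries (f : List ℕ → R) (M : ℕ) : PowerSeries R :=
  mk fun n => ∑ l ∈ partsLE M n, f (rows l)

theorem boundedSeries_zero (f : List ℕ → R) : boundedSeries f 0 = C (f []) := by
  ext n
  rw [boundedSeries, coeff_mk, coeff_C]
  split_ifs with hn
  · subst hn
    rw [partsLE_eq_univ le_rfl, Fintype.sum_unique, rows_of_zero]
  · rw [partsLE_zero_of_ne_zero hn, Finset.sum_empty]

theorem boundedSeries_succ (f : List ℕ → R) (M : ℕ) :
    boundedSeries f (M + 1) =
      boundedSeries f M + X ^ (M + 1) * boundedSeries (fun L => f ((M + 1) :: L)) (M + 1) := by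
  ext n
  simp only [map_add, coeff_X_pow_mul', boundedSeries, coeff_mk]
  rw [← Finset.sum_filter_not_add_sum_filter (partsLE (M + 1) n) (fun l => M + 1 ∈ l.parts),
    filter_notMem_partsLE_succ]
  congr 1
  split_ifs with hn
  · obtain ⟨m, rfl⟩ := Nat.exists_eq_add_of_le' hn
    rw [Nat.add_sub_cancel, filter_mem_partsLE_succ,
      Finset.sum_image (consPart_injective M m).injOn]
    exact Finset.sum_congr rfl fun l hl => by rw [rows_consPart hl]
  · exact Finset.sum_eq_zero fun l hl => absurd (le_of_mem_parts (Finset.mem_filter.1 hl).2) hn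

theorem X_pow_dvd_statSeries_sub_boundedSeries (f : List ℕ → R) (M : ℕ) :
    X ^ (M + 1) ∣ statSeries f - boundedSeries f M := by
  rw [X_pow_dvd_iff]
  intro n hn
  rw [map_sub, statSeries, boundedSeries, coeff_mk, coeff_mk,
    partsLE_eq_univ (Nat.le_of_lt_succ hn), sub_self]

theorem boundedSeries_add (f g : List ℕ → R) (M : ℕ) :
    boundedSeries (fun L => f L + g L) M = boundedSeries f M + boundedSeries g M := by
  ext n
  simp only [boundedSeries, coeff_mk, map_add, Finset.sum_add_distrib]

theorem boundedSeries_const_mul (c : R) (f : List ℕ → R) (M : ℕ) :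
    boundedSeries (fun L => c * f L) M = C c * boundedSeries f M := by
  ext n
  simp only [boundedSeries, coeff_mk, coeff_C_mul, Finset.mul_sum]

/-- The statistic `∑_i q ^ {-i} (q ^ {L_i} - 1)`, which is `q - 1` times the sum of `q ^ c` over
the contents `c` of the cells; `qi` stands for `q⁻¹`. -/
def rowStat (q qi : R) : List ℕ → R
  | [] => 0
  | m :: L => (q ^ m - 1) + qi * rowStat q qi L

theorem rowStat_eq_sum (q qi : R) (L : List ℕ) :
    rowStat q qi L = ∑ i ∈ Finset.range L.length, qi ^ i * (q ^ L.getD i 0 - 1) := by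
  induction L with
  | nil => rfl
  | cons m L ih =>
    rw [rowStat, ih, List.length_cons, Finset.sum_range_succ', add_comm, Finset.mul_sum, pow_zero,
      one_mul, List.getD_cons_zero]
    refine congrArg (· + _) (Finset.sum_congr rfl fun i _ => ?_)
    rw [List.getD_cons_succ, pow_succ', mul_assoc]

theorem rowStat_rows (q qi : R) {n : ℕ} (l : n.Partition) :
    rowStat q qi (rows l) = (q - 1) * ∑ s ∈ cells l, q ^ s.2 * qi ^ s.1 := by
  rw [rowStat_eq_sum, length_rows, sum_cells, Finset.mul_sum]
  refine Finset.sum_congr rfl fun i _ => ?_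
  dsimp only
  rw [← Finset.sum_mul, ← mul_assoc, mul_geom_sum, mul_comm]
  rfl

/-- `∏_{k=1}^N (1 - c T ^ k)`. -/
def qProd (c : R) (N : ℕ) : PowerSeries R := ∏ k ∈ Finset.range N, (1 - C c * X ^ (k + 1))

theorem qProd_succ (c : R) (N : ℕ) : qProd c (N + 1) = qProd c N * (1 - C c * X ^ (N + 1)) :=
  Finset.prod_range_succ _ _

theorem boundedSeries_one_mul_qProd (N : ℕ) :
    boundedSeries (fun _ => (1 : R)) N * qProd 1 N = 1 := by
  induction N with
  | zero => rw [boundedSeries_zero, map_one, one_mul, qProd, Finset.prod_range_zero]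
  | succ N ih =>
    have hsucc := boundedSeries_succ (fun _ => (1 : R)) N
    rw [qProd_succ, map_one, one_mul]
    linear_combination ih + qProd 1 N * hsucc

variable {q qi : R}

theorem one_sub_mul_boundedSeries_rowStat_succ (M : ℕ) :
    (1 - C qi * X ^ (M + 1)) * boundedSeries (rowStat q qi) (M + 1) =
      boundedSeries (rowStat q qi) M +
        X ^ (M + 1) * C (q ^ (M + 1) - 1) * boundedSeries (fun _ => (1 : R)) (M + 1) := by
  have hcons : boundedSeries (fun L => rowStat q qi ((M + 1) :: L)) (M + 1) =
      C (q ^ (M + 1) - 1) * boundedSeries (fun _ => (1 : R)) (M + 1) +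
        C qi * boundedSeries (rowStat q qi) (M + 1) := by
    rw [← boundedSeries_const_mul, ← boundedSeries_const_mul, ← boundedSeries_add]
    simp only [rowStat, mul_one]
  have hsucc := boundedSeries_succ (rowStat q qi) M
  rw [hcons] at hsucc
  linear_combination hsucc

/-- `∏_{i<k} (1 - q⁻¹ T ^ i)`. -/
def shiftedProd (qi : R) (k : ℕ) : PowerSeries R := ∏ i ∈ Finset.range k, (1 - C qi * X ^ i)

theorem shiftedProd_succ (k : ℕ) : shiftedProd qi (k + 1) = shiftedProd qi k * (1 - C qi * X ^ k) :=
  Finset.prod_range_succ _ _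

theorem shiftedProd_succ_eq_mul_qProd (k : ℕ) :
    shiftedProd qi (k + 1) = (1 - C qi) * qProd qi k := by
  rw [shiftedProd, Finset.prod_range_succ', mul_comm, pow_zero, mul_one]
  rfl

/-- The sum over `k ≤ N` of `(q⁻¹; T)_k / (T; T)_k (q T ^ j) ^ k`, a truncation of the series in
the `q`-binomial theorem. -/
def binomSum (q qi : R) (N j : ℕ) : PowerSeries R := ∑ k ∈ Finset.range (N + 1),
  shiftedProd qi k * boundedSeries (fun _ => (1 : R)) k * (C q * X ^ j) ^ k

theorem binomSum_zero (j : ℕ) : binomSum q qi 0 j = 1 := by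
  simp only [binomSum, zero_add, Finset.sum_range_one, shiftedProd, Finset.prod_range_zero,
    boundedSeries_zero, map_one, pow_zero, mul_one]

theorem binomSum_succ (N j : ℕ) : binomSum q qi (N + 1) j = binomSum q qi N j +
    shiftedProd qi (N + 1) * boundedSeries (fun _ => (1 : R)) (N + 1) * (C q * X ^ j) ^ (N + 1) :=
  Finset.sum_range_succ _ _

theorem qProd_mul_boundedSeries (N : ℕ) :
    qProd qi N * (boundedSeries (fun _ => (1 : R)) N +
      C (1 - qi) * boundedSeries (rowStat q qi) N) = binomSum q qi N 1 := by
  induction N with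
  | zero =>
    rw [binomSum_zero, boundedSeries_zero, boundedSeries_zero, rowStat, map_zero, mul_zero,
      add_zero, map_one, mul_one, qProd, Finset.prod_range_zero]
  | succ N ih =>
    have hone := boundedSeries_succ (fun _ => (1 : R)) N
    have hstat := one_sub_mul_boundedSeries_rowStat_succ (q := q) (qi := qi) N
    rw [binomSum_succ, ← ih, qProd_succ, shiftedProd_succ_eq_mul_qProd, mul_pow, pow_one]
    simp only [map_sub, map_one, map_pow] at hstat ⊢
    linear_combination qProd qi N * (1 - C qi) * hstat + qProd qi N * hone

theorem binomSum_shift (hq : q * qi = 1) (N j : ℕ) :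
    (1 - C q * X ^ j) * binomSum q qi N j - (1 - X ^ j) * binomSum q qi N (j + 1) =
      -(shiftedProd qi (N + 1) * boundedSeries (fun _ => (1 : R)) N * (C q * X ^ j) ^ (N + 1)) := by
  have hqC : C q * C qi = (1 : PowerSeries R) := by rw [← map_mul, hq, map_one]
  induction N with
  | zero =>
    rw [binomSum_zero, binomSum_zero, boundedSeries_zero, shiftedProd, zero_add,
      Finset.prod_range_one, map_one]
    linear_combination -X ^ j * hqC
  | succ N ih =>
    have hone := boundedSeries_succ (fun _ => (1 : R)) N
    have hpow : (C q * X ^ (j + 1)) ^ (N + 1) =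
        (C q * X ^ j) ^ (N + 1) * (X : PowerSeries R) ^ (N + 1) := by
      rw [pow_succ X j, ← mul_assoc, mul_pow]
    rw [binomSum_succ, binomSum_succ, shiftedProd_succ (N + 1), hpow,
      pow_succ (C q * X ^ j) (N + 1)]
    linear_combination ih + (shiftedProd qi (N + 1) * (C q * X ^ j) ^ (N + 1)) * hone -
      (shiftedProd qi (N + 1) * (C q * X ^ j) ^ (N + 1) *
        boundedSeries (fun _ => (1 : R)) (N + 1) * X ^ j * X ^ (N + 1)) * hqC

theorem X_pow_dvd_mul_X_pow_succ_pow (c : R) (N j : ℕ) :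
    X ^ (N + 1) ∣ (C c * X ^ (j + 1)) ^ (N + 1) :=
  pow_dvd_pow_of_dvd (dvd_mul_of_dvd_right (dvd_pow_self X j.succ_ne_zero) _) _

theorem X_pow_dvd_qProd_mul_binomSum (hq : q * qi = 1) (N J : ℕ) :
    X ^ (N + 1) ∣ qProd q J * binomSum q qi N 1 - qProd 1 J * binomSum q qi N (J + 1) := by
  induction J with
  | zero => simp only [qProd, Finset.prod_range_zero, zero_add, sub_self, dvd_zero]
  | succ J ih =>
    have hshift := binomSum_shift hq N (J + 1)
    obtain ⟨u, hu⟩ := ih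
    obtain ⟨v, hv⟩ := X_pow_dvd_mul_X_pow_succ_pow q N J
    rw [hv] at hshift
    rw [qProd_succ, qProd_succ, map_one]
    refine ⟨u * (1 - C q * X ^ (J + 1)) - qProd 1 J *
      (shiftedProd qi (N + 1) * boundedSeries (fun _ => (1 : R)) N * v), ?_⟩
    linear_combination (1 - C q * X ^ (J + 1)) * hu + qProd 1 J * hshift

theorem X_pow_dvd_binomSum_sub_one (N : ℕ) : X ^ (N + 1) ∣ binomSum q qi N (N + 1) - 1 := by
  rw [← binomSum_zero (q := q) (qi := qi) (N + 1), binomSum, binomSum, zero_add,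
    Finset.sum_range_one, Finset.sum_range_succ', add_sub_cancel_right]
  refine Finset.dvd_sum fun k _ => dvd_mul_of_dvd_right ?_ _
  rw [mul_pow, ← pow_mul]
  exact dvd_mul_of_dvd_right (pow_dvd_pow X (Nat.le_mul_of_pos_right _ k.succ_pos)) _

/-- `∑_λ T ^ |λ|`. -/
def partitionSeries (R : Type*) [CommRing R] : PowerSeries R := statSeries fun _ => 1

/-- `∑_λ (∑_{(i, j) ∈ λ} q ^ (j - i)) T ^ |λ|`, with `qi` standing for `q⁻¹`. -/
def contentSeries (q qi : R) : PowerSeries R :=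
  mk fun n => ∑ l : n.Partition, ∑ s ∈ cells l, q ^ s.2 * qi ^ s.1

theorem X_pow_dvd_partitionSeries_mul_qProd_sub_one (N : ℕ) :
    X ^ (N + 1) ∣ partitionSeries R * qProd 1 N - 1 := by
  rw [← boundedSeries_one_mul_qProd N, ← sub_mul]
  exact (X_pow_dvd_statSeries_sub_boundedSeries _ N).mul_right _

theorem partitionSeries_add_contentSeries (q qi : R) :
    partitionSeries R + C ((q - 1) * (1 - qi)) * contentSeries q qi =
      statSeries fun L => 1 + (1 - qi) * rowStat q qi L := by
  ext n
  rw [map_add, coeff_C_mul, partitionSeries, contentSeries, statSeries, statSeries, coeff_mk,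
    coeff_mk, coeff_mk, Finset.mul_sum, ← Finset.sum_add_distrib]
  refine Finset.sum_congr rfl fun l _ => ?_
  rw [rowStat_rows]
  ring

theorem X_pow_dvd_qProd_mul_qProd_mul_content (hq : q * qi = 1) (N : ℕ) :
    X ^ (N + 1) ∣ qProd q N * qProd qi N *
      (partitionSeries R + C ((q - 1) * (1 - qi)) * contentSeries q qi) - qProd 1 N := by
  rw [partitionSeries_add_contentSeries]
  have hbounded : qProd qi N * boundedSeries (fun L => 1 + (1 - qi) * rowStat q qi L) N =
      binomSum q qi N 1 := by
    rw [boundedSeries_add, boundedSeries_const_mul, qProd_mul_boundedSeries]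
  obtain ⟨u, hu⟩ :=
    X_pow_dvd_statSeries_sub_boundedSeries (fun L => 1 + (1 - qi) * rowStat q qi L) N
  obtain ⟨v, hv⟩ := X_pow_dvd_qProd_mul_binomSum hq N N
  obtain ⟨w, hw⟩ := X_pow_dvd_binomSum_sub_one (q := q) (qi := qi) N
  refine ⟨qProd q N * qProd qi N * u + v + qProd 1 N * w, ?_⟩
  linear_combination qProd q N * qProd qi N * hu + qProd q N * hbounded + hv + qProd 1 N * hw

/-- The Bloch–Okounkov one-point function: modulo every power of `T`, the quotient `H` of the two
series is `∏ (1 - T ^ k) ^ 2 / ((1 - q T ^ k) (1 - q⁻¹ T ^ k))`. -/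
theorem X_pow_dvd_qProd_mul_qProd_mul_sub (hq : q * qi = 1) {H : PowerSeries R}
    (hH : partitionSeries R * H =
      partitionSeries R + C ((q - 1) * (1 - qi)) * contentSeries q qi) (N : ℕ) :
    X ^ (N + 1) ∣ qProd q N * qProd qi N * H - qProd 1 N ^ 2 := by
  obtain ⟨u, hu⟩ := X_pow_dvd_qProd_mul_qProd_mul_content hq N
  obtain ⟨v, hv⟩ := X_pow_dvd_partitionSeries_mul_qProd_sub_one (R := R) N
  rw [← hH] at hu
  refine ⟨qProd 1 N * u - qProd q N * qProd qi N * H * v, ?_⟩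
  linear_combination qProd 1 N * hu - qProd q N * qProd qi N * H * hv

end QSeries

/-! ### Lambert series and Eisenstein series -/

section CoefficientDerivation

open PowerSeries

variable {R A : Type*} [CommRing R] [CommRing A] [Algebra R A]

/-- The derivation of `A⟦T⟧` which applies a derivation of `A` to every coefficient. -/
def coeffDerivation (D : Derivation R A A) : Derivation R A⟦X⟧ A⟦X⟧ :=
  Derivation.mk'
    { toFun := fun f => mk fun n => D (coeff n f)
      map_add' := fun f g => by
        ext n
        simp only [map_add, coeff_mk]
      map_smul' := fun r f => by
        ext n
        simp only [coeff_mk, RingHom.id_apply, PowerSeries.coeff_smul, Derivation.map_smul] }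
    fun f g => by
      ext n
      simp only [LinearMap.coe_mk, AddHom.coe_mk, smul_eq_mul, coeff_mk, map_add, coeff_mul,
        map_sum, Derivation.leibniz, Finset.sum_add_distrib]
      rw [← Finset.Nat.sum_antidiagonal_swap (f := fun p => coeff p.1 g * D (coeff p.2 f))]
      rfl

variable (D : Derivation R A A)

theorem coeff_coeffDerivation (f : A⟦X⟧) (n : ℕ) :
    coeff n (coeffDerivation D f) = D (coeff n f) := by
  change coeff n (mk fun n => D (coeff n f)) = _
  rw [coeff_mk]

theorem coeffDerivation_C (c : A) : coeffDerivation D (C c) = C (D c) := by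
  ext n
  rw [coeff_coeffDerivation, coeff_C, coeff_C]
  split_ifs
  exacts [rfl, map_zero D]

theorem coeffDerivation_X_pow (k : ℕ) : coeffDerivation D (X ^ k) = 0 := by
  ext n
  rw [coeff_coeffDerivation, coeff_X_pow, map_zero]
  split_ifs
  exacts [D.map_one_eq_zero, map_zero D]

theorem X_pow_dvd_coeffDerivation {f : A⟦X⟧} {N : ℕ} (h : X ^ N ∣ f) :
    X ^ N ∣ coeffDerivation D f := by
  obtain ⟨g, rfl⟩ := h
  refine ⟨coeffDerivation D g, ?_⟩
  rw [Derivation.leibniz, coeffDerivation_X_pow, smul_zero, add_zero, smul_eq_mul]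

/-- The Lambert series `∑_{k ≥ 1} c T ^ k / (1 - c T ^ k)`. -/
def lambert (c : A) : A⟦X⟧ := mk fun n => ∑ d ∈ n.divisors, c ^ d

/-- The `k`-th term `c T ^ k / (1 - c T ^ k)` of the Lambert series of `c`. -/
def geomTail (c : A) (k : ℕ) : A⟦X⟧ := mk fun n => if k ∣ n ∧ n ≠ 0 then c ^ (n / k) else 0

theorem one_sub_mul_geomTail (c : A) {k : ℕ} (hk : 0 < k) :
    (1 - C c * X ^ k) * geomTail c k = C c * X ^ k := by
  ext n
  simp only [sub_mul, one_mul, map_sub, mul_assoc, coeff_C_mul, coeff_X_pow_mul', coeff_X_pow,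
    geomTail, coeff_mk]
  by_cases hn : k ≤ n
  · obtain ⟨m, rfl⟩ := Nat.exists_eq_add_of_le' hn
    simp only [if_pos hn, Nat.add_sub_cancel, Nat.dvd_add_self_right, Nat.add_div_right m hk,
      pow_succ']
    rcases eq_or_ne m 0 with rfl | hm
    · simp [hk.ne']
    · simp [hm, hk.ne']
  · have hdvd : ¬(k ∣ n ∧ n ≠ 0) := fun h => hn (Nat.le_of_dvd (Nat.pos_of_ne_zero h.2) h.1)
    rw [if_neg hn, if_neg hdvd, if_neg (fun h => hn h.ge), mul_zero, sub_zero]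

theorem divisors_eq_filter_Ico {n N : ℕ} (hn : n ≠ 0) (h : n ≤ N) :
    n.divisors = (Finset.Ico 1 (N + 1)).filter (· ∣ n) := by
  ext d
  rw [Nat.mem_divisors, Finset.mem_filter, Finset.mem_Ico]
  refine ⟨fun hd => ⟨⟨Nat.pos_of_dvd_of_pos hd.1 (Nat.pos_of_ne_zero hn), ?_⟩, hd.1⟩,
    fun hd => ⟨hd.2, hn⟩⟩
  exact Nat.lt_succ_of_le ((Nat.le_of_dvd (Nat.pos_of_ne_zero hn) hd.1).trans h)

theorem X_pow_dvd_lambert_sub (c : A) (N : ℕ) :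
    X ^ (N + 1) ∣ lambert c - ∑ k ∈ Finset.range N, geomTail c (k + 1) := by
  rw [X_pow_dvd_iff]
  intro n hn
  rw [map_sub, map_sum, sub_eq_zero, lambert, coeff_mk, Finset.range_eq_Ico,
    Finset.sum_Ico_add' (fun k => coeff n (geomTail c k)) 0 N 1, zero_add]
  simp only [geomTail, coeff_mk]
  rcases eq_or_ne n 0 with rfl | hn0
  · simp only [Nat.divisors_zero, Finset.sum_empty, ne_eq, not_true_eq_false, and_false, if_false,
      Finset.sum_const_zero]
  · rw [← Nat.sum_div_divisors, divisors_eq_filter_Ico hn0 (Nat.le_of_lt_succ hn),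
      Finset.sum_filter]
    simp only [hn0, ne_eq, not_false_eq_true, and_true]

theorem coeffDerivation_qProd {c m : A} (hc : D c = m * c) (N : ℕ) :
    coeffDerivation D (qProd c N) =
      -C m * (qProd c N * ∑ k ∈ Finset.range N, geomTail c (k + 1)) := by
  induction N with
  | zero =>
    rw [qProd, Finset.prod_range_zero, Derivation.map_one_eq_zero, Finset.sum_range_zero, mul_zero,
      mul_zero]
  | succ N ih =>
    have hgeom := one_sub_mul_geomTail c N.succ_pos
    rw [Nat.succ_eq_add_one] at hgeom
    simp only [qProd_succ, Derivation.leibniz, map_sub, Derivation.map_one_eq_zero, ih,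
      coeffDerivation_C, coeffDerivation_X_pow, hc, Finset.sum_range_succ, map_mul, smul_eq_mul]
    linear_combination C m * qProd c N * hgeom

theorem X_pow_dvd_coeffDerivation_qProd {c m : A} (hc : D c = m * c) (N : ℕ) :
    X ^ (N + 1) ∣ coeffDerivation D (qProd c N) + C m * (qProd c N * lambert c) := by
  obtain ⟨u, hu⟩ := X_pow_dvd_lambert_sub c N
  refine ⟨C m * qProd c N * u, ?_⟩
  rw [coeffDerivation_qProd D hc]
  linear_combination C m * qProd c N * hu

theorem coeffDerivation_qProd_one (N : ℕ) : coeffDerivation D (qProd 1 N) = 0 := by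
  rw [coeffDerivation_qProd D (m := 0) (by rw [Derivation.map_one_eq_zero, zero_mul]), map_zero,
    neg_zero, zero_mul]

theorem isUnit_qProd (c : A) (N : ℕ) : IsUnit (qProd c N) := by
  simp only [isUnit_iff_constantCoeff, qProd, map_prod, map_sub, map_one, map_mul, map_pow,
    constantCoeff_X, zero_pow (Nat.succ_ne_zero _), mul_zero, sub_zero, Finset.prod_const_one,
    isUnit_one]

theorem eq_zero_of_forall_X_pow_dvd {f : A⟦X⟧} (h : ∀ N, X ^ (N + 1) ∣ f) : f = 0 := by
  ext n
  exact X_pow_dvd_iff.1 (h n) n (Nat.lt_succ_self n)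

variable {q qi : A} {H : A⟦X⟧}

theorem coeffDerivation_eq_lambert_mul (hq : q * qi = 1) (hD : D q = q)
    (hH : partitionSeries A * H =
      partitionSeries A + C ((q - 1) * (1 - qi)) * contentSeries q qi) :
    coeffDerivation D H = (lambert q - lambert qi) * H := by
  have hDi : D qi = -1 * qi := by
    rw [D.leibniz_of_mul_eq_one ((mul_comm qi q).trans hq), hD, smul_eq_mul]
    linear_combination -qi * hq
  rw [← sub_eq_zero]
  refine eq_zero_of_forall_X_pow_dvd fun N => ?_
  obtain ⟨u, hu⟩ := X_pow_dvd_coeffDerivation D (X_pow_dvd_qProd_mul_qProd_mul_sub hq hH N)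
  obtain ⟨v, hv⟩ := X_pow_dvd_coeffDerivation_qProd D (c := q) (m := 1) (by rw [hD, one_mul]) N
  obtain ⟨w, hw⟩ := X_pow_dvd_coeffDerivation_qProd D hDi N
  simp only [map_sub, pow_two, Derivation.leibniz, coeffDerivation_qProd_one, smul_eq_mul] at hu
  have hcancel : X ^ (N + 1) ∣ (qProd q N * qProd qi N) *
      (coeffDerivation D H - (lambert q - lambert qi) * H) := by
    refine ⟨u - v * qProd qi N * H - qProd q N * w * H, ?_⟩
    simp only [map_one, map_neg] at hv hw
    linear_combination hu - qProd qi N * H * hv - qProd q N * H * hw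
  exact ((isUnit_qProd q N).mul (isUnit_qProd qi N)).dvd_mul_left.1 hcancel

theorem map_qProd {B : Type*} [CommRing B] (φ : A →+* B) (c : A) (N : ℕ) :
    PowerSeries.map φ (qProd c N) = qProd (φ c) N := by
  simp only [qProd, map_prod, map_sub, map_one, map_mul, map_pow, map_X, map_C]

theorem map_eq_one_of_map_eq_one {B : Type*} [CommRing B] (φ : A →+* B) (hq : q * qi = 1)
    (hφ : φ q = 1) (hH : partitionSeries A * H =
      partitionSeries A + C ((q - 1) * (1 - qi)) * contentSeries q qi) :
    PowerSeries.map φ H = 1 := by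
  have hφi : φ qi = 1 := by
    rw [← one_mul (φ qi), ← hφ, ← map_mul, hq, map_one, hφ]
  rw [← sub_eq_zero]
  refine eq_zero_of_forall_X_pow_dvd fun N => ?_
  have hdvd := map_dvd (PowerSeries.map φ) (X_pow_dvd_qProd_mul_qProd_mul_sub hq hH N)
  simp only [map_pow, map_X, map_sub, map_mul, map_qProd, hφ, hφi, map_one, ← pow_two] at hdvd
  refine ((isUnit_qProd (1 : B) N).pow 2).dvd_mul_left.1 ?_
  rwa [mul_sub, mul_one]

end CoefficientDerivation

section SwapVars

open PowerSeries

/-- The exchange of the two variables of an iterated power series. -/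
def swapVars {R : Type*} [CommSemiring R] : R⟦X⟧⟦X⟧ →+* R⟦X⟧⟦X⟧ where
  toFun f := mk fun n => mk fun m => coeff n (coeff m f)
  map_one' := by
    ext n m
    simp only [coeff_mk, coeff_one]
    split_ifs <;> simp_all [coeff_one]
  map_zero' := rfl
  map_add' f g := rfl
  map_mul' f g := by
    ext n m
    simp only [coeff_mk, coeff_mul, map_sum]
    exact Finset.sum_comm

section Semiring

variable {R : Type*} [CommSemiring R]

theorem coeff_coeff_swapVars (f : R⟦X⟧⟦X⟧) (n m : ℕ) :
    coeff m (coeff n (swapVars f)) = coeff n (coeff m f) := by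
  change coeff m (coeff n (mk fun n => mk fun m => coeff n (coeff m f))) = _
  rw [coeff_mk, coeff_mk]

theorem swapVars_swapVars (f : R⟦X⟧⟦X⟧) : swapVars (swapVars f) = f := by
  ext n m
  rw [coeff_coeff_swapVars, coeff_coeff_swapVars]

theorem swapVars_map_C (s : R⟦X⟧) : swapVars (PowerSeries.map C s) = C s := by
  ext n m
  rw [coeff_coeff_swapVars, coeff_map, coeff_C, coeff_C]
  split_ifs <;> rfl

theorem constantCoeff_swapVars (f : R⟦X⟧⟦X⟧) :
    constantCoeff (swapVars f) = PowerSeries.map constantCoeff f := by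
  ext n
  rw [← coeff_zero_eq_constantCoeff_apply, coeff_coeff_swapVars, coeff_map,
    coeff_zero_eq_constantCoeff_apply]

end Semiring

variable {R S : Type*} [CommRing R] [CommRing S]

theorem derivative_swapVars (f : R⟦X⟧⟦X⟧) :
    d⁄dX R⟦X⟧ (swapVars f) = swapVars (coeffDerivation (d⁄dX R) f) := by
  ext n m
  rw [coeff_coeff_swapVars, coeff_coeffDerivation, coeff_derivative, coeff_derivative,
    ← Nat.cast_succ, ← Nat.cast_succ, ← nsmul_eq_mul', ← nsmul_eq_mul', map_nsmul,
    coeff_coeff_swapVars]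

theorem derivative_mul (f g : R⟦X⟧) : d⁄dX R (f * g) = f * d⁄dX R g + g * d⁄dX R f :=
  (d⁄dX R).leibniz f g

theorem derivative_map (φ : R →+* S) (f : R⟦X⟧) :
    d⁄dX S (PowerSeries.map φ f) = PowerSeries.map φ (d⁄dX R f) := by
  ext n
  simp only [coeff_derivative, coeff_map, map_mul, map_add, map_natCast, map_one]

end SwapVars

section Eisenstein

open PowerSeries

theorem constantCoeff_eisExponent : constantCoeff eisExponent = 0 := by
  rw [eisExponent, map_mul, ← coeff_zero_eq_constantCoeff_apply (mk _), coeff_mk,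
    if_neg (by norm_num), mul_zero]

theorem hasSubst_eisExponent : HasSubst eisExponent :=
  HasSubst.of_constantCoeff_zero' constantCoeff_eisExponent

theorem derivative_expOf_eisExponent :
    d⁄dX ℚ⟦X⟧ (expOf eisExponent) = d⁄dX ℚ⟦X⟧ eisExponent * expOf eisExponent := by
  rw [expOf, derivative_subst hasSubst_eisExponent, derivative_exp, mul_comm]

theorem constantCoeff_expOf_eisExponent : constantCoeff (expOf eisExponent) = 1 := by
  rw [expOf, eq_X_mul_shift_add_const (exp ℚ⟦X⟧), subst_add hasSubst_eisExponent,
    subst_mul hasSubst_eisExponent, subst_X hasSubst_eisExponent, map_add, map_mul,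
    constantCoeff_eisExponent, zero_mul, zero_add, constantCoeff_exp, map_one,
    ← coe_substAlgHom hasSubst_eisExponent, map_one, map_one]

theorem derivative_rescale_exp (c : ℚ) :
    d⁄dX ℚ (rescale c (exp ℚ)) = C c * rescale c (exp ℚ) := by
  ext n
  simp only [coeff_derivative, coeff_rescale, coeff_C_mul, coeff_exp, Algebra.algebraMap_self,
    RingHom.id_apply, Nat.factorial_succ, Nat.cast_mul, Nat.cast_succ]
  have hn : (n : ℚ) + 1 ≠ 0 := n.cast_add_one_ne_zero
  have hfac : (n.factorial : ℚ) ≠ 0 := Nat.cast_ne_zero.2 n.factorial_ne_zero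
  field_simp
  ring

theorem rescale_exp_mul_rescale_neg_exp (c : ℚ) :
    rescale c (exp ℚ) * rescale (-c) (exp ℚ) = 1 := by
  rw [exp_mul_exp_eq_exp_add, add_neg_cancel, rescale_zero, RingHom.comp_apply,
    constantCoeff_exp, map_one]

theorem coeff_exp_pow (d m : ℕ) :
    coeff m (exp ℚ ^ d) = (m.factorial : ℚ)⁻¹ * (d : ℚ) ^ m := by
  rw [exp_pow_eq_rescale_exp, coeff_rescale, coeff_exp, Algebra.algebraMap_self, RingHom.id_apply,
    one_div, mul_comm]

theorem coeff_derivative_eisExponent (m : ℕ) :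
    coeff m (d⁄dX ℚ⟦X⟧ eisExponent) =
      if Odd m then (2 * (m.factorial : ℚ)⁻¹) • eisG (m + 1) else 0 := by
  have heven : 2 ≤ m + 1 ∧ Even (m + 1) ↔ Odd m := by grind
  rw [coeff_derivative, eisExponent, two_mul, map_add, coeff_mk, ← Nat.cast_succ, ← nsmul_eq_mul']
  simp only [heven]
  split_ifs
  · have hm : (m : ℚ) + 1 ≠ 0 := m.cast_add_one_ne_zero
    have hfac : (m.factorial : ℚ) ≠ 0 := Nat.cast_ne_zero.2 m.factorial_ne_zero
    rw [← add_smul, ← Nat.cast_smul_eq_nsmul ℚ, smul_smul, Nat.factorial_succ]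
    congr 1
    push_cast
    field_simp
    ring
  · rw [add_zero, smul_zero]

/-- The part of the logarithmic derivative in `u` of `exp (2 ∑ G_k u ^ k / k!)` which is constant
in `T`; it only involves Bernoulli numbers. -/
def bernoulliPart : ℚ⟦X⟧ := PowerSeries.map constantCoeff (d⁄dX ℚ⟦X⟧ eisExponent)

theorem derivative_eisExponent :
    d⁄dX ℚ⟦X⟧ eisExponent =
      swapVars (lambert (exp ℚ) - lambert (rescale (-1) (exp ℚ))) +
        PowerSeries.map C bernoulliPart := by
  ext m n
  rw [map_add, map_add, coeff_coeff_swapVars, map_sub, map_sub, coeff_map, coeff_C, bernoulliPart,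
    coeff_map]
  rcases Nat.eq_zero_or_pos n with rfl | hn
  · simp only [lambert, coeff_mk, Nat.divisors_zero, Finset.sum_empty, map_zero, sub_zero,
      if_true, zero_add, coeff_zero_eq_constantCoeff_apply]
  · simp only [if_neg hn.ne', lambert, coeff_mk, map_sum, ← map_pow, coeff_rescale, coeff_exp_pow,
      ← Finset.sum_sub_distrib, add_zero, coeff_derivative_eisExponent]
    split_ifs with hm
    · rw [coeff_smul, eisG, coeff_mk, if_neg hn.ne', smul_eq_mul, Finset.mul_sum,
        hm.neg_one_pow, Nat.add_sub_cancel]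
      exact Finset.sum_congr rfl fun d _ => by ring
    · rw [map_zero, (Nat.not_odd_iff_even.1 hm).neg_one_pow]
      exact (Finset.sum_eq_zero fun d _ => by ring).symm

theorem coeff_bernoulliPart (m : ℕ) :
    coeff m bernoulliPart =
      if Odd m then -(bernoulli (m + 1) / ((m + 1).factorial : ℚ)) else 0 := by
  rw [bernoulliPart, coeff_map, coeff_derivative_eisExponent]
  split_ifs
  · have hm : (m : ℚ) + 1 ≠ 0 := m.cast_add_one_ne_zero
    have hfac : (m.factorial : ℚ) ≠ 0 := Nat.cast_ne_zero.2 m.factorial_ne_zero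
    rw [← coeff_zero_eq_constantCoeff_apply, coeff_smul, eisG, coeff_mk, if_pos rfl, smul_eq_mul,
      Nat.factorial_succ]
    push_cast
    field_simp
  · exact map_zero _

theorem X_mul_bernoulliPart :
    X * bernoulliPart = -(bernoulliPowerSeries ℚ - 1 + C (1 / 2) * X) := by
  ext k
  simp only [map_neg, map_add, map_sub, bernoulliPowerSeries, coeff_mk, coeff_one, coeff_C_mul,
    coeff_X, Algebra.algebraMap_self, RingHom.id_apply]
  rcases k with _ | _ | m
  · simp
  · rw [coeff_succ_X_mul, coeff_bernoulliPart, if_neg (by decide)]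
    norm_num
  · rw [coeff_succ_X_mul, coeff_bernoulliPart, if_neg (m + 1).succ_ne_zero,
      if_neg (show m + 1 + 1 ≠ 1 by lia), mul_zero, sub_zero, add_zero]
    split_ifs with hm
    · rfl
    · rw [bernoulli_eq_zero_of_odd (Nat.not_odd_iff_even.1 hm).add_one (by lia), zero_div, neg_zero]

/-- The quotient `(e ^ (u / 2) - e ^ (- u / 2)) / u`. -/
def sinhQuot : ℚ⟦X⟧ :=
  mk fun m => coeff (m + 1) (rescale (1 / 2) (exp ℚ) - rescale (-1 / 2) (exp ℚ))

theorem X_mul_sinhQuot :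
    X * sinhQuot = rescale (1 / 2 : ℚ) (exp ℚ) - rescale (-1 / 2 : ℚ) (exp ℚ) := by
  rw [sinhQuot, ← sub_const_eq_X_mul_shift, map_sub, ← coeff_zero_eq_constantCoeff_apply,
    ← coeff_zero_eq_constantCoeff_apply, coeff_rescale, coeff_rescale, pow_zero, pow_zero, sub_self,
    map_zero, sub_zero]

theorem constantCoeff_sinhQuot : constantCoeff sinhQuot = 1 := by
  rw [← coeff_zero_eq_constantCoeff_apply, sinhQuot, coeff_mk, map_sub, coeff_rescale,
    coeff_rescale, coeff_exp]
  norm_num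

theorem derivative_sinhQuot : d⁄dX ℚ sinhQuot = -bernoulliPart * sinhQuot := by
  have half_neg : (-1 / 2 : ℚ) = -(1 / 2) := by norm_num
  have hs := X_mul_sinhQuot
  have hderiv := congrArg (d⁄dX ℚ) hs
  have hsq : rescale (1 / 2 : ℚ) (exp ℚ) * rescale (1 / 2 : ℚ) (exp ℚ) = exp ℚ := by
    rw [exp_mul_exp_eq_exp_add, add_halves, rescale_one, RingHom.id_apply]
  have hinv := rescale_exp_mul_rescale_neg_exp (1 / 2)
  have hC : (C (1 / 2 : ℚ) : ℚ⟦X⟧) + C (1 / 2 : ℚ) = 1 := by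
    rw [← map_add, add_halves, map_one]
  have hB := bernoulliPowerSeries_mul_exp_sub_one ℚ
  rw [derivative_mul, derivative_X, map_sub, derivative_rescale_exp, derivative_rescale_exp,
    mul_one, half_neg, map_neg] at hderiv
  rw [half_neg] at hs
  rw [← hsq] at hB
  set e := rescale (1 / 2 : ℚ) (exp ℚ)
  set e' := rescale (-(1 / 2) : ℚ) (exp ℚ)
  apply mul_left_cancel₀ (pow_ne_zero 2 (X_ne_zero (R := ℚ)))
  linear_combination X * hderiv - bernoulliPowerSeries ℚ * hs - C (1 / 2 : ℚ) * X * hs +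
    (X * sinhQuot) * X_mul_bernoulliPart + X * e' * hC - e' * hB +
    bernoulliPowerSeries ℚ * e * hinv

theorem eq_swapVars_of_partitionSeries_mul_eq {H : ℚ⟦X⟧⟦X⟧}
    (hH : partitionSeries ℚ⟦X⟧ * H = partitionSeries ℚ⟦X⟧ +
      C ((exp ℚ - 1) * (1 - rescale (-1) (exp ℚ))) *
        contentSeries (exp ℚ) (rescale (-1) (exp ℚ))) :
    H = swapVars (PowerSeries.map C sinhQuot * expOf eisExponent) := by
  have hq : exp ℚ * rescale (-1) (exp ℚ) = 1 := by
    simpa only [rescale_one, RingHom.id_apply] using rescale_exp_mul_rescale_neg_exp 1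
  suffices h : swapVars H = PowerSeries.map C sinhQuot * expOf eisExponent by
    rw [← h, swapVars_swapVars]
  have : IsAddTorsionFree ℚ⟦X⟧ := .of_module_rat _
  refine eq_of_derivative_eq_mul
    (a := swapVars (lambert (exp ℚ) - lambert (rescale (-1) (exp ℚ)))) ?_ ?_ ?_
  · rw [derivative_swapVars, coeffDerivation_eq_lambert_mul _ hq (derivative_exp ℚ) hH, map_mul]
  · rw [derivative_mul, derivative_map, derivative_sinhQuot, derivative_expOf_eisExponent,
      derivative_eisExponent, map_mul, map_neg]
    ring
  · rw [constantCoeff_swapVars, map_eq_one_of_map_eq_one _ hq constantCoeff_exp hH, map_mul,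
      constantCoeff_expOf_eisExponent, mul_one, ← coeff_zero_eq_constantCoeff_apply, coeff_map,
      coeff_zero_eq_constantCoeff_apply, constantCoeff_sinhQuot, map_one]

end Eisenstein

/-! ### Quasi-modular forms -/

section QuasiModular

open PowerSeries UpperHalfPlane ModularForm EisensteinSeries
open scoped MatrixGroups

theorem dvd_of_map_dvd_map {K L : Type*} [Field K] [Field L] (φ : K →+* L) {f g : K⟦X⟧}
    (h : PowerSeries.map φ f ∣ PowerSeries.map φ g) : f ∣ g := by
  rcases eq_or_ne f 0 with rfl | hf
  · rw [map_zero, zero_dvd_iff] at h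
    rw [PowerSeries.map_injective φ φ.injective (h.trans (map_zero _).symm)]
  have hX : X ^ f.order.toNat ∣ PowerSeries.map φ g := by
    have hf := map_dvd (PowerSeries.map φ) (X_pow_order_dvd (φ := f))
    rw [map_pow, map_X] at hf
    exact hf.trans h
  rw [← X_pow_order_mul_divXPowOrder (f := f), (isUnit_divided_by_X_pow_order hf).mul_right_dvd]
  refine X_pow_dvd_iff.2 fun m hm => φ.injective ?_
  rw [map_zero, ← coeff_map, X_pow_dvd_iff.1 hX m hm]

/-- The expansion `1 - (2k / B_k) ∑_{n ≥ 1} ∑_{d ∣ n} d ^ (k-1) T ^ n` of the Eisenstein series of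
weight `k`, normalised to have constant term one. -/
def eisE (k : ℕ) : ℚ⟦X⟧ :=
  mk fun n => if n = 0 then 1 else -(2 * k / bernoulli k) * ∑ d ∈ n.divisors, (d : ℚ) ^ (k - 1)

theorem constantCoeff_eisE (k : ℕ) : constantCoeff (eisE k) = 1 := by
  rw [← coeff_zero_eq_constantCoeff_apply, eisE, coeff_mk, if_pos rfl]

theorem bernoulli_ne_zero_of_even {k : ℕ} (hk : Even k) : bernoulli k ≠ 0 := by
  obtain ⟨j, rfl⟩ := even_iff_exists_two_mul.1 hk
  rcases Nat.eq_zero_or_pos j with rfl | hj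
  · exact bernoulli_zero ▸ one_ne_zero
  intro h
  have hzeta : riemannZeta (2 * j) = 0 := by
    rw [riemannZeta_two_mul_nat hj.ne', h, Rat.cast_zero, mul_zero, zero_div]
  have hre : 1 < (2 * (j : ℂ)).re := by
    rw [← Nat.cast_ofNat (R := ℂ), ← Nat.cast_mul, Complex.natCast_re, Nat.one_lt_cast]
    lia
  exact riemannZeta_ne_zero_of_one_lt_re hre hzeta

theorem eisG_eq_smul_eisE {k : ℕ} (hk : Even k) (hk0 : k ≠ 0) :
    eisG k = (-bernoulli k / (2 * k)) • eisE k := by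
  have hB : bernoulli k ≠ 0 := bernoulli_ne_zero_of_even hk
  have hk' : (k : ℚ) ≠ 0 := Nat.cast_ne_zero.2 hk0
  ext n
  rw [coeff_smul, eisG, eisE, coeff_mk, coeff_mk, smul_eq_mul]
  split_ifs
  · rw [mul_one]
  · field_simp

theorem eisE_mem_quasiModular {k : ℕ} (hk : Even k) (hk0 : k ≠ 0) (h : eisG k ∈ quasiModular) :
    eisE k ∈ quasiModular := by
  have hc : -bernoulli k / (2 * k) ≠ 0 := div_ne_zero (neg_ne_zero.2 (bernoulli_ne_zero_of_even hk))
    (mul_ne_zero two_ne_zero (Nat.cast_ne_zero.2 hk0))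
  rw [eisG_eq_smul_eisE hk hk0] at h
  exact (quasiModular.toSubmodule.smul_mem_iff hc).1 h

/-- Extension of scalars of power series from `ℚ` to `ℂ`. -/
abbrev toComplex : ℚ⟦X⟧ →+* ℂ⟦X⟧ := PowerSeries.map (algebraMap ℚ ℂ)

theorem toComplex_injective : Function.Injective toComplex :=
  PowerSeries.map_injective _ (algebraMap ℚ ℂ).injective

theorem toComplex_smul (c : ℚ) (f : ℚ⟦X⟧) : toComplex (c • f) = (c : ℂ) • toComplex f := by
  rw [smul_eq_C_mul, map_mul, map_C, smul_eq_C_mul, eq_ratCast]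

theorem qExpansion_E {k : ℕ} (hk : 3 ≤ k) (heven : Even k) :
    qExpansion 1 (E hk) = toComplex (eisE k) := by
  ext n
  rw [E_qExpansion_coeff hk heven, coeff_map, eisE, coeff_mk, ArithmeticFunction.sigma_apply]
  split_ifs
  · exact (map_one _).symm
  · push_cast
    rfl

theorem qExpansion_mcast_E₄_pow_mul_E₆_pow {k : ℤ} {a b : ℕ} (h : (a * 4 + b * 6 : ℤ) = k) :
    qExpansion 1 (ModularForm.mcast h ((E₄.pow a).mul (E₆.pow b)) : ModularForm 𝒮ℒ k) =
      toComplex (eisE 4 ^ a * eisE 6 ^ b) := by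
  rw [ModularForm.qExpansion_mcast, ModularForm.qExpansion_mul one_pos one_mem_strictPeriods_SL,
    ModularForm.qExpansion_pow one_pos one_mem_strictPeriods_SL,
    ModularForm.qExpansion_pow one_pos one_mem_strictPeriods_SL,
    qExpansion_E (k := 4) (by norm_num) (by decide),
    qExpansion_E (k := 6) (by norm_num) (by decide), map_mul, map_pow, map_pow]

theorem qExpansion_sub_smul {k : ℤ} (c : ℂ) (f g : ModularForm 𝒮ℒ k) :
    qExpansion 1 (f - c • g : ModularForm 𝒮ℒ k) = qExpansion 1 f - c • qExpansion 1 g := by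
  rw [← ModularForm.qExpansion_smul one_pos one_mem_strictPeriods_SL c g]
  exact ModularForm.qExpansion_sub one_pos one_mem_strictPeriods_SL f (c • g)

/-- The expansion `(E₄ ^ 3 - E₆ ^ 2) / 1728` of the modular discriminant. -/
def deltaQ : ℚ⟦X⟧ := (1 / 1728 : ℚ) • (eisE 4 ^ 3 - eisE 6 ^ 2)

theorem qExpansion_discriminant : qExpansion 1 discriminant = toComplex deltaQ := by
  let f : ModularForm 𝒮ℒ 12 := ModularForm.mcast (by norm_num) ((E₄.pow 3).mul (E₆.pow 0))
  let g : ModularForm 𝒮ℒ 12 := ModularForm.mcast (by norm_num) ((E₄.pow 0).mul (E₆.pow 2))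
  have h : discriminant = (1 / 1728 : ℂ) • ⇑(f - (1 : ℂ) • g) := by
    ext z
    have hf : f z = E₄ z ^ 3 * E₆ z ^ 0 := rfl
    have hg : g z = E₄ z ^ 0 * E₆ z ^ 2 := rfl
    rw [discriminant_eq_E₄_cube_sub_E₆_sq, Pi.smul_apply, one_smul, _root_.sub_apply, hf, hg,
      smul_eq_mul]
    ring
  rw [h, ModularForm.qExpansion_smul one_pos one_mem_strictPeriods_SL, qExpansion_sub_smul,
    qExpansion_mcast_E₄_pow_mul_E₆_pow, qExpansion_mcast_E₄_pow_mul_E₆_pow, deltaQ,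
    toComplex_smul, one_smul, ← map_sub, pow_zero, pow_zero, one_mul, mul_one]
  norm_num

theorem toComplex_deltaQ_ne_zero : toComplex deltaQ ≠ 0 := by
  intro h
  have hcoeff := discriminant_qExpansion_coeff_one
  rw [qExpansion_discriminant, h, map_zero] at hcoeff
  exact zero_ne_one hcoeff

theorem eq_zero_or_exists_weight {k : ℤ} (f : ModularForm 𝒮ℒ k) :
    f = 0 ∨ ∃ a b : ℕ, (a * 4 + b * 6 : ℤ) = k := by
  rcases lt_or_ge k 0 with hk | hk
  · exact .inl (rank_zero_iff_forall_zero.mp (levelOne_neg_weight_rank_zero hk) f)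
  rcases Int.even_or_odd k with ⟨j, rfl⟩ | hodd
  · rcases eq_or_ne j 1 with rfl | hj
    · exact .inl (rank_zero_iff_forall_zero.mp levelOne_weight_two_rank_zero f)
    rcases Int.even_or_odd' j with ⟨i, rfl | rfl⟩
    · exact .inr ⟨i.toNat, 0, by lia⟩
    · exact .inr ⟨(i - 1).toNat, 1, by lia⟩
  · exact .inl (levelOne_odd_weight_eq_zero hodd f)

theorem exists_qExpansion_eq_of_constantCoeff_eq_zero {k : ℤ} (f : ModularForm 𝒮ℒ k) {P : ℚ⟦X⟧}
    (hP : qExpansion 1 f = toComplex P) (h0 : constantCoeff P = 0) :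
    ∃ (g : ModularForm 𝒮ℒ (k - 12)) (Q : ℚ⟦X⟧), qExpansion 1 g = toComplex Q ∧ P = deltaQ * Q := by
  have hcoeff : (qExpansion 1 f).coeff 0 = 0 := by
    rw [hP, coeff_map, coeff_zero_eq_constantCoeff_apply, h0, map_zero]
  have hdiv := qExpansion_eq_qExpansion_discriminant_mul f hcoeff
  rw [hP, qExpansion_discriminant] at hdiv
  obtain ⟨Q, rfl⟩ := dvd_of_map_dvd_map (algebraMap ℚ ℂ) (Dvd.intro _ hdiv.symm)
  rw [map_mul] at hdiv
  exact ⟨_, Q, (mul_left_cancel₀ toComplex_deltaQ_ne_zero hdiv).symm, rfl⟩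

theorem eisE_four_mem_quasiModular : eisE 4 ∈ quasiModular :=
  eisE_mem_quasiModular (by decide) (by decide) (Algebra.subset_adjoin (by simp))

theorem eisE_six_mem_quasiModular : eisE 6 ∈ quasiModular :=
  eisE_mem_quasiModular (by decide) (by decide) (Algebra.subset_adjoin (by simp))

theorem eisE_four_pow_mul_eisE_six_pow_mem_quasiModular (a b : ℕ) :
    eisE 4 ^ a * eisE 6 ^ b ∈ quasiModular :=
  mul_mem (pow_mem eisE_four_mem_quasiModular _) (pow_mem eisE_six_mem_quasiModular _)

theorem deltaQ_mem_quasiModular : deltaQ ∈ quasiModular :=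
  Subalgebra.smul_mem _ (sub_mem (pow_mem eisE_four_mem_quasiModular _)
    (pow_mem eisE_six_mem_quasiModular _)) _

theorem eq_zero_of_qExpansion_zero {k : ℤ} {P : ℚ⟦X⟧}
    (hP : qExpansion 1 (0 : ModularForm 𝒮ℒ k) = toComplex P) : P = 0 := by
  rw [FunLike.coe_zero, qExpansion_zero] at hP
  exact toComplex_injective (hP.symm.trans (map_zero _).symm)

/-- Subtracting a multiple of `E₄ ^ a * E₆ ^ b` kills the constant term, and the difference is `Δ`
times a form of weight `k - 12`. -/
theorem mem_quasiModular_of_qExpansion {k : ℤ} (f : ModularForm 𝒮ℒ k) {P : ℚ⟦X⟧}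
    (hP : qExpansion 1 f = toComplex P) : P ∈ quasiModular := by
  obtain ⟨N, hN⟩ : ∃ N : ℕ, k < N := ⟨k.toNat + 1, by lia⟩
  induction N generalizing k P with
  | zero =>
    have hf : f = 0 := rank_zero_iff_forall_zero.mp (levelOne_neg_weight_rank_zero hN) f
    exact eq_zero_of_qExpansion_zero (hf ▸ hP) ▸ zero_mem _
  | succ N ih =>
    obtain rfl | ⟨a, b, hab⟩ := eq_zero_or_exists_weight f
    · exact eq_zero_of_qExpansion_zero hP ▸ zero_mem _
    set m := eisE 4 ^ a * eisE 6 ^ b with hm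
    have hsub := qExpansion_sub_smul ((constantCoeff P : ℚ) : ℂ) f
      (ModularForm.mcast hab ((E₄.pow a).mul (E₆.pow b)))
    rw [hP, qExpansion_mcast_E₄_pow_mul_E₆_pow, ← toComplex_smul, ← map_sub] at hsub
    have h0 : constantCoeff (P - constantCoeff P • m) = 0 := by
      rw [map_sub, smul_eq_C_mul, map_mul, hm, map_mul, map_pow, map_pow, constantCoeff_eisE,
        constantCoeff_eisE, constantCoeff_C, one_pow, one_pow, mul_one, mul_one, sub_self]
    obtain ⟨g, Q, hQ, hPQ⟩ := exists_qExpansion_eq_of_constantCoeff_eq_zero _ hsub h0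
    rw [sub_eq_iff_eq_add.1 hPQ]
    exact add_mem (mul_mem deltaQ_mem_quasiModular (ih g hQ (by lia)))
      (Subalgebra.smul_mem _ (eisE_four_pow_mul_eisE_six_pow_mem_quasiModular a b) _)

theorem eisG_mem_quasiModular {k : ℕ} (hk : Even k) (hk0 : k ≠ 0) : eisG k ∈ quasiModular := by
  rcases eq_or_ne k 2 with rfl | h2
  · exact Algebra.subset_adjoin (Set.mem_insert _ _)
  · have h3 : 3 ≤ k := by
      obtain ⟨j, rfl⟩ := hk
      lia
    rw [eisG_eq_smul_eisE hk hk0]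
    exact Subalgebra.smul_mem _ (mem_quasiModular_of_qExpansion (E h3) (qExpansion_E h3 hk)) _

theorem coeff_expOf_eisExponent_mem (m : ℕ) : coeff m (expOf eisExponent) ∈ quasiModular := by
  induction m using Nat.strong_induction_on with
  | _ m ih =>
    obtain _ | m := m
    · rw [coeff_zero_eq_constantCoeff_apply, constantCoeff_expOf_eisExponent]
      exact one_mem _
    have hderiv := congrArg (coeff m) derivative_expOf_eisExponent
    rw [coeff_derivative, coeff_mul, ← Nat.cast_succ, ← nsmul_eq_mul',
      ← Nat.cast_smul_eq_nsmul ℚ] at hderiv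
    have hm : ((m + 1 : ℕ) : ℚ) ≠ 0 := Nat.cast_ne_zero.2 m.succ_ne_zero
    refine (quasiModular.toSubmodule.smul_mem_iff hm).1 (hderiv ▸ ?_)
    refine sum_mem fun p hp => mul_mem (S := Subalgebra ℚ ℚ⟦X⟧) ?_ (ih _ ?_)
    · rw [coeff_derivative_eisExponent]
      split_ifs with hodd
      · exact Subalgebra.smul_mem _ (eisG_mem_quasiModular hodd.add_one p.1.succ_ne_zero) _
      · exact zero_mem _
    · rw [Finset.HasAntidiagonal.mem_antidiagonal] at hp
      lia

theorem coeff_map_C_mul_expOf_mem (s : ℚ⟦X⟧) (m : ℕ) :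
    coeff m (PowerSeries.map C s * expOf eisExponent) ∈ quasiModular := by
  rw [coeff_mul]
  refine sum_mem fun p _ => mul_mem ?_ (coeff_expOf_eisExponent_mem _)
  rw [coeff_map]
  exact Subalgebra.algebraMap_mem _ _

end QuasiModular

/-! ### The value at `(e ^ (u / 2), e ^ (- u / 2))` -/

section Specialisation

open PowerSeries

theorem map_mul_invOfUnit {R L : Type*} [CommRing R] [Field L] (φ : R →+* L) (f : R⟦X⟧) {g : R⟦X⟧}
    (hg : constantCoeff g = 1) :
    PowerSeries.map φ (f * invOfUnit g 1) = PowerSeries.map φ f * (PowerSeries.map φ g)⁻¹ := by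
  have hne : constantCoeff (PowerSeries.map φ g) ≠ 0 := by
    rw [← coeff_zero_eq_constantCoeff_apply, coeff_map, coeff_zero_eq_constantCoeff_apply, hg,
      map_one]
    exact one_ne_zero
  rw [PowerSeries.eq_mul_inv_iff_mul_eq hne, ← map_mul, mul_assoc, mul_comm (invOfUnit g 1),
    mul_invOfUnit g 1 (hg.trans Units.val_one.symm), mul_one]

section ValueAtPoint

variable {L : Type*} [Field L] [Algebra ℚ L] {a : Fin 2 → L}

theorem HasValue.coeff_mul_inv {x y : QZW⟦X⟧} {x' y' : L⟦X⟧}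
    (hx : ∀ n, HasValue a (coeff n x) (coeff n x')) (hy : ∀ n, HasValue a (coeff n y) (coeff n y'))
    (h1 : constantCoeff y = 1) (h1' : constantCoeff y' = 1) (n : ℕ) :
    HasValue a (coeff n (x * y⁻¹)) (coeff n (x' * y'⁻¹)) := by
  choose s hs hs' using fun n => hasValue_iff.1 (hx n)
  choose t ht ht' using fun n => hasValue_iff.1 (hy n)
  obtain rfl : PowerSeries.map (pairFun a) (mk s) = x := by ext n; rw [coeff_map, coeff_mk, hs]
  obtain rfl : PowerSeries.map (pairVal a) (mk s) = x' := by ext n; rw [coeff_map, coeff_mk, hs']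
  obtain rfl : PowerSeries.map (pairFun a) (mk t) = y := by ext n; rw [coeff_map, coeff_mk, ht]
  obtain rfl : PowerSeries.map (pairVal a) (mk t) = y' := by ext n; rw [coeff_map, coeff_mk, ht']
  have ht0 : constantCoeff (mk t) = 1 := Subtype.ext (Prod.ext h1 h1')
  rw [← map_mul_invOfUnit _ _ ht0, ← map_mul_invOfUnit _ _ ht0]
  exact hasValue_iff.2 ⟨coeff n (mk s * invOfUnit (mk t) 1), (coeff_map ..).symm,
    (coeff_map ..).symm⟩

theorem constantCoeff_partitionSeries (R : Type*) [CommRing R] :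
    constantCoeff (partitionSeries R) = 1 := by
  rw [← coeff_zero_eq_constantCoeff_apply, partitionSeries, statSeries, coeff_mk,
    Fintype.sum_unique]

theorem constantCoeff_contentSeries {R : Type*} [CommRing R] (q qi : R) :
    constantCoeff (contentSeries q qi) = 0 := by
  rw [← coeff_zero_eq_constantCoeff_apply, contentSeries, coeff_mk, Fintype.sum_unique,
    cells_of_zero, Finset.sum_empty]

variable (ha : a 0 * a 1 = 1) (hq : ∀ k : ℕ, 0 < k → (a 0 ^ 2) ^ k ≠ 1)

include ha hq

theorem hasValue_coeff_evalOneSeries (n : ℕ) :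
    HasValue a (coeff n (evalOneSeries (Omega 1))) (coeff n (partitionSeries L)) := by
  rw [evalOneSeries, coeff_map, Omega, coeff_mk, map_sum, partitionSeries, statSeries, coeff_mk]
  refine HasValue.sum _ fun l _ => ?_
  rw [map_mul, MvPolynomial.eval_C, ← mul_one (1 : L)]
  exact (hasValue_hookFun ha hq l).mul (hasValue_eval_one_macH ha hq l)

theorem hasValue_coeff_hookCoeffSeries (n : ℕ) :
    HasValue a (coeff n (hookCoeffSeries (Omega 1)))
      (coeff n (contentSeries (a 0 ^ 2) (a 0 ^ 2)⁻¹)) := by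
  rw [hookCoeffSeries, coeff_mk, Omega, coeff_mk, map_sum, contentSeries, coeff_mk]
  refine HasValue.sum _ fun l _ => ?_
  rw [← MvPolynomial.smul_eq_C_mul, map_smul, smul_eq_mul, ← one_mul (∑ s ∈ cells l, _)]
  exact (hasValue_hookFun ha hq l).mul (hasValue_hookCoeff_macH ha hq l)

theorem hasValue_bbH (n : ℕ) :
    HasValue a (bbH 1 (hookPartition n)) ((a 0 ^ 2 - 1) * (1 - (a 0 ^ 2)⁻¹) *
      coeff (n + 1) (contentSeries (a 0 ^ 2) (a 0 ^ 2)⁻¹ * (partitionSeries L)⁻¹)) := by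
  rw [bbH_hookPartition]
  exact (((hasValue_zv.pow 2).sub .one).mul (HasValue.one.sub (hasValue_wv_sq ha))).mul
    (HasValue.coeff_mul_inv (hasValue_coeff_hookCoeffSeries ha hq)
      (hasValue_coeff_evalOneSeries ha hq) (constantCoeff_evalOneSeries_Omega 1)
      (constantCoeff_partitionSeries L) _)

end ValueAtPoint

theorem map_partitionSeries {R S : Type*} [CommRing R] [CommRing S] (φ : R →+* S) :
    PowerSeries.map φ (partitionSeries R) = partitionSeries S := by
  ext n
  simp only [partitionSeries, statSeries, coeff_map, coeff_mk, map_sum, map_one]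

theorem map_contentSeries {R S : Type*} [CommRing R] [CommRing S] (φ : R →+* S) (q qi : R) :
    PowerSeries.map φ (contentSeries q qi) = contentSeries (φ q) (φ qi) := by
  ext n
  simp only [contentSeries, coeff_map, coeff_mk, map_sum, map_mul, map_pow]

end Specialisation

section EulerPoint

open PowerSeries
open HahnSeries (ofPowerSeries ofPowerSeries_X ofPowerSeries_injective single single_ne_zero)

theorem eulerPoint_mul : eulerPoint 0 * eulerPoint 1 = 1 := by
  change expU (1 / 2) * expU (-1 / 2) = 1
  rw [expU, expU, ← map_mul, neg_div, rescale_exp_mul_rescale_neg_exp, map_one]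

theorem eulerPoint_sq : eulerPoint 0 ^ 2 = ofPowerSeries ℤ ℚ (exp ℚ) := by
  change expU (1 / 2) ^ 2 = _
  rw [expU, ← map_pow, pow_two, exp_mul_exp_eq_exp_add, add_halves, rescale_one, RingHom.id_apply]

theorem eulerPoint_sq_pow_ne_one (k : ℕ) (hk : 0 < k) : (eulerPoint 0 ^ 2) ^ k ≠ 1 := by
  rw [eulerPoint_sq, ← map_pow]
  intro h
  have hexp : exp ℚ ^ k = 1 := ofPowerSeries_injective (h.trans (map_one _).symm)
  have hcoeff := congrArg (coeff 1) hexp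
  rw [coeff_exp_pow, coeff_one, if_neg one_ne_zero] at hcoeff
  exact hk.ne' (by simpa using hcoeff)

theorem eulerPoint_sq_inv : (eulerPoint 0 ^ 2)⁻¹ = ofPowerSeries ℤ ℚ (rescale (-1) (exp ℚ)) := by
  have hinv := rescale_exp_mul_rescale_neg_exp 1
  rw [rescale_one, RingHom.id_apply] at hinv
  rw [inv_eq_of_mul_eq_one_right]
  rw [eulerPoint_sq, ← map_mul, hinv, map_one]

theorem hasValue_bbH_eulerPoint (n : ℕ) : HasValue eulerPoint (bbH 1 (hookPartition n))
    ((eulerPoint 0 ^ 2 - 1) * (1 - (eulerPoint 0 ^ 2)⁻¹) * coeff (n + 1)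
      (contentSeries (eulerPoint 0 ^ 2) (eulerPoint 0 ^ 2)⁻¹ *
        (partitionSeries (LaurentSeries ℚ))⁻¹)) :=
  hasValue_bbH eulerPoint_mul eulerPoint_sq_pow_ne_one n

theorem partitionSeries_mul_hookSeries :
    partitionSeries (LaurentSeries ℚ) * hookSeries = partitionSeries (LaurentSeries ℚ) +
      C ((eulerPoint 0 ^ 2 - 1) * (1 - (eulerPoint 0 ^ 2)⁻¹)) *
        contentSeries (eulerPoint 0 ^ 2) (eulerPoint 0 ^ 2)⁻¹ := by
  set P := partitionSeries (LaurentSeries ℚ) with hP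
  set S := contentSeries (eulerPoint 0 ^ 2) (eulerPoint 0 ^ 2)⁻¹ with hS
  set c := (eulerPoint 0 ^ 2 - 1) * (1 - (eulerPoint 0 ^ 2)⁻¹)
  have hP0 : constantCoeff P ≠ 0 := by
    rw [hP, constantCoeff_partitionSeries]
    exact one_ne_zero
  have hookSeries_eq : hookSeries = 1 + C c * (S * P⁻¹) := by
    rw [hookSeries]
    congr 1
    ext1 n
    obtain _ | n := n
    · rw [coeff_zero_X_mul, coeff_C_mul, coeff_zero_eq_constantCoeff_apply, map_mul, hS,
        constantCoeff_contentSeries, zero_mul, mul_zero]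
    · rw [coeff_succ_X_mul, coeff_mk, coeff_C_mul, (hasValue_bbH_eulerPoint n).evalAt_eq]
  rw [hookSeries_eq]
  linear_combination C c * S * PowerSeries.mul_inv_cancel P hP0

theorem hookSeries_eq_map : hookSeries = PowerSeries.map (ofPowerSeries ℤ ℚ)
    (swapVars (PowerSeries.map C sinhQuot * expOf eisExponent)) := by
  have hP (R : Type) [CommRing R] [Nontrivial R] : partitionSeries R ≠ 0 := fun h =>
    one_ne_zero ((constantCoeff_partitionSeries R).symm.trans (h ▸ map_zero _))
  obtain ⟨H, hH⟩ : partitionSeries ℚ⟦X⟧ ∣ partitionSeries ℚ⟦X⟧ +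
      C ((exp ℚ - 1) * (1 - rescale (-1) (exp ℚ))) *
        contentSeries (exp ℚ) (rescale (-1) (exp ℚ)) := by
    refine (isUnit_iff_constantCoeff.2 ?_).dvd
    rw [constantCoeff_partitionSeries]
    exact isUnit_one
  rw [← eq_swapVars_of_partitionSeries_mul_eq hH.symm]
  refine mul_left_cancel₀ (hP (LaurentSeries ℚ)) ?_
  have hmap := congrArg (PowerSeries.map (ofPowerSeries ℤ ℚ)) hH
  rw [partitionSeries_mul_hookSeries, eulerPoint_sq_inv, eulerPoint_sq]
  simpa only [map_add, map_mul, map_sub, map_one, PowerSeries.map_C, map_partitionSeries,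
    map_contentSeries] using hmap

theorem map_swapVars (f : ℚ⟦X⟧⟦X⟧) :
    PowerSeries.map (ofPowerSeries ℤ ℚ) (swapVars f) = swapSeries f := by
  ext1 n
  rw [coeff_map, swapSeries, coeff_mk]
  congr 1
  ext m
  rw [coeff_coeff_swapVars, coeff_mk]

theorem ofPowerSeries_sinhQuot : ofPowerSeries ℤ ℚ sinhQuot =
    (single (1 : ℤ) (1 : ℚ) : LaurentSeries ℚ)⁻¹ * (expU (1 / 2) - expU (-1 / 2)) := by
  have hne : (single (1 : ℤ) (1 : ℚ) : LaurentSeries ℚ) ≠ 0 := single_ne_zero one_ne_zero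
  rw [eq_inv_mul_iff_mul_eq₀ hne, ← ofPowerSeries_X, ← map_mul, X_mul_sinhQuot, map_sub, expU, expU]

theorem coeffU_map_swapVars_of_neg {m : ℤ} (hm : m < 0) (f : ℚ⟦X⟧⟦X⟧) :
    coeffU m (PowerSeries.map (ofPowerSeries ℤ ℚ) (swapVars f)) = 0 := by
  ext n
  rw [coeffU, coeff_mk, coeff_map, map_zero]
  exact (PowerSeries.coeff_coe _ _).trans (if_pos hm)

theorem coeffU_map_swapVars_natCast (m : ℕ) (f : ℚ⟦X⟧⟦X⟧) :
    coeffU m (PowerSeries.map (ofPowerSeries ℤ ℚ) (swapVars f)) = coeff m f := by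
  ext n
  rw [coeffU, coeff_mk, coeff_map, LaurentSeries.coeff_coe_powerSeries, coeff_coeff_swapVars]

theorem coeffU_hookSeries_mem_quasiModular (m : ℤ) : coeffU m hookSeries ∈ quasiModular := by
  rw [hookSeries_eq_map]
  rcases lt_or_ge m 0 with hm | hm
  · exact coeffU_map_swapVars_of_neg hm _ ▸ zero_mem _
  · lift m to ℕ using hm
    exact coeffU_map_swapVars_natCast m _ ▸ coeff_map_C_mul_expOf_mem _ _

end EulerPoint

end CharVar

end

theorem mainTheorem6 :
    (∀ n : ℕ, CharVar.RegularAt (CharVar.bbH 1 (CharVar.hookPartition n)) CharVar.eulerPoint) ∧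
    CharVar.hookSeries =
      PowerSeries.C ((HahnSeries.single (1 : ℤ) (1 : ℚ) : LaurentSeries ℚ)⁻¹ *
          (CharVar.expU (1 / 2) - CharVar.expU (-1 / 2))) *
        CharVar.swapSeries (CharVar.expOf CharVar.eisExponent) ∧
    ∀ m : ℤ, CharVar.coeffU m CharVar.hookSeries ∈ CharVar.quasiModular := by
  refine ⟨fun n => (CharVar.hasValue_bbH_eulerPoint n).regularAt, ?_,
    CharVar.coeffU_hookSeries_mem_quasiModular⟩
  rw [CharVar.hookSeries_eq_map, map_mul, CharVar.swapVars_map_C, map_mul, PowerSeries.map_C,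
    CharVar.map_swapVars, CharVar.ofPowerSeries_sinhQuot]
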